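/- **Setting.** Fix a mass $m>0$. Minkowski space $\mathbb R^4$ has metric $g=\operatorname{diag}(1,-1,-1,-1)$, points $x=(x^0,\vec x)$, and $\mathrm{Past}=\{u\in\mathbb R^4: u_\mu u^\mu>0,\ u^0<0\}$; $\gamma^\mu$ are the Dirac matrices in the standard representation, $\slashed p=\gamma^\mu p_\mu$, and $\overline\phi=\phi^*\gamma^0$ for $\phi\in\mathbb C^4$. A Cauchy surface is a graph $\Sigma=\{\pi_\Sigma(\vec x)=(t_\Sigma(\vec x),\vec x):\vec x\in\mathbb R^3\}$ of a smooth $t_\Sigma:\mathbb R^3\to\mathbb R$ with $\sup|\nabla t_\Sigma|<1$. On $\Sigma$ one has $i_\gamma(d^4x)=\Gamma(\vec x)\,d^3\vec x$ with $\Gamma(\vec x)=\gamma^0-\sum_{k=1}^3\gamma^k\partial_kt_\Sigma(\vec x)$. $\mathcal H_\Sigma=L^2(\Sigma,\mathbb C^4)$ is the Hilbert space with scalar product $\langle\phi,\psi\rangle=\int_\Sigma\overline\phi(x)\,i_\gamma(d^4x)\,\psi(x)$, and $\mathcal C_\Sigma=C_c^\infty(\Sigma,\mathbb C^4)$. $P_\Sigma^-$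 is the orthogonal projector of $\mathcal H_\Sigma$ onto the closed subspace generated by the restrictions to $\Sigma$ of the negative energy solutions of the free Dirac equation, i.e. of the wave packets $$\Psi(x)=(2\pi)^{-3/2}\int_{\mathbb R^3}e^{-ip_\mu x^\mu}g(\vec p)\,\frac{m}{p^0}\,d^3\vec p,\qquad p^0=-\sqrt{|\vec p|^2+m^2},$$ with $g\in C_c^\infty(\mathbb R^3,\mathbb C^4)$ and $\slashed p\,g(\vec p)=m\,g(\vec p)$ for all $\vec p$. For $w\in\mathbb C^4$ with $-w_\mu w^\mu\notin(-\infty,0]$ let $r(w)=\sqrt{-w_\mu w^\mu}$ (principal root) and $$p^-(w)=\frac{-i\gamma^\mu\partial_\mu+m}{2m}D(w),\quad D(w)=-\frac{m^3}{2\pi^2}\frac{K_1(m\,r(w))}{m\,r(w)},\quad K_1(\xi)=\xi\int_1^\infty e^{-\xi s}\sqrt{s^2-1}\,ds\ \ (\operatorname{Re}\xi>0).$$ For $A=(A_\mu)\in C_c^\infty(\mathbb R^4,\mathbb R^4)$ let $\mathcal G(A)$ be the set of all $\lambda\in C^\infty(\mathbb R^4\times\mathbb R^4,\mathbb R)$ such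 that $\operatorname{supp}\lambda\subseteq K\times\mathbb R^4\cup\mathbb R^4\times K$ for some compact $K\subset\mathbb R^4$, and, for all $x\in\mathbb R^4$, $\lambda(x,x)=0$ and $\partial^x_\mu\lambda(x,y)=-\partial^y_\mu\lambda(x,y)=A_\mu(x)$ at $y=x$. **Lemma.** Let $m>0$, $0<V_{\max}<1$, $A\in C_c^\infty(\mathbb R^4,\mathbb R^4)$ and $\lambda\in\mathcal G(A)$. There is a constant $C$, depending only on $m$, $V_{\max}$ and $\lambda$, such that for every Cauchy surface $\Sigma$ with $\sup_{\vec x}|\nabla t_\Sigma(\vec x)|\le V_{\max}$ there is a bounded operator $P_\Sigma^\lambda:\mathcal H_\Sigma\to\mathcal H_\Sigma$ such that for all $u\in\mathrm{Past}$ and $\phi,\psi\in\mathcal C_\Sigma$ $$\langle\phi,P_\Sigma^\lambda\psi\rangle=\lim_{\varepsilon\downarrow0}\int_{x\in\Sigma}\overline\phi(x)\,i_\gamma(d^4x)\int_{y\in\Sigma}e^{-i\lambda(x,y)}\,p^-(y-x+i\varepsilon u)\,i_\gamma(d^4y)\,\psi(y).$$ In particular the limit does not depend on $u$. For each $u\in\mathrm{Past}$,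 $P_\Sigma^\lambda$ is the only bounded operator with these matrix elements for all $\phi,\psi\in\mathcal C_\Sigma$. Let $\Delta P_\Sigma^\lambda=P_\Sigma^\lambda-P_\Sigma^-$. For every $\psi\in\mathcal H_\Sigma$ and almost every $x\in\Sigma$, $$(\Delta P_\Sigma^\lambda\psi)(x)=\int_{y\in\Sigma}\bigl(e^{-i\lambda(x,y)}-1\bigr)\,p^-(y-x)\,i_\gamma(d^4y)\,\psi(y),$$ where the integral converges absolutely. Furthermore: (i) $\|P_\Sigma^\lambda\|\le C$; (ii) $\Delta P_\Sigma^\lambda$ is compact; (iii) $|\Delta P_\Sigma^\lambda|^2=(\Delta P_\Sigma^\lambda)^*\Delta P_\Sigma^\lambda$ is a Hilbert–Schmidt operator; (iv) if $\lambda(x,y)=-\lambda(y,x)$ for all $x,y\in\Sigma$, then $P_\Sigma^\lambda$ is self-adjoint. -/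

import Mathlib

open MeasureTheory Filter Topology Set
open scoped ContDiff InnerProductSpace Gradient

namespace DiracSea

noncomputable section

/-! ### Minkowski space, spinors and Dirac matrices -/

/-- Minkowski space-time `ℝ⁴`, with coordinates `x⁰, x¹, x², x³`. -/
abbrev Spacetime : Type := Fin 4 → ℝ

/-- The complexification `ℂ⁴` of space-time. -/
abbrev CSpacetime : Type := Fin 4 → ℂ

/-- Euclidean three-space. -/
abbrev Space : Type := EuclideanSpace ℝ (Fin 3)

/-- The space `ℂ⁴` of 4-spinors, with its standard Hermitian inner product. -/
abbrev Spinor : Type := EuclideanSpace ℂ (Fin 4)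

/-- The space-time point `(x⁰, x)`. -/
def point (x0 : ℝ) (x : Space) : Spacetime := ![x0, x 0, x 1, x 2]

/-- The diagonal entries of the metric tensor `diag(1, -1, -1, -1)`. -/
def metric : Fin 4 → ℝ := ![1, -1, -1, -1]

/-- The Minkowski product `v_μ w^μ` of real four-vectors. -/
def mink (v w : Spacetime) : ℝ := ∑ μ, metric μ * v μ * w μ

/-- The complex bilinear extension of the Minkowski square, `w_μ w^μ`. -/
def cminkSq (w : CSpacetime) : ℂ := ∑ μ, (metric μ : ℂ) * w μ * w μ

/-- The open set of past-directed time-like vectors. -/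
def Past : Set Spacetime := {u | 0 < mink u u ∧ u 0 < 0}

/-- The Dirac matrices `γ⁰, γ¹, γ², γ³` (upper index) in the standard representation. -/
def gam : Fin 4 → Matrix (Fin 4) (Fin 4) ℂ :=
  ![!![1, 0, 0, 0; 0, 1, 0, 0; 0, 0, -1, 0; 0, 0, 0, -1],
    !![0, 0, 0, 1; 0, 0, 1, 0; 0, -1, 0, 0; -1, 0, 0, 0],
    !![0, 0, 0, -Complex.I; 0, 0, Complex.I, 0; 0, Complex.I, 0, 0; -Complex.I, 0, 0, 0],
    !![0, 0, 1, 0; 0, 0, 0, -1; -1, 0, 0, 0; 0, 1, 0, 0]]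

/-- A `4 × 4` matrix acting on spinors. -/
def act (M : Matrix (Fin 4) (Fin 4) ℂ) : Spinor →L[ℂ] Spinor :=
  Matrix.toEuclideanCLM (n := Fin 4) (𝕜 := ℂ) M

/-- Feynman slash `γ^μ p_μ` of a real four-vector with components `p^μ`. -/
def slash (p : Spacetime) : Matrix (Fin 4) (Fin 4) ℂ :=
  ∑ μ, ((metric μ * p μ : ℝ) : ℂ) • gam μ

/-! ### Cauchy surfaces -/

/-- A Cauchy surface with tangent spaces bounded away from the light cone, given as the graph
`{(t x, x) | x ∈ ℝ³}` of a smooth function whose slope is bounded by a constant `< 1`. -/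
structure CauchySurface where
  /-- The height function. -/
  t : Space → ℝ
  smooth : ContDiff ℝ ∞ t
  spacelike : ∃ V : ℝ, V < 1 ∧ ∀ x, ‖∇ t x‖ ≤ V

namespace CauchySurface

variable (S : CauchySurface)

/-- The parametrization `x ↦ (t x, x)` of the surface. -/
def param (x : Space) : Spacetime := point (S.t x) x

/-- The surface as a subset of space-time. -/
def carrier : Set Spacetime := Set.range S.param

/-- The matrix `Γ(x) = γ⁰ - ∑ₖ γᵏ ∂ₖ t(x)`: the restriction of the matrix valued 3-form
`i_γ(d⁴x)` to the surface is `Γ(x) d³x` in the coordinates given by `param`. -/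
def Gam (x : Space) : Matrix (Fin 4) (Fin 4) ℂ :=
  gam 0 - ∑ k : Fin 3, ((∇ S.t x k : ℝ) : ℂ) • gam k.succ

end CauchySurface

/-! ### The Hilbert space of a Cauchy surface -/

/-- The matrix `∑ₖ vₖ γ⁰ γᵏ`; one has `γ⁰ Γ(x) = 1 - slopeMat (∇ t(x))`. -/
def slopeMat (v : Fin 3 → ℝ) : Matrix (Fin 4) (Fin 4) ℂ :=
  ∑ k : Fin 3, ((v k : ℝ) : ℂ) • (gam 0 * gam k.succ)

lemma gam_zero_sq : gam 0 * gam 0 = 1 := by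
  ext i j
  fin_cases i <;> fin_cases j <;>
    simp [gam, Matrix.mul_apply, Fin.sum_univ_four]

lemma gam_zero_mul_Gam (S : CauchySurface) (x : Space) :
    gam 0 * S.Gam x = 1 - slopeMat (fun k => ∇ S.t x k) := by
  simp [CauchySurface.Gam, slopeMat, mul_sub, gam_zero_sq, Finset.mul_sum]

lemma slopeMat_conjTranspose (v : Fin 3 → ℝ) : (slopeMat v).conjTranspose = slopeMat v := by
  ext i j
  fin_cases i <;> fin_cases j <;>
    simp [slopeMat, gam, Fin.sum_univ_three, Matrix.conjTranspose_apply, Matrix.sum_apply]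

lemma slopeMat_sq (v : Fin 3 → ℝ) :
    slopeMat v * slopeMat v = ((∑ k, v k ^ 2 : ℝ) : ℂ) • 1 := by
  ext i j
  fin_cases i <;> fin_cases j <;>
    simp [slopeMat, gam, Matrix.mul_apply, Fin.sum_univ_four, Fin.sum_univ_three] <;>
      ring_nf <;> simp

lemma act_one (ψ : Spinor) : act 1 ψ = ψ := by
  simp [act]

lemma act_sub (M N : Matrix (Fin 4) (Fin 4) ℂ) (ψ : Spinor) :
    act (M - N) ψ = act M ψ - act N ψ := by
  simp [act]

lemma act_mul (M N : Matrix (Fin 4) (Fin 4) ℂ) (ψ : Spinor) :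
    act (M * N) ψ = act M (act N ψ) := by
  simp [act]

lemma inner_act_left (M : Matrix (Fin 4) (Fin 4) ℂ) (φ ψ : Spinor) :
    ⟪act M φ, ψ⟫_ℂ = ⟪φ, act M.conjTranspose ψ⟫_ℂ := by
  have h : act M.conjTranspose = ContinuousLinearMap.adjoint (act M) := by
    have := map_star (Matrix.toEuclideanCLM (n := Fin 4) (𝕜 := ℂ)) M
    simpa [act, ContinuousLinearMap.star_eq_adjoint, Matrix.star_eq_conjTranspose] using this
  rw [h, ContinuousLinearMap.adjoint_inner_right]

lemma norm_act_slopeMat (v : Fin 3 → ℝ) (ψ : Spinor) :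
    ‖act (slopeMat v) ψ‖ = √(∑ k, v k ^ 2) * ‖ψ‖ := by
  have h0 : (0 : ℝ) ≤ ∑ k, v k ^ 2 := Finset.sum_nonneg fun _ _ => sq_nonneg _
  have h : ‖act (slopeMat v) ψ‖ ^ 2 = (√(∑ k, v k ^ 2) * ‖ψ‖) ^ 2 := by
    rw [mul_pow, Real.sq_sqrt h0]
    have h1 : ⟪act (slopeMat v) ψ, act (slopeMat v) ψ⟫_ℂ
        = ((∑ k, v k ^ 2 : ℝ) : ℂ) * ⟪ψ, ψ⟫_ℂ := by
      rw [inner_act_left, slopeMat_conjTranspose, ← act_mul, slopeMat_sq]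
      have : act (((∑ k, v k ^ 2 : ℝ) : ℂ) • 1) ψ = ((∑ k, v k ^ 2 : ℝ) : ℂ) • ψ := by
        simp [act]
      rw [this, inner_smul_right]
    rw [← inner_self_eq_norm_sq (𝕜 := ℂ), ← inner_self_eq_norm_sq (𝕜 := ℂ) ψ, h1]
    exact Complex.re_ofReal_mul _ _
  exact (sq_eq_sq₀ (norm_nonneg _) (by positivity)).1 h

namespace CauchySurface

variable (S : CauchySurface)

/-- The positive definite weight `γ⁰ Γ(x)` of the scalar product on the surface. -/
def weight (x : Space) : Spinor →L[ℂ] Spinor := act (gam 0 * S.Gam x)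

lemma norm_slope (x : Space) (ψ : Spinor) :
    ‖act (slopeMat (fun k => ∇ S.t x k)) ψ‖ = ‖∇ S.t x‖ * ‖ψ‖ := by
  rw [norm_act_slopeMat, EuclideanSpace.norm_eq (∇ S.t x)]
  simp only [Real.norm_eq_abs, sq_abs]

lemma weight_apply (x : Space) (ψ : Spinor) :
    S.weight x ψ = ψ - act (slopeMat (fun k => ∇ S.t x k)) ψ := by
  rw [weight, gam_zero_mul_Gam, act_sub, act_one]

lemma norm_weight_le (x : Space) (ψ : Spinor) : ‖S.weight x ψ‖ ≤ 2 * ‖ψ‖ := by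
  obtain ⟨V, hV, h⟩ := S.spacelike
  rw [weight_apply]
  refine (norm_sub_le _ _).trans ?_
  rw [norm_slope]
  nlinarith [h x, norm_nonneg ψ]

lemma inner_weight_symm (x : Space) (φ ψ : Spinor) :
    ⟪S.weight x φ, ψ⟫_ℂ = ⟪φ, S.weight x ψ⟫_ℂ := by
  rw [weight_apply, weight_apply, inner_sub_left, inner_sub_right, inner_act_left,
    slopeMat_conjTranspose]

lemma re_inner_weight_ge {V : ℝ} (h : ∀ x, ‖∇ S.t x‖ ≤ V) (x : Space) (ψ : Spinor) :
    (1 - V) * ‖ψ‖ ^ 2 ≤ RCLike.re ⟪ψ, S.weight x ψ⟫_ℂ := by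
  rw [weight_apply, inner_sub_right, map_sub, inner_self_eq_norm_sq]
  have h1 := (RCLike.re_le_norm _).trans
    (norm_inner_le_norm (𝕜 := ℂ) ψ (act (slopeMat (fun k => ∇ S.t x k)) ψ))
  rw [norm_slope] at h1
  nlinarith [mul_le_mul_of_nonneg_right (h x) (sq_nonneg ‖ψ‖)]

lemma continuous_gradient : Continuous (fun x => ∇ S.t x) := by
  have h : Continuous (fderiv ℝ S.t) := S.smooth.continuous_fderiv (by simp)
  exact (InnerProductSpace.toDual ℝ Space).symm.continuous.comp h

lemma continuous_weight : Continuous S.weight := by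
  have h : Continuous fun x => gam 0 * S.Gam x := by
    unfold Gam
    refine continuous_const.mul (continuous_const.sub ?_)
    refine continuous_finsetSum _ fun k _ => ?_
    have hk : Continuous fun x => ((∇ S.t x k : ℝ) : ℂ) := Complex.continuous_ofReal.comp
      ((EuclideanSpace.proj (𝕜 := ℝ) k).continuous.comp S.continuous_gradient)
    exact hk.smul (continuous_const (y := gam k.succ))
  have h2 : Continuous fun M : Matrix (Fin 4) (Fin 4) ℂ => act M :=
    LinearMap.continuous_of_finiteDimensional
      ((Matrix.toEuclideanCLM (n := Fin 4) (𝕜 := ℂ)).toAlgEquiv.toLinearMap)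
  exact h2.comp h

/-- The vector space of the Hilbert space `L²(Σ, ℂ⁴)` of a Cauchy surface: classes of square
integrable spinor fields, as functions of the coordinate `x ∈ ℝ³` of the point `(t x, x)`.
It carries the scalar product `innerL2` below (not the unweighted one). -/
def HilbertSpace (_S : CauchySurface) : Type := Lp Spinor 2 (volume : Measure Space)

instance : AddCommGroup S.HilbertSpace :=
  inferInstanceAs (AddCommGroup (Lp Spinor 2 (volume : Measure Space)))

instance : Module ℂ S.HilbertSpace :=
  inferInstanceAs (Module ℂ (Lp Spinor 2 (volume : Measure Space)))

variable {S}

/-- A representative of a vector of the Hilbert space, in the coordinate `x ∈ ℝ³`. -/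
def HilbertSpace.fn (ψ : S.HilbertSpace) : Space → Spinor :=
  ((show Lp Spinor 2 (volume : Measure Space) from ψ) : Space → Spinor)

lemma HilbertSpace.memLp (ψ : S.HilbertSpace) : MemLp ψ.fn 2 volume :=
  Lp.memLp (show Lp Spinor 2 (volume : Measure Space) from ψ)

lemma HilbertSpace.fn_add (φ ψ : S.HilbertSpace) :
    (φ + ψ).fn =ᵐ[volume] fun x => φ.fn x + ψ.fn x :=
  Lp.coeFn_add (show Lp Spinor 2 (volume : Measure Space) from φ) ψ

lemma HilbertSpace.fn_smul (c : ℂ) (ψ : S.HilbertSpace) :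
    (c • ψ).fn =ᵐ[volume] fun x => c • ψ.fn x :=
  Lp.coeFn_smul c (show Lp Spinor 2 (volume : Measure Space) from ψ)

variable (S)

/-- The vector of the Hilbert space given by a square integrable spinor field. -/
def toHilbert (f : Space → Spinor) (hf : MemLp f 2 volume) : S.HilbertSpace :=
  hf.toLp f

/-- The scalar product `∫_Σ φ̄(x) i_γ(d⁴x) ψ(x) = ∫_{ℝ³} φ(x)^* γ⁰ Γ(x) ψ(x) d³x`. -/
def innerL2 (φ ψ : S.HilbertSpace) : ℂ := ∫ x, ⟪φ.fn x, S.weight x (ψ.fn x)⟫_ℂ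

lemma memLp_weight {f : Space → Spinor} (hf : MemLp f 2 volume) :
    MemLp (fun x => S.weight x (f x)) 2 volume := by
  refine MemLp.of_le_mul (c := 2) hf ?_ (Eventually.of_forall fun x => S.norm_weight_le x _)
  exact (isBoundedBilinearMap_apply (𝕜 := ℂ) (E := Spinor) (F := Spinor)).continuous
    |>.comp_aestronglyMeasurable
      (S.continuous_weight.aestronglyMeasurable.prodMk hf.aestronglyMeasurable)

lemma integrable_inner (φ ψ : S.HilbertSpace) :
    Integrable (fun x => ⟪φ.fn x, S.weight x (ψ.fn x)⟫_ℂ) volume := by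
  have h1 := φ.memLp
  have h2 := S.memLp_weight ψ.memLp
  refine (L2.integrable_inner (𝕜 := ℂ) (h1.toLp _) (h2.toLp _)).congr ?_
  filter_upwards [h1.coeFn_toLp, h2.coeFn_toLp] with x e1 e2
  rw [e1, e2]

lemma re_innerL2_self_ge {V : ℝ} (h : ∀ x, ‖∇ S.t x‖ ≤ V) (ψ : S.HilbertSpace) :
    (1 - V) * ∫ x, ‖ψ.fn x‖ ^ 2 ≤ RCLike.re (S.innerL2 ψ ψ) := by
  rw [innerL2, ← integral_re (S.integrable_inner ψ ψ), ← integral_const_mul]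
  refine integral_mono_ae ?_ (S.integrable_inner ψ ψ).re
    (Eventually.of_forall fun x => S.re_inner_weight_ge h x _)
  exact (ψ.memLp.integrable_norm_pow (by norm_num)).const_mul _

lemma integral_norm_sq (ψ : S.HilbertSpace) :
    ∫ x, ‖ψ.fn x‖ ^ 2 = ‖(show Lp Spinor 2 (volume : Measure Space) from ψ)‖ ^ 2 := by
  rw [← inner_self_eq_norm_sq (𝕜 := ℂ), L2.inner_def, ← integral_re (L2.integrable_inner _ _)]
  refine integral_congr_ae (Eventually.of_forall fun x => ?_)
  simp only [inner_self_eq_norm_sq]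
  rfl

/-- The scalar product of a Cauchy surface as an inner product. -/
@[reducible] def core : InnerProductSpace.Core ℂ S.HilbertSpace where
  inner := S.innerL2
  conj_inner_symm φ ψ := by
    rw [innerL2, innerL2, ← integral_conj]
    refine integral_congr_ae (Eventually.of_forall fun x => ?_)
    simp only [inner_conj_symm]
    exact S.inner_weight_symm x _ _
  re_inner_nonneg ψ := by
    obtain ⟨V, hV, h⟩ := S.spacelike
    refine le_trans ?_ (S.re_innerL2_self_ge h ψ)
    exact mul_nonneg (by linarith) (integral_nonneg fun x => sq_nonneg _)
  add_left φ ψ χ := by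
    simp only [innerL2]
    rw [← integral_add (S.integrable_inner φ χ) (S.integrable_inner ψ χ)]
    refine integral_congr_ae ?_
    filter_upwards [HilbertSpace.fn_add φ ψ] with x hx
    rw [hx, inner_add_left]
  smul_left φ ψ c := by
    simp only [innerL2]
    rw [← integral_const_mul]
    refine integral_congr_ae ?_
    filter_upwards [HilbertSpace.fn_smul c φ] with x hx
    rw [hx, inner_smul_left]
  definite ψ hψ := by
    obtain ⟨V, hV, h⟩ := S.spacelike
    have h1 := S.re_innerL2_self_ge h ψ
    rw [S.integral_norm_sq, show S.innerL2 ψ ψ = 0 from hψ, map_zero] at h1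
    have h2 : ‖(show Lp Spinor 2 (volume : Measure Space) from ψ)‖ = 0 := by
      by_contra hne
      have : 0 < ‖(show Lp Spinor 2 (volume : Measure Space) from ψ)‖ ^ 2 := by positivity
      nlinarith
    exact norm_eq_zero.1 h2

instance : NormedAddCommGroup S.HilbertSpace := S.core.toNormedAddCommGroup

instance : InnerProductSpace ℂ S.HilbertSpace := InnerProductSpace.ofCore S.core.toCore

lemma inner_def (φ ψ : S.HilbertSpace) :
    ⟪φ, ψ⟫_ℂ = ∫ x, ⟪φ.fn x, S.weight x (ψ.fn x)⟫_ℂ := rfl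

lemma norm_sq_le (ψ : S.HilbertSpace) :
    ‖ψ‖ ^ 2 ≤ 2 * ‖(show Lp Spinor 2 (volume : Measure Space) from ψ)‖ ^ 2 := by
  rw [← S.integral_norm_sq, ← inner_self_eq_norm_sq (𝕜 := ℂ), inner_def,
    ← integral_re (S.integrable_inner ψ ψ), ← integral_const_mul]
  refine integral_mono_ae (S.integrable_inner ψ ψ).re
    ((ψ.memLp.integrable_norm_pow (by norm_num)).const_mul _) (Eventually.of_forall fun x => ?_)
  have h1 := (RCLike.re_le_norm _).trans
    (norm_inner_le_norm (𝕜 := ℂ) (ψ.fn x) (S.weight x (ψ.fn x)))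
  have h2 := S.norm_weight_le x (ψ.fn x)
  simp only
  nlinarith [norm_nonneg (ψ.fn x)]

instance : CompleteSpace S.HilbertSpace := by
  obtain ⟨V, hV, h⟩ := S.spacelike
  let e : Lp Spinor 2 (volume : Measure Space) ≃ₗ[ℂ] S.HilbertSpace :=
    LinearEquiv.refl ℂ (Lp Spinor 2 (volume : Measure Space))
  have h1 : ∀ x, ‖e x‖ ≤ √2 * ‖x‖ := fun x => by
    have := S.norm_sq_le (e x)
    refine abs_le_of_sq_le_sq' ?_ (by positivity) |>.2
    rw [mul_pow, Real.sq_sqrt (by norm_num)]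
    exact this
  have h2 : ∀ x, ‖e.symm x‖ ≤ √((1 - V)⁻¹) * ‖x‖ := fun x => by
    have h3 := S.re_innerL2_self_ge h x
    rw [S.integral_norm_sq] at h3
    have h4 : RCLike.re (S.innerL2 x x) = ‖x‖ ^ 2 := inner_self_eq_norm_sq (𝕜 := ℂ) x
    rw [h4] at h3
    have h5 : 0 < 1 - V := by linarith
    refine abs_le_of_sq_le_sq' ?_ (by positivity) |>.2
    rw [mul_pow, Real.sq_sqrt (by positivity), inv_mul_eq_div, le_div_iff₀ h5, mul_comm]
    exact h3
  let e' := e.toContinuousLinearEquivOfBounds _ _ h1 h2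
  exact (completeSpace_congr (e := e'.toEquiv) e'.isUniformEmbedding).1 inferInstance

/-- `C_c^∞(Σ, ℂ⁴)`, in the coordinate `x ∈ ℝ³`. -/
def _root_.DiracSea.TestSpinor : Type :=
  {f : Space → Spinor // ContDiff ℝ ∞ f ∧ HasCompactSupport f}

/-- A test spinor field as a vector of the Hilbert space of the surface. -/
def ofTest (f : TestSpinor) : S.HilbertSpace :=
  S.toHilbert f.1 (f.2.1.continuous.memLp_of_hasCompactSupport f.2.2)

end CauchySurface

/-! ### Negative energy solutions and the projector `P_Σ^-` -/

/-- The point of the negative mass shell `p_μ p^μ = m²`, `p⁰ < 0`, with spatial momentum `p`. -/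
def negShell (m : ℝ) (p : Space) : Spacetime := point (-√(‖p‖ ^ 2 + m ^ 2)) p

/-- The wave packet `Ψ(x) = (2π)^{-3/2} ∫_{M_-} e^{-ipx} g(p) i_p(d⁴p)/m` over the negative mass
shell, where `i_p(d⁴p) = (m²/p⁰) d³p`. -/
def wavePacket (m : ℝ) (g : Space → Spinor) (x : Spacetime) : Spinor :=
  (((2 * Real.pi) ^ (-(3 / 2) : ℝ) : ℝ) : ℂ) •
    ∫ p : Space, (Complex.exp (-Complex.I * (mink (negShell m p) x : ℝ)) *
      ((m / negShell m p 0 : ℝ) : ℂ)) • g p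

/-- A smooth negative energy solution of the free Dirac equation `(i∂̸ - m) Ψ = 0`: a wave packet
over the negative mass shell with smooth compactly supported amplitude `g` fulfilling the Dirac
equation `p̸ g(p) = m g(p)` in momentum space. -/
def IsNegEnergySolution (m : ℝ) (Ψ : Spacetime → Spinor) : Prop :=
  ∃ g : Space → Spinor, ContDiff ℝ ∞ g ∧ HasCompactSupport g ∧
    (∀ p, act (slash (negShell m p)) (g p) = (m : ℂ) • g p) ∧ Ψ = wavePacket m g

namespace CauchySurface

variable (S : CauchySurface)

/-- `H_Σ^-`: the closed subspace generated by the restrictions to the surface of the negative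
energy solutions of the free Dirac equation. -/
def negSpace (m : ℝ) : Submodule ℂ S.HilbertSpace :=
  (Submodule.span ℂ {ψ : S.HilbertSpace | ∃ Ψ : Spacetime → Spinor,
    IsNegEnergySolution m Ψ ∧ ψ.fn =ᵐ[volume] fun x => Ψ (S.param x)}).topologicalClosure

instance (m : ℝ) : CompleteSpace (S.negSpace m) :=
  inferInstanceAs (CompleteSpace (Submodule.topologicalClosure _))

/-- `P_Σ^-`: the orthogonal projector onto `H_Σ^-`. -/
def Pminus (m : ℝ) : S.HilbertSpace →L[ℂ] S.HilbertSpace := (S.negSpace m).starProjection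

end CauchySurface

/-! ### The kernel `p^-` -/

/-- `r(w) = √(-w_μ w^μ)`, the principal square root. -/
def rfun (w : CSpacetime) : ℂ := (-cminkSq w) ^ (1 / 2 : ℂ)

/-- The modified Bessel function of the second kind of order one, for `Re ξ > 0`. -/
def besselK1 (ξ : ℂ) : ℂ :=
  ξ * ∫ s in Set.Ioi (1 : ℝ), Complex.exp (-ξ * (s : ℂ)) * ((√(s ^ 2 - 1) : ℝ) : ℂ)

/-- `D(w) = -(m³ / 2π²) K₁(m r(w)) / (m r(w))`, an analytic function on the set of `w ∈ ℂ⁴`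
with `-w_μ w^μ ∉ (-∞, 0]`. -/
def Dfun (m : ℝ) (w : CSpacetime) : ℂ :=
  -((m : ℂ) ^ 3 / (2 * (Real.pi : ℂ) ^ 2)) * (besselK1 (m * rfun w) / (m * rfun w))

/-- `p^-(w) = (-i∂̸ + m)/(2m) D(w)` with `∂̸ = γ^μ ∂/∂w^μ` and complex partial derivatives. -/
def pminus (m : ℝ) (w : CSpacetime) : Matrix (Fin 4) (Fin 4) ℂ :=
  (1 / (2 * (m : ℂ))) •
    (-Complex.I • ∑ μ, (fderiv ℂ (Dfun m) w (Pi.single μ 1)) • gam μ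
      + ((m : ℂ) * Dfun m w) • (1 : Matrix (Fin 4) (Fin 4) ℂ))

/-- The complex four-vector `z + iεu`. -/
def shift (z : Spacetime) (ε : ℝ) (u : Spacetime) : CSpacetime :=
  fun μ => (z μ : ℂ) + Complex.I * (ε * u μ : ℝ)

/-! ### Local gauge functions and the regularized matrix elements -/

/-- The class `G(A)` of local gauge functions of the vector potential with components `A_μ`. -/
structure IsLocalGauge (A : Spacetime → Spacetime) (lam : Spacetime → Spacetime → ℝ) : Prop where
  smooth : ContDiff ℝ ∞ (Function.uncurry lam)
  support : ∃ K : Set Spacetime, IsCompact K ∧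
    tsupport (Function.uncurry lam) ⊆ (K ×ˢ Set.univ) ∪ (Set.univ ×ˢ K)
  diag : ∀ x, lam x x = 0
  deriv_fst : ∀ x μ, fderiv ℝ (fun x' => lam x' x) x (Pi.single μ 1) = A x μ
  deriv_snd : ∀ x μ, fderiv ℝ (fun y' => lam x y') x (Pi.single μ 1) = -A x μ

namespace CauchySurface

variable (S : CauchySurface)

/-- The regularized matrix element
`∫_{x∈Σ} φ̄(x) i_γ(d⁴x) ∫_{y∈Σ} e^{-iλ(x,y)} p^-(y-x+iεu) i_γ(d⁴y) ψ(y)`. -/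
def regElement (m : ℝ) (lam : Spacetime → Spacetime → ℝ) (ε : ℝ) (u : Spacetime)
    (φ ψ : TestSpinor) : ℂ :=
  ∫ x : Space, ⟪φ.1 x, act (gam 0 * S.Gam x) (∫ y : Space,
    Complex.exp (-Complex.I * (lam (S.param x) (S.param y) : ℝ)) •
      act (pminus m (shift (S.param y - S.param x) ε u) * S.Gam y) (ψ.1 y))⟫_ℂ

/-- The operator `P` has as matrix elements between test spinor fields the limits of the
regularized matrix elements in direction `u`. -/
def IsRegLimit (m : ℝ) (lam : Spacetime → Spacetime → ℝ) (u : Spacetime)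
    (P : S.HilbertSpace →L[ℂ] S.HilbertSpace) : Prop :=
  ∀ φ ψ : TestSpinor, Tendsto (fun ε : ℝ => S.regElement m lam ε u φ ψ) (𝓝[>] 0)
    (𝓝 ⟪S.ofTest φ, P (S.ofTest ψ)⟫_ℂ)

/-- The integrand `(e^{-iλ(x,y)} - 1) p^-(y-x) Γ(y) ψ(y)`, in the coordinates `x, y ∈ ℝ³`. -/
def diffIntegrand (m : ℝ) (lam : Spacetime → Spacetime → ℝ) (ψ : S.HilbertSpace)
    (x y : Space) : Spinor :=
  (Complex.exp (-Complex.I * (lam (S.param x) (S.param y) : ℝ)) - 1) •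
    act (pminus m (fun μ => ((S.param y - S.param x) μ : ℂ)) * S.Gam y) (ψ.fn y)

end CauchySurface

/-! ### Hilbert–Schmidt operators -/

/-- `T` is a Hilbert–Schmidt operator: `∑ᵢ ‖T eᵢ‖² < ∞` for every Hilbert basis. -/
def IsHilbertSchmidt {H : Type} [NormedAddCommGroup H] [InnerProductSpace ℂ H]
    (T : H →L[ℂ] H) : Prop :=
  ∀ (ι : Type) (b : HilbertBasis ι ℂ H), Summable fun i => ‖T (b i)‖ ^ 2

end

end DiracSea

open DiracSea

/-!
The operator is `P_Σ^λ = P_Σ^- + T`, where `T` is the integral operator on the surface with kernel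
`(e^{-iλ(x,y)} - 1) p^-(y - x) Γ(y)`. Since `λ` vanishes on the diagonal, the gauge factor removes
one power of the singularity of `p^-`, and since `λ` is supported over a compact set in one of its
arguments, it also localizes the kernel. Everything rests on two facts.

*Without gauge factor the regularized matrix elements converge to those of `P_Σ^-`.* The current
of two negative energy solutions is conserved, and wave packets with smooth compactly supported
amplitudes decay rapidly away from the light cone (non-stationary phase,
`norm_oscillatory_integral_le`). Hence the flux through the graph of `s t` does not depend on `s`
(`integral_fluxDensity_eq`), and with Plancherel's theorem at `s = 0` the restriction of wave
packets to the surface is a partial isometry `J` from `L²(ℝ³, ℂ⁴)` to the Hilbert space of the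
surface. Therefore `P_Σ^- = J J*` (`Pminus_apply`), and on test spinor fields the matrix elements
are `∫ ⟨φ̂(p), Π(p) ψ̂(p)⟩ d³p`, with `Π(p)` the negative spectral projector of the Dirac Hamiltonian
(`inner_Pminus_ofTest`). On the other side, for `Im w` in the past cone,
`p^-(w) γ⁰ = (2π)^{-3} ∫ e^{ipw} Π(p) d³p` (`act_pminus_gam_zero`): at Euclidean points this is an
explicit computation with Gaussian integrals (`integral_euclidean`), and it extends to the whole
tube by analytic continuation along complex lines (`Dfun_eq_shellIntegral`). So the regularization
amounts to a factor `e^{-ε p_μ u^μ}` in momentum space, which tends to `1` (`isRegLimit_Pminus`).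

*The kernel of `T` is small.* On space-like separated points, uniformly in the regularization,
`|p^-(y - x + iεu)| ≤ C |y - x|^{-3} e^{-c|y - x|}`, so the kernel with gauge factor is dominated by
`C |y - x|^{-2} e^{-c|y - x|} (1_B(x) + 1_B(y))` with a ball `B` (`exists_majorant`). The constants
depend on the surface only through the bound for its slope. The Schur test
(`SchurKernel`, `norm_kernelOp_le`) yields a uniform bound for `‖T‖` and the absolute convergence
of the integrals, and dominated convergence identifies `T` with the limit of the difference of the
regularized matrix elements (`tendsto_regElement_sub`). The kernel is not square integrable, as
`|z|^{-4}` is not integrable at the origin of `ℝ³`; but it is in `L^{4/3}`, jointly and uniformly in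
either variable, and by the Cauchy–Schwarz inequality this makes the kernel of `T^* T` square
integrable (`lintegral_sqMajorant_lt_top`). Bessel's inequality at each point then shows that
`T^* T` is a Hilbert–Schmidt operator (`isHilbertSchmidt_kernelOp`), and this implies that `T` is
compact (`isCompactOperator_of_isHilbertSchmidt`). If `λ` is antisymmetric then the kernel of `T` is
Hermitian, because `γ⁰ p^-(-z)^* = p^-(z) γ⁰` at space-like points (`diffKernel_symm`).

Uniqueness holds since the test spinor fields are dense.
-/

namespace DiracSea

noncomputable section

/-! ### The spectral projector of the Dirac Hamiltonian -/

/-- The relativistic energy `√(|p|² + m²)`. -/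
def energy (m : ℝ) (p : Space) : ℝ := √(‖p‖ ^ 2 + m ^ 2)

lemma energy_sq (m : ℝ) (p : Space) : energy m p ^ 2 = ‖p‖ ^ 2 + m ^ 2 :=
  Real.sq_sqrt (by positivity)

lemma energy_pos {m : ℝ} (hm : 0 < m) (p : Space) : 0 < energy m p :=
  Real.sqrt_pos.2 (by positivity)

lemma le_energy (m : ℝ) (p : Space) : m ≤ energy m p :=
  Real.le_sqrt_of_sq_le (by nlinarith [sq_nonneg ‖p‖])

lemma norm_le_energy (m : ℝ) (p : Space) : ‖p‖ ≤ energy m p :=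
  Real.le_sqrt_of_sq_le (by nlinarith [sq_nonneg m])

lemma contDiff_energy {m : ℝ} (hm : 0 < m) : ContDiff ℝ ∞ (energy m) := by
  unfold energy
  refine ContDiff.sqrt ((contDiff_norm_sq ℝ).add contDiff_const) fun p => ?_
  positivity

lemma continuous_energy (m : ℝ) : Continuous (energy m) := by
  unfold energy; fun_prop

/-- The Dirac Hamiltonian `∑ₖ pₖ γ⁰γᵏ + m γ⁰` in momentum space. -/
def diracHam (m : ℝ) (p : Space) : Matrix (Fin 4) (Fin 4) ℂ :=
  slopeMat (fun k => p k) + (m : ℂ) • gam 0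

/-- The orthogonal projector `(1 - H/E)/2` of `ℂ⁴` onto the negative spectral subspace of the
Dirac Hamiltonian, as a matrix. -/
def negProj (m : ℝ) (p : Space) : Matrix (Fin 4) (Fin 4) ℂ :=
  (1 / 2 : ℂ) • (1 - ((energy m p)⁻¹ : ℂ) • diracHam m p)

lemma gam_zero_conjTranspose : (gam 0).conjTranspose = gam 0 := by
  ext i j
  fin_cases i <;> fin_cases j <;> simp [gam, Matrix.conjTranspose_apply]

lemma gam_succ_mul_gam_zero (k : Fin 3) : gam k.succ * gam 0 = -(gam 0 * gam k.succ) := by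
  fin_cases k <;> ext i j <;> fin_cases i <;> fin_cases j <;>
    simp [gam, Matrix.mul_apply, Fin.sum_univ_four]

lemma slopeMat_mul_gam_zero (v : Fin 3 → ℝ) : slopeMat v * gam 0 = -(gam 0 * slopeMat v) := by
  simp only [slopeMat, Finset.sum_mul, Finset.mul_sum, ← Finset.sum_neg_distrib]
  refine Finset.sum_congr rfl fun k _ => ?_
  rw [smul_mul_assoc, mul_assoc, gam_succ_mul_gam_zero, mul_smul_comm, mul_neg, smul_neg]

lemma diracHam_sq (m : ℝ) (p : Space) :
    diracHam m p * diracHam m p = ((energy m p : ℂ) ^ 2) • 1 := by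
  have h1 := slopeMat_sq (fun k => p k)
  have h2 : ((energy m p : ℂ) ^ 2) = ((∑ k, p k ^ 2 : ℝ) : ℂ) + (m : ℂ) ^ 2 := by
    rw [← Complex.ofReal_pow, energy_sq, EuclideanSpace.norm_sq_eq]
    simp only [Real.norm_eq_abs, sq_abs]
    push_cast
    rfl
  rw [diracHam, add_mul, mul_add, mul_add, h1, h2, smul_mul_assoc, mul_smul_comm, smul_mul_assoc,
    mul_smul_comm, slopeMat_mul_gam_zero, gam_zero_sq, smul_smul, add_smul, pow_two]
  module

lemma diracHam_conjTranspose (m : ℝ) (p : Space) :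
    (diracHam m p).conjTranspose = diracHam m p := by
  rw [diracHam, Matrix.conjTranspose_add, slopeMat_conjTranspose, Matrix.conjTranspose_smul,
    gam_zero_conjTranspose]
  simp

lemma negProj_conjTranspose (m : ℝ) (p : Space) :
    (negProj m p).conjTranspose = negProj m p := by
  rw [negProj, Matrix.conjTranspose_smul, Matrix.conjTranspose_sub, Matrix.conjTranspose_smul,
    diracHam_conjTranspose, Matrix.conjTranspose_one, ← Complex.ofReal_inv]
  simp

lemma diracHam_mul_negProj {m : ℝ} (hm : 0 < m) (p : Space) :
    diracHam m p * negProj m p = -((energy m p : ℂ) • negProj m p) := by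
  have h : (energy m p : ℂ) ≠ 0 := by exact_mod_cast (energy_pos hm p).ne'
  rw [negProj, mul_smul_comm, mul_sub, mul_smul_comm, diracHam_sq, mul_one, smul_smul,
    smul_comm _ (1 / 2 : ℂ), ← smul_neg]
  congr 1
  rw [smul_sub, smul_smul, mul_inv_cancel₀ h, one_smul, pow_two, inv_mul_cancel_left₀ h]
  abel

lemma negProj_mul_self {m : ℝ} (hm : 0 < m) (p : Space) :
    negProj m p * negProj m p = negProj m p := by
  have h : (energy m p : ℂ) ≠ 0 := by exact_mod_cast (energy_pos hm p).ne'
  conv_lhs => enter [1]; rw [negProj]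
  rw [smul_mul_assoc, sub_mul, one_mul, smul_mul_assoc, diracHam_mul_negProj hm, smul_neg,
    smul_smul, inv_mul_cancel₀ h, one_smul, sub_neg_eq_add, ← two_smul ℂ, smul_smul]
  norm_num

lemma negShell_zero (m : ℝ) (p : Space) : negShell m p 0 = -energy m p := rfl

lemma negShell_succ (m : ℝ) (p : Space) (k : Fin 3) : negShell m p k.succ = p k := by
  fin_cases k <;> rfl

lemma metric_succ (k : Fin 3) : metric k.succ = -1 := by
  fin_cases k <;> rfl

lemma slash_negShell (m : ℝ) (p : Space) :
    slash (negShell m p) = -((energy m p : ℂ) • gam 0) - ∑ k : Fin 3, (p k : ℂ) • gam k.succ := by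
  rw [slash, Fin.sum_univ_succ]
  simp only [negShell_zero, negShell_succ, metric_succ]
  simp [metric, sub_eq_add_neg]

lemma gam_zero_mul_slash (m : ℝ) (p : Space) :
    gam 0 * slash (negShell m p) = -((energy m p : ℂ) • 1) - slopeMat (fun k => p k) := by
  rw [slash_negShell, mul_sub, mul_neg, mul_smul_comm, gam_zero_sq, slopeMat, Finset.mul_sum]
  simp only [mul_smul_comm]

/-- `(p̸ + m) γ⁰ = 2 p⁰ Π(p)` on the negative mass shell. -/
lemma slash_add_mul_gam_zero {m : ℝ} (hm : 0 < m) (p : Space) :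
    (slash (negShell m p) + (m : ℂ) • 1) * gam 0 = (-2 * energy m p : ℂ) • negProj m p := by
  have h : (energy m p : ℂ) ≠ 0 := by exact_mod_cast (energy_pos hm p).ne'
  have h2 : slash (negShell m p) * gam 0 = -((energy m p : ℂ) • 1) + slopeMat (fun k => p k) := by
    rw [slash_negShell, sub_mul, neg_mul, smul_mul_assoc, gam_zero_sq, slopeMat, Finset.sum_mul]
    simp only [smul_mul_assoc, gam_succ_mul_gam_zero, smul_neg, Finset.sum_neg_distrib]
    abel
  rw [add_mul, h2, negProj, smul_smul, smul_sub, smul_smul, smul_mul_assoc, one_mul, diracHam]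
  have h3 : (-2 * energy m p * (1 / 2) * (energy m p : ℂ)⁻¹) = -1 := by field_simp
  rw [h3]
  module

lemma slash_mul_negProj {m : ℝ} (hm : 0 < m) (p : Space) :
    slash (negShell m p) * negProj m p = (m : ℂ) • negProj m p := by
  have h1 : gam 0 * slash (negShell m p)
      = -((energy m p : ℂ) • 1) - diracHam m p + (m : ℂ) • gam 0 := by
    rw [gam_zero_mul_slash, diracHam]; abel
  have h2 : gam 0 * (slash (negShell m p) * negProj m p) = gam 0 * ((m : ℂ) • negProj m p) := by
    rw [← mul_assoc, h1, add_mul, sub_mul, diracHam_mul_negProj hm, mul_smul_comm,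
      smul_mul_assoc, neg_mul, smul_mul_assoc, one_mul]
    abel
  have h3 := congrArg (fun M => gam 0 * M) h2
  simpa only [← mul_assoc, gam_zero_sq, one_mul] using h3

lemma act_smul (c : ℂ) (M : Matrix (Fin 4) (Fin 4) ℂ) (ψ : Spinor) :
    act (c • M) ψ = c • act M ψ := by
  simp [act]

lemma act_add (M N : Matrix (Fin 4) (Fin 4) ℂ) (ψ : Spinor) :
    act (M + N) ψ = act M ψ + act N ψ := by
  simp [act]

lemma act_sum {ι : Type*} (s : Finset ι) (M : ι → Matrix (Fin 4) (Fin 4) ℂ) (ψ : Spinor) :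
    act (∑ i ∈ s, M i) ψ = ∑ i ∈ s, act (M i) ψ := by
  simp [act]

/-- `act` as a continuous linear map. -/
def actL : Matrix (Fin 4) (Fin 4) ℂ →ₗ[ℂ] Spinor →L[ℂ] Spinor :=
  (Matrix.toEuclideanCLM (n := Fin 4) (𝕜 := ℂ)).toAlgEquiv.toLinearMap

lemma continuous_act : Continuous fun M : Matrix (Fin 4) (Fin 4) ℂ => act M :=
  LinearMap.continuous_of_finiteDimensional actL

/-- The negative energy condition `p̸ v = m v` forces `Π(p) v = v`. -/
lemma negProj_eq_self {m : ℝ} (hm : 0 < m) (p : Space) (v : Spinor)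
    (hv : act (slash (negShell m p)) v = (m : ℂ) • v) : act (negProj m p) v = v := by
  have h : (energy m p : ℂ) ≠ 0 := by exact_mod_cast (energy_pos hm p).ne'
  have h1 : act (gam 0 * slash (negShell m p)) v = (m : ℂ) • act (gam 0) v := by
    rw [act_mul, hv, map_smul]
  have h2 : act (diracHam m p) v = -((energy m p : ℂ) • v) := by
    have h3 : diracHam m p = (m : ℂ) • gam 0 - gam 0 * slash (negShell m p)
        - (energy m p : ℂ) • 1 := by
      rw [gam_zero_mul_slash, diracHam]; abel
    rw [h3, act_sub, act_sub, h1, act_smul, act_smul, act_one]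
    abel
  rw [negProj, act_smul, act_sub, act_one, act_smul, h2, smul_neg, smul_smul, inv_mul_cancel₀ h,
    one_smul, sub_neg_eq_add, ← two_smul ℂ, smul_smul]
  norm_num

lemma act_slash_negProj {m : ℝ} (hm : 0 < m) (p : Space) (v : Spinor) :
    act (slash (negShell m p)) (act (negProj m p) v) = (m : ℂ) • act (negProj m p) v := by
  rw [← act_mul, slash_mul_negProj hm, act_smul]

lemma act_negProj_idem {m : ℝ} (hm : 0 < m) (p : Space) (v : Spinor) :
    act (negProj m p) (act (negProj m p) v) = act (negProj m p) v := by
  rw [← act_mul, negProj_mul_self hm]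

lemma inner_act_negProj (m : ℝ) (p : Space) (v w : Spinor) :
    ⟪act (negProj m p) v, w⟫_ℂ = ⟪v, act (negProj m p) w⟫_ℂ := by
  rw [inner_act_left, negProj_conjTranspose]

lemma norm_act_negProj_le {m : ℝ} (hm : 0 < m) (p : Space) (v : Spinor) :
    ‖act (negProj m p) v‖ ≤ ‖v‖ := by
  have h : ‖act (negProj m p) v‖ * ‖act (negProj m p) v‖ ≤ ‖v‖ * ‖act (negProj m p) v‖ := by
    rw [← inner_self_eq_norm_mul_norm (𝕜 := ℂ), inner_act_negProj, act_negProj_idem hm]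
    exact (RCLike.re_le_norm _).trans (norm_inner_le_norm _ _)
  by_cases h0 : ‖act (negProj m p) v‖ = 0
  · rw [h0]; positivity
  · exact le_of_mul_le_mul_right h (lt_of_le_of_ne (norm_nonneg _) (Ne.symm h0))

lemma contDiff_act_negProj {m : ℝ} (hm : 0 < m) :
    ContDiff ℝ ∞ fun p : Space => act (negProj m p) := by
  have hE : ContDiff ℝ ∞ fun p : Space => ((energy m p)⁻¹ : ℂ) := by
    have : ContDiff ℝ ∞ fun p : Space => (((energy m p)⁻¹ : ℝ) : ℂ) :=
      Complex.ofRealCLM.contDiff.comp ((contDiff_energy hm).inv fun p => (energy_pos hm p).ne')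
    simpa using this
  have hk : ∀ k : Fin 3, ContDiff ℝ ∞ fun p : Space => ((p k : ℝ) : ℂ) := fun k =>
    Complex.ofRealCLM.contDiff.comp (EuclideanSpace.proj (𝕜 := ℝ) k).contDiff
  have e : (fun p : Space => act (negProj m p)) = fun p => (1 / 2 : ℂ) • (act 1 -
      ((energy m p)⁻¹ : ℂ) • ((∑ k : Fin 3, ((p k : ℝ) : ℂ) • act (gam 0 * gam k.succ))
        + (m : ℂ) • act (gam 0))) := by
    funext p
    ext1 v
    simp only [negProj, diracHam, slopeMat, act_smul, act_sub, act_add, act_sum,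
      smul_apply, sub_apply, add_apply, sum_apply]
  rw [e]
  have hs : ContDiff ℝ ∞ fun p : Space =>
      ∑ k : Fin 3, ((p k : ℝ) : ℂ) • act (gam 0 * gam k.succ) :=
    ContDiff.sum fun k _ => (hk k).smul contDiff_const
  exact (contDiff_const.sub (hE.smul (hs.add contDiff_const))).const_smul (1 / 2 : ℂ)


/-! ### Wave packets: derivatives and the Dirac equation -/

/-- The superposition `∫ e^{-ipx} h(p) d³p` of plane waves over the negative mass shell. -/
def packet (m : ℝ) (h : Space → Spinor) (x : Spacetime) : Spinor :=
  ∫ p : Space, Complex.exp (-Complex.I * (mink (negShell m p) x : ℝ)) • h p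

lemma mink_point (m : ℝ) (p : Space) (x0 : ℝ) (x : Space) :
    mink (negShell m p) (point x0 x) = -(energy m p * x0 + ⟪p, x⟫_ℝ) := by
  rw [mink, Fin.sum_univ_succ]
  simp only [negShell_zero, negShell_succ, metric_succ, PiLp.inner_apply]
  have : ∀ k : Fin 3, point x0 x k.succ = x k := fun k => by fin_cases k <;> rfl
  simp only [this]
  simp [metric, point, Fin.sum_univ_three]
  ring

lemma point_eta (x : Spacetime) : point (x 0) (WithLp.toLp 2 fun k => x k.succ) = x := by
  ext μ; fin_cases μ <;> rfl

lemma continuous_negShell (m : ℝ) : Continuous (negShell m) := by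
  refine continuous_pi fun μ => ?_
  fin_cases μ
  · exact (continuous_energy m).neg
  · exact (EuclideanSpace.proj (𝕜 := ℝ) (0 : Fin 3)).continuous
  · exact (EuclideanSpace.proj (𝕜 := ℝ) (1 : Fin 3)).continuous
  · exact (EuclideanSpace.proj (𝕜 := ℝ) (2 : Fin 3)).continuous

/-- The functional `x ↦ p_μ x^μ`. -/
def minkL (p : Spacetime) : Spacetime →L[ℝ] ℝ :=
  ∑ μ, (metric μ * p μ) • ContinuousLinearMap.proj (R := ℝ) (φ := fun _ : Fin 4 => ℝ) μ

lemma minkL_apply (p x : Spacetime) : minkL p x = mink p x := by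
  simp [minkL, mink]

lemma continuous_minkL : Continuous minkL := by
  unfold minkL
  fun_prop

lemma continuous_mink_left (m : ℝ) (x : Spacetime) :
    Continuous fun p : Space => mink (negShell m p) x := by
  have := continuous_negShell m
  unfold mink
  fun_prop

lemma continuous_planeWave (m : ℝ) (x : Spacetime) :
    Continuous fun p : Space => Complex.exp (-Complex.I * (mink (negShell m p) x : ℝ)) := by
  have := continuous_mink_left m x
  fun_prop

lemma norm_exp_neg_I_mul (r : ℝ) : ‖Complex.exp (-Complex.I * (r : ℝ))‖ = 1 := by
  rw [Complex.norm_exp]; simp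

lemma norm_exp_I_mul (r : ℝ) : ‖Complex.exp (Complex.I * (r : ℝ))‖ = 1 := by
  rw [Complex.norm_exp]; simp

lemma integrable_packet (m : ℝ) {h : Space → Spinor} (hh : Integrable h) (x : Spacetime) :
    Integrable fun p : Space => Complex.exp (-Complex.I * (mink (negShell m p) x : ℝ)) • h p := by
  refine hh.norm.mono' ((continuous_planeWave m x).aestronglyMeasurable.smul
    hh.aestronglyMeasurable) ?_
  · exact Eventually.of_forall fun p => by rw [norm_smul, norm_exp_neg_I_mul, one_mul]

lemma norm_packet_le (m : ℝ) (h : Space → Spinor) (x : Spacetime) :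
    ‖packet m h x‖ ≤ ∫ p, ‖h p‖ := by
  refine (norm_integral_le_integral_norm _).trans (le_of_eq ?_)
  refine integral_congr_ae (Eventually.of_forall fun p => ?_)
  simp only [norm_smul, norm_exp_neg_I_mul, one_mul]

/-- The amplitude of the derivative of a wave packet in the direction `v`. -/
def derivAmp (m : ℝ) (v : Spacetime) (h : Space → Spinor) (p : Space) : Spinor :=
  (-Complex.I * (mink (negShell m p) v : ℝ)) • h p

lemma continuous_derivAmp (m : ℝ) (v : Spacetime) {h : Space → Spinor} (hh : Continuous h) :
    Continuous (derivAmp m v h) := by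
  have := continuous_mink_left m v
  unfold derivAmp
  fun_prop

lemma hasCompactSupport_derivAmp (m : ℝ) (v : Spacetime) {h : Space → Spinor}
    (hc : HasCompactSupport h) : HasCompactSupport (derivAmp m v h) :=
  HasCompactSupport.smul_left (f := fun p => -Complex.I * (mink (negShell m p) v : ℝ)) hc

lemma hasFDerivAt_packet (m : ℝ) {h : Space → Spinor} (hh : Continuous h)
    (hc : HasCompactSupport h) (x : Spacetime) :
    ∃ L : Spacetime →L[ℝ] Spinor, HasFDerivAt (packet m h) L x ∧
      ∀ v, L v = packet m (derivAmp m v h) x := by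
  have hi : Integrable h := hh.integrable_of_hasCompactSupport hc
  have hm1 : Continuous fun p : Space => minkL (negShell m p) :=
    continuous_minkL.comp (continuous_negShell m)
  let F' : Spacetime → Space → Spacetime →L[ℝ] Spinor := fun x p =>
    ((minkL (negShell m p)).smulRight
      ((Complex.exp (-Complex.I * (mink (negShell m p) x : ℝ)) * (-Complex.I)) • h p))
  have hF'c : ∀ x, Continuous (F' x) := fun x => by
    have h2 : Continuous fun p : Space =>
        ((Complex.exp (-Complex.I * (mink (negShell m p) x : ℝ)) * (-Complex.I)) • h p) :=
      ((continuous_planeWave m x).mul continuous_const).smul hh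
    exact (ContinuousLinearMap.smulRightL ℝ Spacetime Spinor).continuous₂.comp (hm1.prodMk h2)
  have hF'n : ∀ x p, ‖F' x p‖ = ‖minkL (negShell m p)‖ * ‖h p‖ := fun x p => by
    simp only [F', ContinuousLinearMap.norm_smulRight_apply, norm_smul, norm_mul,
      norm_exp_neg_I_mul, norm_neg, Complex.norm_I, one_mul]
  have hbc : Continuous fun p => ‖minkL (negShell m p)‖ * ‖h p‖ := by fun_prop
  have hbi : Integrable fun p => ‖minkL (negShell m p)‖ * ‖h p‖ :=
    hbc.integrable_of_hasCompactSupport hc.norm.mul_left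
  have key := hasFDerivAt_integral_of_dominated_of_fderiv_le (μ := (volume : Measure Space))
    (𝕜 := ℝ) (F := fun x p => Complex.exp (-Complex.I * (mink (negShell m p) x : ℝ)) • h p)
    (F' := F') (x₀ := x) (s := univ) (bound := fun p => ‖minkL (negShell m p)‖ * ‖h p‖) univ_mem
    (Eventually.of_forall fun y => (integrable_packet m hi y).aestronglyMeasurable)
    (integrable_packet m hi x) (hF'c x).aestronglyMeasurable
    (Eventually.of_forall fun p y _ => (hF'n y p).le) hbi
    (Eventually.of_forall fun p y _ => ?_)
  · refine ⟨_, key, fun v => ?_⟩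
    have hint : Integrable (F' x) := hbi.mono' (hF'c x).aestronglyMeasurable
      (Eventually.of_forall fun p => (hF'n x p).le)
    rw [ContinuousLinearMap.integral_apply hint, packet]
    refine integral_congr_ae (Eventually.of_forall fun p => ?_)
    simp only [F', ContinuousLinearMap.smulRight_apply, minkL_apply, derivAmp, smul_smul]
    rw [← Complex.coe_smul, smul_smul]
    congr 1
    ring
  · have h1 : HasFDerivAt (fun y => mink (negShell m p) y) (minkL (negShell m p)) y := by
      have := (minkL (negShell m p)).hasFDerivAt (x := y)
      simpa only [← minkL_apply] using this
    have h2 := ((Complex.ofRealCLM.hasFDerivAt.comp y h1).const_mul (-Complex.I)).cexp.smul_const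
      (h p)
    refine HasFDerivAt.congr_fderiv h2 ?_
    ext1 v
    simp only [F', ContinuousLinearMap.smulRight_apply, smul_apply,
      ContinuousLinearMap.comp_apply, Complex.ofRealCLM_apply, smul_eq_mul, Function.comp]
    rw [← Complex.coe_smul, smul_smul]
    congr 1
    ring

lemma continuous_packet (m : ℝ) {h : Space → Spinor} (hh : Continuous h)
    (hc : HasCompactSupport h) : Continuous (packet m h) :=
  continuous_iff_continuousAt.2 fun x =>
    let ⟨_, hL, _⟩ := hasFDerivAt_packet m hh hc x
    hL.continuousAt

lemma packet_act (m : ℝ) (M : Matrix (Fin 4) (Fin 4) ℂ) {h : Space → Spinor} (hh : Integrable h)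
    (x : Spacetime) : act M (packet m h x) = packet m (fun p => act M (h p)) x := by
  rw [packet, ← ContinuousLinearMap.integral_comp_comm _ (integrable_packet m hh x), packet]
  simp only [map_smul]

/-- The Dirac equation for wave packets over the negative mass shell. -/
lemma dirac_packet (m : ℝ) {h : Space → Spinor} (hh : Continuous h)
    (hc : HasCompactSupport h) (hs : ∀ p, act (slash (negShell m p)) (h p) = (m : ℂ) • h p)
    (x : Spacetime) :
    ∑ μ, act (gam μ) (packet m (derivAmp m (Pi.single μ 1) h) x)
      = (-Complex.I * m) • packet m h x := by
  have hi : ∀ μ, Integrable (derivAmp m (Pi.single μ 1) h) := fun μ =>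
    (continuous_derivAmp m _ hh).integrable_of_hasCompactSupport (hasCompactSupport_derivAmp m _ hc)
  have e1 : ∀ μ, act (gam μ) (packet m (derivAmp m (Pi.single μ 1) h) x)
      = ∫ p : Space, Complex.exp (-Complex.I * (mink (negShell m p) x : ℝ)) •
        act (gam μ) (derivAmp m (Pi.single μ 1) h p) := fun μ => by
    rw [packet_act m _ (hi μ)]; rfl
  simp only [e1]
  rw [← integral_finsetSum, packet, ← integral_smul]
  · refine integral_congr_ae (Eventually.of_forall fun p => ?_)
    simp only
    rw [← Finset.smul_sum, smul_comm]
    congr 1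
    have h2 := hs p
    rw [slash, act_sum] at h2
    rw [mul_smul, ← h2, Finset.smul_sum]
    refine Finset.sum_congr rfl fun μ _ => ?_
    rw [derivAmp, map_smul, act_smul, smul_smul]
    congr 3
    simp [mink, Pi.single_apply]
  · intro μ _
    exact integrable_packet m ((act (gam μ)).integrable_comp (hi μ)) x

/-- The bilinear current `⟨Ψ, γ⁰γ^μ Ψ'⟩` of two wave packets. -/
def current (m : ℝ) (h h' : Space → Spinor) (μ : Fin 4) (x : Spacetime) : ℂ :=
  ⟪packet m h x, act (gam 0 * gam μ) (packet m h' x)⟫_ℂ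

/-- The derivative of the current in the direction `v`. -/
def dcurrent (m : ℝ) (h h' : Space → Spinor) (μ : Fin 4) (v x : Spacetime) : ℂ :=
  ⟪packet m h x, act (gam 0 * gam μ) (packet m (derivAmp m v h') x)⟫_ℂ +
    ⟪packet m (derivAmp m v h) x, act (gam 0 * gam μ) (packet m h' x)⟫_ℂ

lemma continuous_current (m : ℝ) {h h' : Space → Spinor} (hh : Continuous h)
    (hc : HasCompactSupport h) (hh' : Continuous h') (hc' : HasCompactSupport h') (μ : Fin 4) :
    Continuous (current m h h' μ) :=
  (continuous_packet m hh hc).inner ((act _).continuous.comp (continuous_packet m hh' hc'))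

lemma continuous_dcurrent (m : ℝ) {h h' : Space → Spinor} (hh : Continuous h)
    (hc : HasCompactSupport h) (hh' : Continuous h') (hc' : HasCompactSupport h') (μ : Fin 4)
    (v : Spacetime) : Continuous (dcurrent m h h' μ v) :=
  (continuous_current m hh hc (continuous_derivAmp m v hh') (hasCompactSupport_derivAmp m v hc') μ
    ).add (continuous_current m (continuous_derivAmp m v hh) (hasCompactSupport_derivAmp m v hc)
      hh' hc' μ)

lemma hasFDerivAt_current (m : ℝ) {h h' : Space → Spinor} (hh : Continuous h)
    (hc : HasCompactSupport h) (hh' : Continuous h') (hc' : HasCompactSupport h') (μ : Fin 4)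
    (x : Spacetime) :
    ∃ L : Spacetime →L[ℝ] ℂ, HasFDerivAt (current m h h' μ) L x ∧
      ∀ v, L v = dcurrent m h h' μ v x := by
  obtain ⟨L, hL, e⟩ := hasFDerivAt_packet m hh hc x
  obtain ⟨L', hL', e'⟩ := hasFDerivAt_packet m hh' hc' x
  have h1 := ((act (gam 0 * gam μ)).restrictScalars ℝ).hasFDerivAt.comp x hL'
  refine ⟨_, hL.inner ℂ h1, fun v => ?_⟩
  simp [dcurrent, ← e, ← e', fderivInnerCLM_apply]

lemma gam_zero_mul_gam_conjTranspose (μ : Fin 4) :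
    (gam 0 * gam μ).conjTranspose = gam 0 * gam μ := by
  fin_cases μ <;> ext i j <;> fin_cases i <;> fin_cases j <;>
    simp [gam, Matrix.mul_apply, Fin.sum_univ_four, Matrix.conjTranspose_apply]

/-- Current conservation. -/
lemma sum_dcurrent (m : ℝ) {h h' : Space → Spinor} (hh : Continuous h)
    (hc : HasCompactSupport h) (hs : ∀ p, act (slash (negShell m p)) (h p) = (m : ℂ) • h p)
    (hh' : Continuous h') (hc' : HasCompactSupport h')
    (hs' : ∀ p, act (slash (negShell m p)) (h' p) = (m : ℂ) • h' p) (x : Spacetime) :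
    ∑ μ, dcurrent m h h' μ (Pi.single μ 1) x = 0 := by
  have h1 := dirac_packet m hh hc hs x
  have h2 := dirac_packet m hh' hc' hs' x
  simp only [dcurrent, Finset.sum_add_distrib]
  have e1 : ∀ μ, ⟪packet m (derivAmp m (Pi.single μ 1) h) x,
      act (gam 0 * gam μ) (packet m h' x)⟫_ℂ
      = ⟪act (gam 0) (act (gam μ) (packet m (derivAmp m (Pi.single μ 1) h) x)),
        packet m h' x⟫_ℂ := fun μ => by
    rw [← act_mul, inner_act_left, gam_zero_mul_gam_conjTranspose]
  simp only [e1]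
  simp only [act_mul]
  rw [← inner_sum, ← sum_inner, ← map_sum, ← map_sum, h1, h2, map_smul, map_smul,
    inner_smul_left, inner_smul_right, inner_act_left, gam_zero_conjTranspose]
  simp


/-! ### Decay of wave packets away from the light cone -/

/-- The phase `a E(p) + ⟨e, p⟩` of a wave packet in the direction of `(a, e)`. -/
def dirPhase (m : ℝ) (θ : Space × ℝ) (p : Space) : ℝ := θ.2 * energy m p + ⟪θ.1, p⟫_ℝ

/-- The derivative of `dirPhase` in the direction `e`. -/
def dirPhaseDeriv (m : ℝ) (q : (Space × ℝ) × Space) : ℝ :=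
  q.1.2 * (⟪q.1.1, q.2⟫_ℝ * (energy m q.2)⁻¹) + ⟪q.1.1, q.1.1⟫_ℝ

lemma hasFDerivAt_energy {m : ℝ} (hm : 0 < m) (p : Space) :
    ∃ L : Space →L[ℝ] ℝ, HasFDerivAt (energy m) L p ∧ ∀ v, L v = ⟪v, p⟫_ℝ * (energy m p)⁻¹ := by
  have h1 : HasFDerivAt (fun p : Space => ‖p‖ ^ 2 + m ^ 2) (2 • (innerSL ℝ) p) p :=
    (hasStrictFDerivAt_norm_sq p).hasFDerivAt.add_const _
  have h2 := h1.sqrt (by positivity)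
  refine ⟨_, h2, fun v => ?_⟩
  have h0 : energy m p ≠ 0 := (energy_pos hm p).ne'
  have h3 : √(‖p‖ ^ 2 + m ^ 2) = energy m p := rfl
  rw [h3]
  simp only [smul_apply, innerSL_apply_apply, real_inner_comm p v, smul_eq_mul, nsmul_eq_mul]
  field_simp
  simp

lemma hasFDerivAt_dirPhase {m : ℝ} (hm : 0 < m) (θ : Space × ℝ) (p : Space) :
    ∃ L : Space →L[ℝ] ℝ, HasFDerivAt (dirPhase m θ) L p ∧ L θ.1 = dirPhaseDeriv m (θ, p) := by
  obtain ⟨L, hL, e⟩ := hasFDerivAt_energy hm p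
  refine ⟨_, (hL.const_mul θ.2).add ((innerSL ℝ θ.1).hasFDerivAt), ?_⟩
  simp [dirPhaseDeriv, e]

lemma contDiff_dirPhaseDeriv {m : ℝ} (hm : 0 < m) : ContDiff ℝ ∞ (dirPhaseDeriv m) := by
  have hE : ContDiff ℝ ∞ fun q : (Space × ℝ) × Space => (energy m q.2)⁻¹ :=
    ((contDiff_energy hm).comp contDiff_snd).inv fun q => (energy_pos hm _).ne'
  have h1 : ContDiff ℝ ∞ fun q : (Space × ℝ) × Space => q.1.1 := contDiff_fst.comp contDiff_fst
  have h2 : ContDiff ℝ ∞ fun q : (Space × ℝ) × Space => q.1.2 := contDiff_snd.comp contDiff_fst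
  exact (h2.mul ((h1.inner ℝ contDiff_snd).mul hE)).add (h1.inner ℝ h1)

/-- The directions with speed at most `V`. -/
def directions (V : ℝ) : Set (Space × ℝ) := Metric.sphere 0 1 ×ˢ Icc (-V) V

lemma isCompact_directions (V : ℝ) : IsCompact (directions V) :=
  (isCompact_sphere 0 1).prod isCompact_Icc

lemma dirPhaseDeriv_ge {m : ℝ} (hm : 0 < m) {V : ℝ} {θ : Space × ℝ} (hθ : θ ∈ directions V)
    (p : Space) : 1 - V ≤ dirPhaseDeriv m (θ, p) := by
  obtain ⟨h1, h2⟩ := hθ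
  have h1 : ‖θ.1‖ = 1 := by simpa using h1
  have h3 : |⟪θ.1, p⟫_ℝ * (energy m p)⁻¹| ≤ 1 := by
    rw [abs_mul, abs_of_pos (inv_pos.2 (energy_pos hm p)), ← div_eq_mul_inv,
      div_le_one (energy_pos hm p)]
    refine (abs_real_inner_le_norm _ _).trans ?_
    rw [h1, one_mul]
    exact norm_le_energy m p
  have h4 : |θ.2 * (⟪θ.1, p⟫_ℝ * (energy m p)⁻¹)| ≤ V * 1 := by
    rw [abs_mul]
    have := abs_le.2 h2
    exact mul_le_mul this h3 (abs_nonneg _) ((abs_nonneg _).trans this)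
  have h5 := (abs_le.1 h4).1
  simp only [dirPhaseDeriv, real_inner_self_eq_norm_sq, h1]
  linarith

/-- A non-stationary phase estimate, uniform in the direction: each integration by parts along
`e` gains a factor `1/r`. -/
lemma norm_oscillatory_integral_le {m : ℝ} (hm : 0 < m) {V : ℝ} (hV : V < 1) {K : Set Space}
    (hK : IsCompact K) (N : ℕ) (b : (Space × ℝ) × Space → Spinor)
    (hb : ∀ θ ∈ directions V, ∀ p, ContDiffAt ℝ ∞ b (θ, p)) (hbK : ∀ θ, ∀ p ∉ K, b (θ, p) = 0) :
    ∃ C : ℝ, ∀ θ ∈ directions V, ∀ r > 0,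
      ‖∫ p, Complex.exp (Complex.I * (r * dirPhase m θ p : ℝ)) • b (θ, p)‖ ≤ C / r ^ N := by
  induction N generalizing b with
  | zero =>
    have hc : ContinuousOn b (directions V ×ˢ K) := fun q hq =>
      (hb q.1 hq.1 q.2).continuousAt.continuousWithinAt
    obtain ⟨C, hC⟩ := ((isCompact_directions V).prod hK).exists_bound_of_continuousOn hc
    refine ⟨|C| * (volume : Measure Space).real K, fun θ hθ r hr => ?_⟩
    rw [pow_zero, div_one]
    have h0 : ∀ p, p ∉ K → Complex.exp (Complex.I * (r * dirPhase m θ p : ℝ)) • b (θ, p) = 0 :=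
      fun p hp => by rw [hbK θ p hp, smul_zero]
    rw [← setIntegral_eq_integral_of_forall_compl_eq_zero h0]
    refine norm_setIntegral_le_of_norm_le_const hK.measure_lt_top fun p hp => ?_
    rw [norm_smul, norm_exp_I_mul, one_mul]
    exact (hC (θ, p) ⟨hθ, hp⟩).trans (le_abs_self C)
  | succ N ih =>
    -- The amplitude `b` is replaced by `b' = ∂ₑ(κ⁻¹ b)` with `κ = dirPhaseDeriv`; as a function on
    -- the compact set of directions times `K` it is again smooth and supported in `K`.
    let f : (Space × ℝ) × Space → Spinor := fun q => (dirPhaseDeriv m q)⁻¹ • b q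
    have hpos : ∀ θ ∈ directions V, ∀ p, 0 < dirPhaseDeriv m (θ, p) := fun θ hθ p =>
      lt_of_lt_of_le (by linarith) (dirPhaseDeriv_ge hm hθ p)
    have hf : ∀ θ ∈ directions V, ∀ p, ContDiffAt ℝ ∞ f (θ, p) := fun θ hθ p =>
      ((contDiff_dirPhaseDeriv hm).contDiffAt.inv (hpos θ hθ p).ne').smul (hb θ hθ p)
    let b' : (Space × ℝ) × Space → Spinor := fun q => fderiv ℝ f q (0, q.1.1)
    have hb' : ∀ θ ∈ directions V, ∀ p, ContDiffAt ℝ ∞ b' (θ, p) := fun θ hθ p => by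
      have h1 : ContDiffAt ℝ ∞ (fderiv ℝ f) (θ, p) := (hf θ hθ p).fderiv_right (by simp)
      have h2 : ContDiffAt ℝ ∞ (fun q : (Space × ℝ) × Space => ((0 : Space × ℝ), q.1.1)) (θ, p) :=
        contDiffAt_const.prodMk (contDiff_fst.comp contDiff_fst).contDiffAt
      exact h1.clm_apply h2
    have hb'K : ∀ θ, ∀ p ∉ K, b' (θ, p) = 0 := fun θ p hp => by
      have h1 : f =ᶠ[𝓝 (θ, p)] fun _ => 0 := by
        have : (univ : Set (Space × ℝ)) ×ˢ Kᶜ ∈ 𝓝 (θ, p) :=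
          prod_mem_nhds univ_mem (hK.isClosed.isOpen_compl.mem_nhds hp)
        filter_upwards [this] with q hq
        simp only [f, hbK q.1 q.2 hq.2, smul_zero]
      simp [b', h1.fderiv_eq]
    obtain ⟨C, hC⟩ := ih b' hb' hb'K
    refine ⟨C, fun θ hθ r hr => ?_⟩
    let g : Space → ℂ := fun p => Complex.exp (Complex.I * (r * dirPhase m θ p : ℝ))
    let fθ : Space → Spinor := fun p => f (θ, p)
    have hfθ : ContDiff ℝ ∞ fθ := contDiff_iff_contDiffAt.2 fun p =>
      (hf θ hθ p).comp p (contDiffAt_const.prodMk contDiffAt_id)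
    have hfK : ∀ p ∉ K, fθ p = 0 := fun p hp => by simp only [fθ, f, hbK θ p hp, smul_zero]
    have hfd : ∀ p, fderiv ℝ fθ p θ.1 = b' (θ, p) := fun p => by
      have h1 : HasFDerivAt f (fderiv ℝ f (θ, p)) (θ, p) :=
        ((hf θ hθ p).differentiableAt (by simp)).hasFDerivAt
      have h2 : HasFDerivAt (fun p : Space => (θ, p)) (ContinuousLinearMap.inr ℝ (Space × ℝ) Space)
          p := hasFDerivAt_prodMk_right θ p
      have h3 : HasFDerivAt fθ _ p := h1.comp p h2
      rw [h3.fderiv]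
      simp [b']
    have hgd : ∀ p, ∃ L : Space →L[ℝ] ℂ, HasFDerivAt g L p ∧
        L θ.1 = (Complex.I * r * dirPhaseDeriv m (θ, p)) * g p := fun p => by
      obtain ⟨L, hL, e⟩ := hasFDerivAt_dirPhase hm θ p
      have h1 : HasFDerivAt (fun p => ((r * dirPhase m θ p : ℝ) : ℂ)) _ p :=
        Complex.ofRealCLM.hasFDerivAt.comp p (hL.const_mul r)
      refine ⟨_, (h1.const_mul Complex.I).cexp, ?_⟩
      simp only [smul_apply, ContinuousLinearMap.comp_apply, e, smul_eq_mul,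
        Complex.ofRealCLM_apply, g]
      push_cast
      ring
    have hgc : Continuous g := continuous_iff_continuousAt.2 fun p =>
      let ⟨_, hL, _⟩ := hgd p
      hL.continuousAt
    have hκc : Continuous fun p => dirPhaseDeriv m (θ, p) :=
      (contDiff_dirPhaseDeriv hm).continuous.comp (continuous_const.prodMk continuous_id)
    have hgd' : ∀ p, fderiv ℝ g p θ.1 = (Complex.I * r * dirPhaseDeriv m (θ, p)) * g p :=
      fun p => by
        obtain ⟨L, hL, e⟩ := hgd p
        rw [hL.fderiv, e]
    have hb'c : Continuous fun p => b' (θ, p) := continuous_iff_continuousAt.2 fun p =>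
      ((hb' θ hθ p).continuousAt).comp (continuous_const.prodMk continuous_id).continuousAt
    -- `∂ₑ e^{irφ} = i r κ e^{irφ}`, so the derivative of the exponential absorbs the factor `κ⁻¹`
    -- in `f`.
    have ibp := integral_smul_fderiv_eq_neg_fderiv_smul_of_integrable
      (μ := (volume : Measure Space)) (f := g) (g := fθ) (v := θ.1) ?_ ?_ ?_
      (fun p _ => let ⟨_, hL, _⟩ := hgd p; hL.differentiableAt)
      (fun p _ => (hfθ.differentiable (by simp)) p)
    -- The three integrability side conditions follow after the main case.
    · simp only [hfd, hgd'] at ibp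
      have e1 : ∫ p, ((Complex.I * r * dirPhaseDeriv m (θ, p)) * g p) • fθ p
          = (Complex.I * r) • ∫ p, g p • b (θ, p) := by
        rw [← integral_smul]
        refine integral_congr_ae (Eventually.of_forall fun p => ?_)
        have hne : (dirPhaseDeriv m (θ, p) : ℂ) ≠ 0 := by exact_mod_cast (hpos θ hθ p).ne'
        simp only [fθ, f]
        rw [← Complex.coe_smul, smul_smul, smul_smul]
        congr 1
        push_cast
        field_simp
      rw [e1] at ibp
      have e2 := congrArg norm ibp
      rw [norm_neg, norm_smul, norm_mul, Complex.norm_I, one_mul, Complex.norm_real,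
        Real.norm_of_nonneg hr.le] at e2
      have h3 := hC θ hθ r hr
      have e3 : r * ‖∫ p, g p • b (θ, p)‖ ≤ C / r ^ N := by rw [← e2]; exact h3
      change ‖∫ p, g p • b (θ, p)‖ ≤ C / r ^ (N + 1)
      rw [pow_succ, ← div_div, le_div_iff₀ hr, mul_comm]
      exact e3
    · simp only [hgd']
      have hκ' : Continuous fun p => (Complex.I * r * dirPhaseDeriv m (θ, p)) * g p :=
        (continuous_const.mul (Complex.continuous_ofReal.comp hκc)).mul hgc
      exact (hκ'.smul hfθ.continuous).integrable_of_hasCompactSupport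
        (HasCompactSupport.intro hK fun p hp => by
          rw [Pi.smul_apply', hfK p hp, smul_zero])
    · simp only [hfd]
      exact (hgc.smul hb'c).integrable_of_hasCompactSupport
        (HasCompactSupport.intro hK fun p hp => by
          rw [Pi.smul_apply', hb'K θ p hp, smul_zero])
    · exact (hgc.smul hfθ.continuous).integrable_of_hasCompactSupport
        (HasCompactSupport.intro hK fun p hp => by
          rw [Pi.smul_apply', hfK p hp, smul_zero])

/-- Rapid decay of a wave packet in a region `|x⁰| ≤ c + V|x|` with `V < 1`. -/
lemma packet_decay {m : ℝ} (hm : 0 < m) {V c : ℝ} (hV : V < 1) (hc : 0 ≤ c)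
    {h : Space → Spinor} (hh : ContDiff ℝ ∞ h) (hcs : HasCompactSupport h) (N : ℕ) :
    ∃ C : ℝ, 0 ≤ C ∧ ∀ (x0 : ℝ) (x : Space), |x0| ≤ c + V * ‖x‖ →
      ‖packet m h (point x0 x)‖ ≤ C * ((1 + ‖x‖) ^ N)⁻¹ := by
  obtain ⟨C, hC⟩ := norm_oscillatory_integral_le hm (V := (1 + V) / 2) (by linarith) hcs N
    (fun q => h q.2) (fun θ _ p => (hh.comp contDiff_snd).contDiffAt)
    (fun θ p hp => image_eq_zero_of_notMem_tsupport hp)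
  set I := ∫ p, ‖h p‖
  have hI : 0 ≤ I := integral_nonneg fun p => norm_nonneg _
  set R := 2 * c / (1 - V) + 1
  have hR : 1 ≤ R := by
    have : 0 ≤ 2 * c / (1 - V) := div_nonneg (by linarith) (by linarith)
    simp only [R]; linarith
  have hC0 : 0 ≤ |C| * 2 ^ N + I * (1 + R) ^ N := by positivity
  refine ⟨|C| * 2 ^ N + I * (1 + R) ^ N, hC0, fun x0 x hx => ?_⟩
  rw [← div_eq_mul_inv, le_div_iff₀ (by positivity)]
  -- Beyond the radius `R` the constant `c` is absorbed into the larger slope `(1 + V) / 2`;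
  -- inside, the trivial bound by the `L¹` norm of the amplitude suffices.
  by_cases hxR : ‖x‖ ≤ R
  · calc ‖packet m h (point x0 x)‖ * (1 + ‖x‖) ^ N ≤ I * (1 + R) ^ N := by
          refine mul_le_mul (norm_packet_le m h _) ?_ (by positivity) hI
          gcongr
      _ ≤ _ := le_add_of_nonneg_left (by positivity)
  · push Not at hxR
    have hx1 : 1 < ‖x‖ := lt_of_le_of_lt hR hxR
    have hx0 : 0 < ‖x‖ := by linarith
    have hθ : (‖x‖⁻¹ • x, x0 / ‖x‖) ∈ directions ((1 + V) / 2) := by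
      refine ⟨by simp [norm_smul, hx0.ne'], abs_le.1 ?_⟩
      rw [abs_div, abs_norm, div_le_iff₀ hx0]
      have : 2 * c ≤ (1 - V) * ‖x‖ := by
        have h1 : 2 * c / (1 - V) < ‖x‖ := by simp only [R] at hxR; linarith
        rw [div_lt_iff₀ (by linarith)] at h1
        linarith
      linarith
    have h1 := hC _ hθ ‖x‖ hx0
    have h2 : packet m h (point x0 x) = ∫ p, Complex.exp (Complex.I *
        (‖x‖ * dirPhase m (‖x‖⁻¹ • x, x0 / ‖x‖) p : ℝ)) • h p := by
      refine integral_congr_ae (Eventually.of_forall fun p => ?_)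
      simp only
      congr 2
      have e1 : ‖x‖ * dirPhase m (‖x‖⁻¹ • x, x0 / ‖x‖) p = energy m p * x0 + ⟪p, x⟫_ℝ := by
        rw [dirPhase, real_inner_smul_left, real_inner_comm p x]
        field_simp
      rw [mink_point, e1]
      push_cast
      ring
    rw [← h2] at h1
    rw [le_div_iff₀ (by positivity)] at h1
    calc ‖packet m h (point x0 x)‖ * (1 + ‖x‖) ^ N
        ≤ ‖packet m h (point x0 x)‖ * (2 * ‖x‖) ^ N := by gcongr; linarith
      _ = ‖packet m h (point x0 x)‖ * ‖x‖ ^ N * 2 ^ N := by rw [mul_pow]; ring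
      _ ≤ |C| * 2 ^ N := by
          gcongr
          exact h1.trans (le_abs_self C)
      _ ≤ _ := le_add_of_nonneg_right (by positivity)


/-! ### Flux of a conserved current through Cauchy surfaces -/

/-- `(x⁰, x) ↦ point x⁰ x` as a linear map. -/
def pointL : ℝ × Space →L[ℝ] Spacetime :=
  ContinuousLinearMap.pi (Fin.cons (ContinuousLinearMap.fst ℝ ℝ Space) fun k : Fin 3 =>
    (EuclideanSpace.proj (𝕜 := ℝ) k).comp (ContinuousLinearMap.snd ℝ ℝ Space))

lemma pointL_apply (q : ℝ × Space) : pointL q = point q.1 q.2 := by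
  ext μ
  fin_cases μ <;> rfl

lemma continuous_point : Continuous fun q : ℝ × Space => point q.1 q.2 := by
  simpa only [← pointL_apply] using pointL.continuous

lemma point_one_zero : point 1 0 = Pi.single 0 1 := by
  ext μ; fin_cases μ <;> simp [point]

lemma point_zero_single (k : Fin 3) :
    point 0 (EuclideanSpace.single k 1) = Pi.single k.succ 1 := by
  ext μ
  fin_cases k <;> fin_cases μ <;> simp [point]

lemma point_eq_smul (a : ℝ) (x : Space) : point a x = a • point 1 0 + point 0 x := by
  ext μ
  fin_cases μ <;> simp [point]

/-- The point of the graph of `s t` above `x`; these graphs interpolate between the plane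
`x⁰ = 0` and the surface. -/
def CauchySurface.scaled (S : CauchySurface) (s : ℝ) (x : Space) : Spacetime := point (s * S.t x) x

lemma CauchySurface.scaled_one (S : CauchySurface) (x : Space) : S.scaled 1 x = S.param x := by
  rw [scaled, one_mul, param]

lemma CauchySurface.continuous_t (S : CauchySurface) : Continuous S.t := S.smooth.continuous

lemma CauchySurface.continuous_scaled (S : CauchySurface) :
    Continuous fun q : ℝ × Space => S.scaled q.1 q.2 :=
  continuous_point.comp ((continuous_fst.mul (S.continuous_t.comp continuous_snd)).prodMk
    continuous_snd)

lemma CauchySurface.continuous_param (S : CauchySurface) : Continuous S.param :=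
  continuous_point.comp (S.continuous_t.prodMk continuous_id)

lemma CauchySurface.hasFDerivAt_t (S : CauchySurface) (x : Space) :
    HasFDerivAt S.t (fderiv ℝ S.t x) x :=
  (S.smooth.differentiable (by simp) x).hasFDerivAt

lemma CauchySurface.gradient_apply (S : CauchySurface) (x : Space) (k : Fin 3) :
    ∇ S.t x k = fderiv ℝ S.t x (EuclideanSpace.single k 1) := by
  have h := InnerProductSpace.toDual_symm_apply (𝕜 := ℝ) (x := EuclideanSpace.single k (1 : ℝ))
    (y := fderiv ℝ S.t x)
  rw [← h, EuclideanSpace.inner_single_right]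
  simp [gradient]

lemma CauchySurface.continuous_gradient_apply (S : CauchySurface) (k : Fin 3) :
    Continuous fun x => ∇ S.t x k :=
  (EuclideanSpace.proj (𝕜 := ℝ) k).continuous.comp S.continuous_gradient

lemma CauchySurface.norm_fderiv (S : CauchySurface) (x : Space) : ‖fderiv ℝ S.t x‖ = ‖∇ S.t x‖ := by
  simp [gradient]

lemma CauchySurface.abs_t_sub_le (S : CauchySurface) {V : ℝ} (h : ∀ x, ‖∇ S.t x‖ ≤ V)
    (x y : Space) : |S.t y - S.t x| ≤ V * ‖y - x‖ :=
  Convex.norm_image_sub_le_of_norm_fderiv_le (𝕜 := ℝ) (s := univ)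
    (fun x _ => S.smooth.differentiable (by simp) x)
    (fun x _ => (S.norm_fderiv x).trans_le (h x)) convex_univ (mem_univ x) (mem_univ y)

lemma CauchySurface.exists_abs_t_le (S : CauchySurface) :
    ∃ V c : ℝ, 0 ≤ V ∧ V < 1 ∧ 0 ≤ c ∧ ∀ x, |S.t x| ≤ c + V * ‖x‖ := by
  obtain ⟨V, hV, h⟩ := S.spacelike
  refine ⟨V, |S.t 0|, (norm_nonneg _).trans (h 0), hV, abs_nonneg _, fun x => ?_⟩
  have h1 := S.abs_t_sub_le h 0 x
  rw [sub_zero] at h1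
  calc |S.t x| = |S.t 0 + (S.t x - S.t 0)| := by congr 1; ring
    _ ≤ _ := (abs_add_le _ _).trans (by linarith)

/-- The flux density of the current `j` through the graph of `s t`, with respect to `d³x`. -/
def fluxDensity (S : CauchySurface) (j : Fin 4 → Spacetime → ℂ) (s : ℝ) (x : Space) : ℂ :=
  j 0 (S.scaled s x) - s * ∑ k : Fin 3, (∇ S.t x k : ℂ) * j k.succ (S.scaled s x)

/-- The derivative of `fluxDensity` in `s`. -/
def fluxDensityDeriv (S : CauchySurface) (j : Fin 4 → Spacetime → ℂ)
    (dj : Fin 4 → Spacetime → Spacetime → ℂ) (s : ℝ) (x : Space) : ℂ :=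
  S.t x * dj 0 (Pi.single 0 1) (S.scaled s x) -
    (∑ k : Fin 3, (∇ S.t x k : ℂ) * j k.succ (S.scaled s x) +
      s * ∑ k : Fin 3, (∇ S.t x k : ℂ) * (S.t x * dj k.succ (Pi.single 0 1) (S.scaled s x)))

section flux

variable (S : CauchySurface) {j : Fin 4 → Spacetime → ℂ} {dj : Fin 4 → Spacetime → Spacetime → ℂ}

lemma hasDerivAt_current_scaled
    (hj : ∀ μ x, ∃ L : Spacetime →L[ℝ] ℂ, HasFDerivAt (j μ) L x ∧ ∀ v, L v = dj μ v x)
    (μ : Fin 4) (s : ℝ) (x : Space) :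
    HasDerivAt (fun s => j μ (S.scaled s x)) (S.t x * dj μ (Pi.single 0 1) (S.scaled s x)) s := by
  obtain ⟨L, hL, e⟩ := hj μ (S.scaled s x)
  have h1 : HasDerivAt (fun s : ℝ => pointL (s * S.t x, x)) (pointL (1 * S.t x, 0)) s :=
    pointL.hasFDerivAt.comp_hasDerivAt s (((hasDerivAt_id s).mul_const _).prodMk
      (hasDerivAt_const s x))
  simp only [pointL_apply] at h1
  have h2 := hL.comp_hasDerivAt s h1
  refine h2.congr_deriv ?_
  rw [one_mul, point_eq_smul, point_one_zero, ← e]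
  have : point 0 0 = 0 := by ext μ; fin_cases μ <;> rfl
  simp [this]

lemma hasDerivAt_fluxDensity
    (hj : ∀ μ x, ∃ L : Spacetime →L[ℝ] ℂ, HasFDerivAt (j μ) L x ∧ ∀ v, L v = dj μ v x)
    (s : ℝ) (x : Space) :
    HasDerivAt (fun s => fluxDensity S j s x) (fluxDensityDeriv S j dj s x) s := by
  have h1 : HasDerivAt (fun s => ∑ k : Fin 3, (∇ S.t x k : ℂ) * j k.succ (S.scaled s x))
      (∑ k : Fin 3, (∇ S.t x k : ℂ) * (S.t x * dj k.succ (Pi.single 0 1) (S.scaled s x))) s :=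
    HasDerivAt.fun_sum fun k _ => (hasDerivAt_current_scaled S hj k.succ s x).const_mul _
  have h2 : HasDerivAt (fun s : ℝ => (s : ℂ)) 1 s := Complex.ofRealCLM.hasDerivAt
  have h3 := (hasDerivAt_current_scaled S hj 0 s x).sub (h2.mul h1)
  refine h3.congr_deriv ?_
  rw [fluxDensityDeriv, one_mul]

lemma hasFDerivAt_flux_component
    (hj : ∀ μ x, ∃ L : Spacetime →L[ℝ] ℂ, HasFDerivAt (j μ) L x ∧ ∀ v, L v = dj μ v x)
    (s : ℝ) (x : Space) (k : Fin 3) : ∃ L : Space →L[ℝ] ℂ,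
      HasFDerivAt (fun x => (S.t x : ℂ) * j k.succ (S.scaled s x)) L x ∧
      L (EuclideanSpace.single k 1) = (∇ S.t x k : ℂ) * j k.succ (S.scaled s x) +
        S.t x * (s * (∇ S.t x k : ℂ) * dj k.succ (Pi.single 0 1) (S.scaled s x) +
          dj k.succ (Pi.single k.succ 1) (S.scaled s x)) := by
  have h1 : HasFDerivAt (fun x => pointL (s * S.t x, x)) (pointL.comp
      ((s • fderiv ℝ S.t x).prod (ContinuousLinearMap.id ℝ Space))) x :=
    pointL.hasFDerivAt.comp x (((S.hasFDerivAt_t x).const_mul s).prodMk (hasFDerivAt_id x))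
  obtain ⟨L, hL, e⟩ := hj k.succ (S.scaled s x)
  have e0 : ∀ x, S.scaled s x = pointL (s * S.t x, x) := fun x => (pointL_apply (_, _)).symm
  rw [e0] at hL
  have h3 := hL.comp x h1
  have h4 : HasFDerivAt (fun x => (S.t x : ℂ)) (Complex.ofRealCLM.comp (fderiv ℝ S.t x)) x :=
    Complex.ofRealCLM.hasFDerivAt.comp x (S.hasFDerivAt_t x)
  have h5 := h4.mul h3
  have e1 : (fun x => (S.t x : ℂ) * j k.succ (S.scaled s x)) =
      fun x => (S.t x : ℂ) * (j k.succ ∘ fun x => pointL (s * S.t x, x)) x := by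
    funext y
    simp only [Function.comp, e0]
  rw [e1]
  refine ⟨_, h5, ?_⟩
  simp only [add_apply, smul_apply, ContinuousLinearMap.comp_apply,
    ContinuousLinearMap.prod_apply, ContinuousLinearMap.id_apply,
    Complex.ofRealCLM_apply, ← S.gradient_apply, smul_eq_mul, Function.comp, ← e0]
  rw [pointL_apply, point_eq_smul, point_one_zero, point_zero_single, map_add, map_smul, e, e]
  simp only [Complex.real_smul]
  push_cast
  ring

lemma fderiv_flux_component
    (hj : ∀ μ x, ∃ L : Spacetime →L[ℝ] ℂ, HasFDerivAt (j μ) L x ∧ ∀ v, L v = dj μ v x)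
    (s : ℝ) (x : Space) (k : Fin 3) :
    fderiv ℝ (fun x => (S.t x : ℂ) * j k.succ (S.scaled s x)) x (EuclideanSpace.single k 1)
      = (∇ S.t x k : ℂ) * j k.succ (S.scaled s x) +
        S.t x * (s * (∇ S.t x k : ℂ) * dj k.succ (Pi.single 0 1) (S.scaled s x) +
          dj k.succ (Pi.single k.succ 1) (S.scaled s x)) := by
  obtain ⟨L, hL, e⟩ := hasFDerivAt_flux_component S hj s x k
  rw [hL.fderiv, e]

/-- The `s`-derivative of the flux density is a divergence. -/
lemma fluxDensityDeriv_eq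
    (hj : ∀ μ x, ∃ L : Spacetime →L[ℝ] ℂ, HasFDerivAt (j μ) L x ∧ ∀ v, L v = dj μ v x)
    (hdiv : ∀ x, ∑ μ, dj μ (Pi.single μ 1) x = 0) (s : ℝ) (x : Space) :
    fluxDensityDeriv S j dj s x = -∑ k : Fin 3,
      fderiv ℝ (fun x => (S.t x : ℂ) * j k.succ (S.scaled s x)) x (EuclideanSpace.single k 1) := by
  simp only [fderiv_flux_component S hj]
  have h4 := hdiv (S.scaled s x)
  rw [Fin.sum_univ_succ] at h4
  rw [fluxDensityDeriv, eq_neg_of_add_eq_zero_left h4]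
  simp only [Fin.sum_univ_three]
  ring

lemma continuous_fluxDensity (hjc : ∀ μ, Continuous (j μ)) :
    Continuous fun q : ℝ × Space => fluxDensity S j q.1 q.2 := by
  have h2 : ∀ k : Fin 3, Continuous fun q : ℝ × Space => ((∇ S.t q.2 k : ℝ) : ℂ) := fun k =>
    Complex.continuous_ofReal.comp ((S.continuous_gradient_apply k).comp continuous_snd)
  have h3 : ∀ μ, Continuous fun q : ℝ × Space => j μ (S.scaled q.1 q.2) := fun μ =>
    (hjc μ).comp S.continuous_scaled
  exact (h3 0).sub ((Complex.continuous_ofReal.comp continuous_fst).mul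
    (continuous_finsetSum _ fun k _ => (h2 k).mul (h3 k.succ)))

lemma continuous_fluxDensityDeriv (hjc : ∀ μ, Continuous (j μ))
    (hdjc : ∀ μ v, Continuous (dj μ v)) :
    Continuous fun q : ℝ × Space => fluxDensityDeriv S j dj q.1 q.2 := by
  have h2 : ∀ k : Fin 3, Continuous fun q : ℝ × Space => ((∇ S.t q.2 k : ℝ) : ℂ) := fun k =>
    Complex.continuous_ofReal.comp ((S.continuous_gradient_apply k).comp continuous_snd)
  have h3 : ∀ μ, Continuous fun q : ℝ × Space => j μ (S.scaled q.1 q.2) := fun μ =>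
    (hjc μ).comp S.continuous_scaled
  have h4 : ∀ μ v, Continuous fun q : ℝ × Space => dj μ v (S.scaled q.1 q.2) := fun μ v =>
    (hdjc μ v).comp S.continuous_scaled
  have h5 : Continuous fun q : ℝ × Space => (S.t q.2 : ℂ) :=
    Complex.continuous_ofReal.comp (S.continuous_t.comp continuous_snd)
  exact (h5.mul (h4 0 _)).sub ((continuous_finsetSum _ fun k _ => (h2 k).mul (h3 k.succ)).add
    ((Complex.continuous_ofReal.comp continuous_fst).mul
      (continuous_finsetSum _ fun k _ => (h2 k).mul (h5.mul (h4 k.succ _)))))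

/-- The derivative of the cut-off flux is carried by the gradient of the cut-off. -/
lemma hasDerivAt_cutoff_flux (hjc : ∀ μ, Continuous (j μ))
    (hj : ∀ μ x, ∃ L : Spacetime →L[ℝ] ℂ, HasFDerivAt (j μ) L x ∧ ∀ v, L v = dj μ v x)
    (hdjc : ∀ μ v, Continuous (dj μ v)) (hdiv : ∀ x, ∑ μ, dj μ (Pi.single μ 1) x = 0)
    {χ : Space → ℂ} (hχ : ContDiff ℝ ∞ χ) (hχc : HasCompactSupport χ) (s : ℝ) :
    HasDerivAt (fun s => ∫ x, χ x * fluxDensity S j s x)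
      (∑ k : Fin 3, ∫ x, fderiv ℝ χ x (EuclideanSpace.single k 1) *
        ((S.t x : ℂ) * j k.succ (S.scaled s x))) s := by
  have hqc : ∀ s, Continuous fun x => fluxDensity S j s x := fun s =>
    (continuous_fluxDensity S hjc).comp (continuous_const.prodMk continuous_id)
  have hdc := continuous_fluxDensityDeriv S hjc hdjc
  have hdc' : ∀ s, Continuous fun x => fluxDensityDeriv S j dj s x := fun s =>
    hdc.comp (continuous_const.prodMk continuous_id)
  obtain ⟨C, hC⟩ := (((isCompact_Icc (a := s - 1) (b := s + 1)).prod hχc).exists_bound_of_continuousOn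
    hdc.continuousOn)
  have key := hasDerivAt_integral_of_dominated_loc_of_deriv_le (μ := (volume : Measure Space))
    (F := fun s x => χ x * fluxDensity S j s x) (F' := fun s x => χ x * fluxDensityDeriv S j dj s x)
    (x₀ := s) (s := Icc (s - 1) (s + 1)) (bound := fun x => ‖χ x‖ * C)
    (Icc_mem_nhds (by linarith) (by linarith))
    (Eventually.of_forall fun s => (hχ.continuous.mul (hqc s)).aestronglyMeasurable)
    ((hχ.continuous.mul (hqc s)).integrable_of_hasCompactSupport hχc.mul_right)
    (hχ.continuous.mul (hdc' s)).aestronglyMeasurable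
    (Eventually.of_forall fun x s' hs' => by
      rw [norm_mul]
      by_cases hx : x ∈ tsupport χ
      · exact mul_le_mul_of_nonneg_left (hC (s', x) ⟨hs', hx⟩) (norm_nonneg _)
      · simp [image_eq_zero_of_notMem_tsupport hx])
    ((hχ.continuous.norm.mul continuous_const).integrable_of_hasCompactSupport hχc.norm.mul_right)
    (Eventually.of_forall fun x s' _ => (hasDerivAt_fluxDensity S hj s' x).const_mul _)
  refine key.2.congr_deriv ?_
  have hFd' : ∀ (k : Fin 3) x, DifferentiableAt ℝ
      (fun x => (S.t x : ℂ) * j k.succ (S.scaled s x)) x := fun k x =>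
    let ⟨_, hL, _⟩ := hasFDerivAt_flux_component S hj s x k
    hL.differentiableAt
  have hFc : ∀ k : Fin 3, Continuous fun x => (S.t x : ℂ) * j k.succ (S.scaled s x) := fun k =>
    continuous_iff_continuousAt.2 fun x => (hFd' k x).continuousAt
  have hχd : ∀ k : Fin 3, Continuous fun x => fderiv ℝ χ x (EuclideanSpace.single k 1) := fun k =>
    (hχ.continuous_fderiv (by simp)).clm_apply continuous_const
  have hFd : ∀ k : Fin 3, Continuous fun x => fderiv ℝ
      (fun x => (S.t x : ℂ) * j k.succ (S.scaled s x)) x (EuclideanSpace.single k 1) := fun k => by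
    simp only [fderiv_flux_component S hj]
    have h0 : Continuous fun x => S.scaled s x :=
      S.continuous_scaled.comp (continuous_const.prodMk continuous_id)
    have h2 : Continuous fun x => ((∇ S.t x k : ℝ) : ℂ) :=
      Complex.continuous_ofReal.comp (S.continuous_gradient_apply k)
    have h5 : Continuous fun x => (S.t x : ℂ) := Complex.continuous_ofReal.comp S.continuous_t
    exact (h2.mul ((hjc _).comp h0)).add (h5.mul (((continuous_const.mul h2).mul
      ((hdjc _ _).comp h0)).add ((hdjc _ _).comp h0)))
  have hibp : ∀ k : Fin 3, ∫ x, χ x * fderiv ℝ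
      (fun x => (S.t x : ℂ) * j k.succ (S.scaled s x)) x (EuclideanSpace.single k 1)
      = -∫ x, fderiv ℝ χ x (EuclideanSpace.single k 1) *
        ((S.t x : ℂ) * j k.succ (S.scaled s x)) := fun k => by
    refine integral_mul_fderiv_eq_neg_fderiv_mul_of_integrable ?_ ?_ ?_
      (fun x _ => hχ.differentiable (by simp) x)
      (fun x _ => hFd' k x)
    · exact ((hχd k).mul (hFc k)).integrable_of_hasCompactSupport
        (hχc.fderiv_apply (𝕜 := ℝ) _).mul_right
    · exact (hχ.continuous.mul (hFd k)).integrable_of_hasCompactSupport hχc.mul_right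
    · exact (hχ.continuous.mul (hFc k)).integrable_of_hasCompactSupport hχc.mul_right
  simp only [fluxDensityDeriv_eq S hj hdiv, mul_neg, Finset.mul_sum]
  rw [integral_neg, integral_finsetSum, ← Finset.sum_neg_distrib]
  · exact Finset.sum_congr rfl fun k _ => by rw [hibp k, neg_neg]
  · intro k _
    exact (hχ.continuous.mul (hFd k)).integrable_of_hasCompactSupport hχc.mul_right

end flux


lemma integrable_one_add_norm_pow_inv {n : ℕ} (hn : 3 < n) :
    Integrable fun x : Space => ((1 + ‖x‖) ^ n)⁻¹ := by
  have h := integrable_one_add_norm (E := Space) (μ := volume) (r := n)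
    (by rw [finrank_euclideanSpace_fin]; exact_mod_cast hn)
  refine h.congr (Eventually.of_forall fun x => ?_)
  simp only
  rw [Real.rpow_neg (by positivity), Real.rpow_natCast]

/-- A smooth cut-off, equal to `1` for `|x| ≤ n + 1` and to `0` for `|x| ≥ 2 (n + 1)`. -/
def cutoff (n : ℕ) (x : Space) : ℂ :=
  ((⟨1, 2, one_pos, one_lt_two⟩ : ContDiffBump (0 : Space)) (((n : ℝ) + 1)⁻¹ • x) : ℝ)

lemma contDiff_cutoff (n : ℕ) : ContDiff ℝ ∞ (cutoff n) :=
  Complex.ofRealCLM.contDiff.comp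
    ((ContDiffBump.contDiff _).comp (contDiff_const_smul (((n : ℝ) + 1)⁻¹)))

lemma norm_cutoff_le (n : ℕ) (x : Space) : ‖cutoff n x‖ ≤ 1 := by
  rw [cutoff, Complex.norm_real, Real.norm_of_nonneg (ContDiffBump.nonneg _)]
  exact ContDiffBump.le_one _

lemma hasCompactSupport_cutoff (n : ℕ) : HasCompactSupport (cutoff n) := by
  have h1 := (ContDiffBump.hasCompactSupport
    (⟨1, 2, one_pos, one_lt_two⟩ : ContDiffBump (0 : Space)))
  have h2 := h1.comp_homeomorph (Homeomorph.smulOfNeZero (((n : ℝ) + 1)⁻¹) (by positivity))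
  exact h2.comp_left (g := ((↑) : ℝ → ℂ)) Complex.ofReal_zero

lemma tendsto_cutoff (x : Space) : Tendsto (fun n => cutoff n x) atTop (𝓝 1) := by
  refine tendsto_const_nhds.congr' ?_
  filter_upwards [eventually_ge_atTop ⌈‖x‖⌉₊] with n hn
  rw [cutoff, ContDiffBump.one_of_mem_closedBall, Complex.ofReal_one]
  rw [mem_closedBall_zero_iff, norm_smul, norm_inv, Real.norm_of_nonneg (by positivity),
    inv_mul_eq_div]
  refine (div_le_one (by positivity)).2 ((Nat.le_ceil _).trans ?_)
  have : ((⌈‖x‖⌉₊ : ℕ) : ℝ) ≤ n := by exact_mod_cast hn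
  linarith

lemma norm_fderiv_cutoff_le :
    ∃ M : ℝ, 0 ≤ M ∧ ∀ n x, ‖fderiv ℝ (cutoff n) x‖ ≤ M / ((n : ℝ) + 1) := by
  let f : ContDiffBump (0 : Space) := ⟨1, 2, one_pos, one_lt_two⟩
  have hf : ContDiff ℝ ∞ fun x => ((f x : ℝ) : ℂ) := Complex.ofRealCLM.contDiff.comp f.contDiff
  have hfc : HasCompactSupport fun x => ((f x : ℝ) : ℂ) :=
    f.hasCompactSupport.comp_left (g := ((↑) : ℝ → ℂ)) Complex.ofReal_zero
  obtain ⟨M, hM⟩ := (hfc.fderiv (𝕜 := ℝ)).exists_bound_of_continuous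
    (hf.continuous_fderiv (by simp))
  refine ⟨M, (norm_nonneg _).trans (hM 0), fun n x => ?_⟩
  have h1 : HasFDerivAt (fun x : Space => (((n : ℝ) + 1)⁻¹ • x))
      ((((n : ℝ) + 1)⁻¹) • ContinuousLinearMap.id ℝ Space) x :=
    ((((n : ℝ) + 1)⁻¹) • ContinuousLinearMap.id ℝ Space).hasFDerivAt
  have h2 : HasFDerivAt (cutoff n) _ x :=
    ((hf.differentiable (by simp)) _).hasFDerivAt.comp x h1
  rw [h2.fderiv, ContinuousLinearMap.comp_smul, norm_smul, norm_inv,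
    Real.norm_of_nonneg (by positivity), ContinuousLinearMap.comp_id, inv_mul_eq_div]
  gcongr
  exact hM _

/-- The flux of a conserved, decaying current through a Cauchy surface is its flux through the
plane `x⁰ = 0`. -/
lemma integral_fluxDensity_eq (S : CauchySurface) {j : Fin 4 → Spacetime → ℂ}
    {dj : Fin 4 → Spacetime → Spacetime → ℂ} (hjc : ∀ μ, Continuous (j μ))
    (hj : ∀ μ x, ∃ L : Spacetime →L[ℝ] ℂ, HasFDerivAt (j μ) L x ∧ ∀ v, L v = dj μ v x)
    (hdjc : ∀ μ v, Continuous (dj μ v)) (hdiv : ∀ x, ∑ μ, dj μ (Pi.single μ 1) x = 0) {D : ℝ}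
    (hD : ∀ μ, ∀ s ∈ Icc (0 : ℝ) 1, ∀ x, ‖j μ (S.scaled s x)‖ ≤ D * ((1 + ‖x‖) ^ 6)⁻¹) :
    ∫ x, fluxDensity S j 1 x = ∫ x, fluxDensity S j 0 x := by
  obtain ⟨V, c, hV0, hV, hc, ht⟩ := S.exists_abs_t_le
  obtain ⟨V', hV', hg⟩ := S.spacelike
  obtain ⟨M, hM0, hM⟩ := norm_fderiv_cutoff_le
  have hD0 : 0 ≤ D := by
    have := (norm_nonneg _).trans (hD 0 0 ⟨le_rfl, zero_le_one⟩ 0)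
    simpa using this
  have hqc : ∀ s, Continuous fun x => fluxDensity S j s x := fun s =>
    (continuous_fluxDensity S hjc).comp (continuous_const.prodMk continuous_id)
  have hgk : ∀ x (k : Fin 3), ‖(∇ S.t x k : ℂ)‖ ≤ 1 := fun x k => by
    rw [Complex.norm_real]
    exact (PiLp.norm_apply_le (∇ S.t x) k).trans ((hg x).trans hV'.le)
  have hq : ∀ s ∈ Icc (0 : ℝ) 1, ∀ x, ‖fluxDensity S j s x‖ ≤ 4 * D * ((1 + ‖x‖) ^ 6)⁻¹ := by
    intro s hs x
    refine (norm_sub_le _ _).trans ?_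
    have h1 : ‖∑ k : Fin 3, (∇ S.t x k : ℂ) * j k.succ (S.scaled s x)‖
        ≤ ∑ k : Fin 3, D * ((1 + ‖x‖) ^ 6)⁻¹ := by
      refine norm_sum_le_of_le _ fun k _ => ?_
      rw [norm_mul]
      have := mul_le_mul (hgk x k) (hD k.succ s hs x) (norm_nonneg _) zero_le_one
      simpa using this
    have h2 : ‖(s : ℂ)‖ ≤ 1 := by
      rw [Complex.norm_real, Real.norm_of_nonneg hs.1]; exact hs.2
    have h3 := mul_le_mul h2 h1 (norm_nonneg _) zero_le_one
    rw [norm_mul]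
    have h4 := hD 0 s hs x
    simp only [Finset.sum_const, Finset.card_univ, Fintype.card_fin, nsmul_eq_mul] at h3
    push_cast at h3
    linarith
  have hlim : ∀ s ∈ Icc (0 : ℝ) 1, Tendsto (fun n => ∫ x, cutoff n x * fluxDensity S j s x) atTop
      (𝓝 (∫ x, fluxDensity S j s x)) := by
    intro s hs
    refine tendsto_integral_of_dominated_convergence (fun x => 4 * D * ((1 + ‖x‖) ^ 6)⁻¹)
      (fun n => ((contDiff_cutoff n).continuous.mul (hqc s)).aestronglyMeasurable)
      ((integrable_one_add_norm_pow_inv (by norm_num)).const_mul _) (fun n =>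
        Eventually.of_forall fun x => ?_) (Eventually.of_forall fun x => ?_)
    · rw [norm_mul]
      exact (mul_le_of_le_one_left (norm_nonneg _) (norm_cutoff_le n x)).trans (hq s hs x)
    · simpa using (tendsto_cutoff x).mul_const (fluxDensity S j s x)
  -- The gradient of the cut-off is `O(1/n)`, and the linear growth of `t` costs one of the six
  -- powers of the decay of the current.
  set B := 3 * (M * (c + 1) * D * ∫ x : Space, ((1 + ‖x‖) ^ 5)⁻¹)
  have hbd : ∀ n : ℕ, ‖(∫ x, cutoff n x * fluxDensity S j 1 x) -
      ∫ x, cutoff n x * fluxDensity S j 0 x‖ ≤ B / ((n : ℝ) + 1) := by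
    intro n
    refine norm_image_sub_le_of_norm_deriv_le_segment_01'
      (f := fun s => ∫ x, cutoff n x * fluxDensity S j s x)
      (fun s hs => (hasDerivAt_cutoff_flux S hjc hj hdjc hdiv (contDiff_cutoff n)
        (hasCompactSupport_cutoff n) s).hasDerivWithinAt) fun s hs => ?_
    have hs' : s ∈ Icc (0 : ℝ) 1 := ⟨hs.1, hs.2.le⟩
    refine (norm_sum_le_of_le (f := fun k : Fin 3 => ∫ x, fderiv ℝ (cutoff n) x
      (EuclideanSpace.single k 1) * ((S.t x : ℂ) * j k.succ (S.scaled s x))) _ (n := fun _ =>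
        (M * (c + 1) * D * ∫ x : Space, ((1 + ‖x‖) ^ 5)⁻¹) / ((n : ℝ) + 1)) fun k _ => ?_).trans
      (le_of_eq ?_)
    · have h1 : ∀ x, ‖fderiv ℝ (cutoff n) x (EuclideanSpace.single k 1) *
          ((S.t x : ℂ) * j k.succ (S.scaled s x))‖
          ≤ (M * (c + 1) * D) / ((n : ℝ) + 1) * ((1 + ‖x‖) ^ 5)⁻¹ := by
        intro x
        have e1 : ‖fderiv ℝ (cutoff n) x (EuclideanSpace.single k 1)‖ ≤ M / ((n : ℝ) + 1) := by
          have := (fderiv ℝ (cutoff n) x).le_opNorm (EuclideanSpace.single k (1 : ℝ))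
          simp only [PiLp.norm_single, norm_one, mul_one] at this
          exact this.trans (hM n x)
        have e2 : ‖(S.t x : ℂ)‖ ≤ (c + 1) * (1 + ‖x‖) := by
          rw [Complex.norm_real]
          refine (ht x).trans ?_
          nlinarith [norm_nonneg x, mul_nonneg hc (norm_nonneg x)]
        rw [norm_mul, norm_mul]
        refine (mul_le_mul e1 (mul_le_mul e2 (hD k.succ s hs' x) (norm_nonneg _) (by positivity))
          (by positivity) (by positivity)).trans (le_of_eq ?_)
        have : (1 + ‖x‖) ≠ 0 := by positivity
        field_simp
      refine (norm_integral_le_of_norm_le ((integrable_one_add_norm_pow_inv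
        (by norm_num)).const_mul _) (Eventually.of_forall h1)).trans (le_of_eq ?_)
      rw [integral_const_mul]
      ring
    · simp only [Finset.sum_const, Finset.card_univ, Fintype.card_fin, nsmul_eq_mul, B]
      push_cast
      ring
  have h0 : Tendsto (fun n => (∫ x, cutoff n x * fluxDensity S j 1 x) -
      ∫ x, cutoff n x * fluxDensity S j 0 x) atTop (𝓝 0) := by
    refine squeeze_zero_norm hbd ?_
    have := tendsto_one_div_add_atTop_nhds_zero_nat.const_mul B
    simpa [div_eq_mul_inv] using this
  have h1 := (hlim 1 ⟨zero_le_one, le_rfl⟩).sub (hlim 0 ⟨le_rfl, zero_le_one⟩)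
  exact sub_eq_zero.1 (tendsto_nhds_unique h1 h0)

/-- Decay of a wave packet on all the graphs of `s t`, `0 ≤ s ≤ 1`. -/
lemma packet_scaled_decay {m : ℝ} (hm : 0 < m) (S : CauchySurface) {h : Space → Spinor}
    (hh : ContDiff ℝ ∞ h) (hcs : HasCompactSupport h) (N : ℕ) :
    ∃ C : ℝ, 0 ≤ C ∧ ∀ s ∈ Icc (0 : ℝ) 1, ∀ x,
      ‖packet m h (S.scaled s x)‖ ≤ C * ((1 + ‖x‖) ^ N)⁻¹ := by
  obtain ⟨V, c, hV0, hV, hc, ht⟩ := S.exists_abs_t_le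
  obtain ⟨C, hC0, hC⟩ := packet_decay hm hV hc hh hcs N
  refine ⟨C, hC0, fun s hs x => hC _ x ?_⟩
  rw [abs_mul, abs_of_nonneg hs.1]
  exact (mul_le_of_le_one_left (abs_nonneg _) hs.2).trans (ht x)

/-- The scalar product of two negative energy wave packets does not depend on the surface: it is
the flux of their conserved current. -/
lemma integral_inner_packet_param {m : ℝ} (hm : 0 < m) (S : CauchySurface) {h h' : Space → Spinor}
    (hh : ContDiff ℝ ∞ h) (hc : HasCompactSupport h)
    (hs : ∀ p, act (slash (negShell m p)) (h p) = (m : ℂ) • h p)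
    (hh' : ContDiff ℝ ∞ h') (hc' : HasCompactSupport h')
    (hs' : ∀ p, act (slash (negShell m p)) (h' p) = (m : ℂ) • h' p) :
    ∫ x, ⟪packet m h (S.param x), S.weight x (packet m h' (S.param x))⟫_ℂ
      = ∫ x, ⟪packet m h (point 0 x), packet m h' (point 0 x)⟫_ℂ := by
  obtain ⟨C, hC0, hC⟩ := packet_scaled_decay hm S hh hc 3
  obtain ⟨C', hC0', hC'⟩ := packet_scaled_decay hm S hh' hc' 3
  have key := integral_fluxDensity_eq S (j := current m h h') (dj := dcurrent m h h')
    (D := (∑ μ, ‖act (gam 0 * gam μ)‖) * (C * C'))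
    (fun μ => continuous_current m hh.continuous hc hh'.continuous hc' μ)
    (fun μ x => hasFDerivAt_current m hh.continuous hc hh'.continuous hc' μ x)
    (fun μ v => continuous_dcurrent m hh.continuous hc hh'.continuous hc' μ v)
    (sum_dcurrent m hh.continuous hc hs hh'.continuous hc' hs') (fun μ s hs x => by
      have h1 : ‖act (gam 0 * gam μ)‖ ≤ ∑ μ, ‖act (gam 0 * gam μ)‖ :=
        Finset.single_le_sum (f := fun μ => ‖act (gam 0 * gam μ)‖) (fun _ _ => norm_nonneg _)
          (Finset.mem_univ μ)
      have h2 := norm_inner_le_norm (𝕜 := ℂ) (packet m h (S.scaled s x))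
        (act (gam 0 * gam μ) (packet m h' (S.scaled s x)))
      have h3 := (act (gam 0 * gam μ)).le_opNorm (packet m h' (S.scaled s x))
      have h4 := mul_le_mul h1 (hC' s hs x) (norm_nonneg _) ((norm_nonneg _).trans h1)
      calc _ ≤ _ := h2
        _ ≤ (C * ((1 + ‖x‖) ^ 3)⁻¹) *
            ((∑ μ, ‖act (gam 0 * gam μ)‖) * (C' * ((1 + ‖x‖) ^ 3)⁻¹)) :=
          mul_le_mul (hC s hs x) (h3.trans h4) (norm_nonneg _) (by positivity)
        _ = _ := by
          have : (1 + ‖x‖) ≠ 0 := by positivity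
          field_simp)
  have e1 : ∀ x, fluxDensity S (current m h h') 1 x
      = ⟪packet m h (S.param x), S.weight x (packet m h' (S.param x))⟫_ℂ := fun x => by
    simp only [fluxDensity, current, S.scaled_one, CauchySurface.weight, CauchySurface.Gam]
    rw [mul_sub, act_sub, inner_sub_right, Finset.mul_sum, Finset.mul_sum, act_sum, inner_sum]
    simp only [mul_smul_comm, act_smul, inner_smul_right]
    simp
  have e0 : ∀ x, fluxDensity S (current m h h') 0 x
      = ⟪packet m h (point 0 x), packet m h' (point 0 x)⟫_ℂ := fun x => by
    simp [fluxDensity, current, CauchySurface.scaled, gam_zero_sq, act_one]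
  simpa only [e1, e0] using key

open scoped FourierTransform in
/-- Plancherel's theorem for wave packets at time zero. -/
lemma integral_inner_packet_zero (m : ℝ) {h h' : Space → Spinor}
    (hh : ContDiff ℝ ∞ h) (hc : HasCompactSupport h)
    (hh' : ContDiff ℝ ∞ h') (hc' : HasCompactSupport h') :
    ∫ x, ⟪packet m h (point 0 x), packet m h' (point 0 x)⟫_ℂ
      = ((2 * Real.pi) ^ 3 : ℝ) * ∫ p, ⟪h p, h' p⟫_ℂ := by
  have e : ∀ (f : Space → Spinor) x, packet m f (point 0 x) = 𝓕 f ((-(2 * Real.pi)⁻¹) • x) := by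
    intro f x
    rw [Real.fourier_eq', packet]
    refine integral_congr_ae (Eventually.of_forall fun p => ?_)
    simp only
    congr 2
    rw [mink_point, inner_smul_right]
    have : (Real.pi : ℂ) ≠ 0 := by exact_mod_cast Real.pi_ne_zero
    push_cast
    field_simp
    ring
  simp only [e]
  -- Mathlib's Fourier transform has the phase `2π⟨x, p⟩`, hence the dilation by `(2π)⁻¹`.
  rw [Measure.integral_comp_smul volume (fun y => ⟪𝓕 h y, 𝓕 h' y⟫_ℂ)]
  have hpl := SchwartzMap.integral_inner_fourier_fourier (hc.toSchwartzMap hh)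
    (hc'.toSchwartzMap hh')
  simp only [SchwartzMap.fourier_coe] at hpl
  have e2 : ((hc.toSchwartzMap hh : SchwartzMap Space Spinor) : Space → Spinor) = h := rfl
  have e3 : ((hc'.toSchwartzMap hh' : SchwartzMap Space Spinor) : Space → Spinor) = h' := rfl
  rw [e2, e3] at hpl
  rw [hpl, finrank_euclideanSpace_fin, Complex.real_smul]
  congr 2
  rw [neg_pow, inv_pow, mul_inv, inv_inv, abs_mul, abs_of_pos (a := (2 * Real.pi) ^ 3)
    (by positivity)]
  norm_num


/-! ### The projector onto the negative energy solutions -/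

/-- The normalization constant `(2π)^{-3/2}` of the Fourier transform. -/
def fourierConst : ℝ := (2 * Real.pi) ^ (-(3 / 2) : ℝ)

lemma fourierConst_pos : 0 < fourierConst := by unfold fourierConst; positivity

lemma fourierConst_sq : fourierConst ^ 2 * (2 * Real.pi) ^ 3 = 1 := by
  have h : (0 : ℝ) < 2 * Real.pi := by positivity
  rw [fourierConst, ← Real.rpow_natCast, ← Real.rpow_mul h.le, ← Real.rpow_natCast (2 * Real.pi),
    ← Real.rpow_add h]
  norm_num

/-- Smooth compactly supported spinor fields on momentum space. -/
def testFun : Submodule ℂ (Space → Spinor) where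
  carrier := {h | ContDiff ℝ ∞ h ∧ HasCompactSupport h}
  zero_mem' := ⟨contDiff_const, HasCompactSupport.zero⟩
  add_mem' ha hb := ⟨ha.1.add hb.1, ha.2.add hb.2⟩
  smul_mem' c _ ha := ⟨ha.1.const_smul c, ha.2.smul_left (f := fun _ => c)⟩

lemma testFun.memLp (h : testFun) : MemLp h.1 2 (volume : Measure Space) :=
  h.2.1.continuous.memLp_of_hasCompactSupport h.2.2

/-- Test spinor fields as vectors of `L²`. -/
def testToLp : testFun →ₗ[ℂ] Lp Spinor 2 (volume : Measure Space) where
  toFun h := (testFun.memLp h).toLp h.1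
  map_add' _ _ := rfl
  map_smul' _ _ := rfl

lemma testToLp_coe (h : testFun) : testToLp h =ᵐ[volume] h.1 := (testFun.memLp h).coeFn_toLp

lemma denseRange_testToLp : DenseRange testToLp := by
  refine (Lp.dense_hasCompactSupport_contDiff (F := Spinor) (μ := (volume : Measure Space))
    (p := 2) (by norm_num)).mono ?_
  rintro f ⟨g, hfg, hg, hg'⟩
  refine ⟨⟨g, hg', hg⟩, ?_⟩
  exact Lp.ext ((testToLp_coe _).trans hfg.symm)

lemma inner_testToLp (f : Lp Spinor 2 (volume : Measure Space)) (h : testFun) :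
    ⟪f, testToLp h⟫_ℂ = ∫ p, ⟪f p, h.1 p⟫_ℂ := by
  rw [L2.inner_def]
  refine integral_congr_ae ?_
  filter_upwards [testToLp_coe h] with p hp
  rw [hp]

lemma inner_testToLp_testToLp (h h' : testFun) :
    ⟪testToLp h, testToLp h'⟫_ℂ = ∫ p, ⟪h.1 p, h'.1 p⟫_ℂ := by
  rw [inner_testToLp]
  refine integral_congr_ae ?_
  filter_upwards [testToLp_coe h] with p hp
  rw [hp]

/-- The negative energy part of an amplitude. -/
def negPart (m : ℝ) (h : Space → Spinor) (p : Space) : Spinor := act (negProj m p) (h p)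

lemma contDiff_negPart {m : ℝ} (hm : 0 < m) {h : Space → Spinor} (hh : ContDiff ℝ ∞ h) :
    ContDiff ℝ ∞ (negPart m h) := by
  have h1 : ContDiff ℝ ∞ fun p : Space => (act (negProj m p)).restrictScalars ℝ :=
    (ContinuousLinearMap.restrictScalarsL ℂ Spinor Spinor ℝ ℝ).contDiff.comp
      (contDiff_act_negProj hm)
  exact h1.clm_apply hh

lemma hasCompactSupport_negPart (m : ℝ) {h : Space → Spinor} (hc : HasCompactSupport h) :
    HasCompactSupport (negPart m h) :=
  hc.mono fun p hp hp' => hp (by rw [negPart, hp', map_zero])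

lemma memLp_packet_param {m : ℝ} (hm : 0 < m) (S : CauchySurface) {h : Space → Spinor}
    (hh : ContDiff ℝ ∞ h) (hc : HasCompactSupport h) :
    MemLp (fun x => packet m h (S.param x)) 2 volume := by
  have h1 : Continuous fun x => packet m h (S.param x) :=
    (continuous_packet m hh.continuous hc).comp S.continuous_param
  rw [memLp_two_iff_integrable_sq_norm h1.aestronglyMeasurable]
  obtain ⟨C, hC0, hC⟩ := packet_scaled_decay hm S hh hc 2
  refine ((integrable_one_add_norm_pow_inv (n := 4) (by norm_num)).const_mul (C ^ 2)).mono'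
    (h1.norm.pow 2).aestronglyMeasurable (Eventually.of_forall fun x => ?_)
  have h2 := hC 1 ⟨zero_le_one, le_rfl⟩ x
  rw [S.scaled_one] at h2
  rw [Real.norm_of_nonneg (by positivity)]
  calc _ ≤ (C * ((1 + ‖x‖) ^ 2)⁻¹) ^ 2 := by gcongr
    _ = _ := by rw [mul_pow, inv_pow, ← pow_mul]

namespace CauchySurface

variable (S : CauchySurface)

lemma toHilbert_fn (f : Space → Spinor) (hf : MemLp f 2 volume) :
    (S.toHilbert f hf).fn =ᵐ[volume] f := hf.coeFn_toLp

variable {S} in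
lemma hilbert_ext {φ ψ : S.HilbertSpace} (h : φ.fn =ᵐ[volume] ψ.fn) : φ = ψ :=
  Lp.ext h

lemma ofTest_fn (φ : TestSpinor) : (S.ofTest φ).fn =ᵐ[volume] φ.1 := S.toHilbert_fn _ _

lemma memLp_restrict {m : ℝ} (hm : 0 < m) (h : testFun) :
    MemLp (fun x => (fourierConst : ℂ) • packet m (negPart m h.1) (S.param x)) 2 volume :=
  (memLp_packet_param hm S (contDiff_negPart hm h.2.1)
    (hasCompactSupport_negPart m h.2.2)).const_smul (fourierConst : ℂ)

/-- The restriction to the surface of the normalized wave packet with the negative energy part of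
`h` as amplitude. -/
def restrictPacket {m : ℝ} (hm : 0 < m) : testFun →ₗ[ℂ] S.HilbertSpace where
  toFun h := S.toHilbert (fun x => (fourierConst : ℂ) • packet m (negPart m h.1) (S.param x))
    (S.memLp_restrict hm h)
  map_add' h h' := by
    refine hilbert_ext ((S.toHilbert_fn _ _).trans ?_)
    refine EventuallyEq.trans ?_ (HilbertSpace.fn_add _ _).symm
    filter_upwards [S.toHilbert_fn _ (S.memLp_restrict hm h),
      S.toHilbert_fn _ (S.memLp_restrict hm h')] with x h1 h2
    refine Eq.trans ?_ (congrArg₂ (· + ·) h1 h2).symm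
    rw [← smul_add]
    congr 1
    simp only [packet]
    rw [← integral_add]
    · refine integral_congr_ae (Eventually.of_forall fun p => ?_)
      simp [negPart]
    · exact integrable_packet m ((contDiff_negPart hm h.2.1).continuous.integrable_of_hasCompactSupport
        (hasCompactSupport_negPart m h.2.2)) _
    · exact integrable_packet m
        ((contDiff_negPart hm h'.2.1).continuous.integrable_of_hasCompactSupport
        (hasCompactSupport_negPart m h'.2.2)) _
  map_smul' c h := by
    refine hilbert_ext ((S.toHilbert_fn _ _).trans ?_)
    refine EventuallyEq.trans ?_ (HilbertSpace.fn_smul _ _).symm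
    filter_upwards [S.toHilbert_fn _ (S.memLp_restrict hm h)] with x h1
    refine Eq.trans ?_ (congrArg (c • ·) h1).symm
    rw [smul_comm c]
    congr 1
    simp only [packet]
    rw [← integral_smul]
    refine integral_congr_ae (Eventually.of_forall fun p => ?_)
    simp [negPart, smul_comm c]

lemma restrictPacket_fn {m : ℝ} (hm : 0 < m) (h : testFun) :
    (S.restrictPacket hm h).fn =ᵐ[volume]
      fun x => (fourierConst : ℂ) • packet m (negPart m h.1) (S.param x) :=
  S.toHilbert_fn _ (S.memLp_restrict hm h)

/-- Restriction to the surface preserves the scalar product of negative energy amplitudes. -/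
lemma inner_restrictPacket {m : ℝ} (hm : 0 < m) (h h' : testFun) :
    ⟪S.restrictPacket hm h, S.restrictPacket hm h'⟫_ℂ
      = ∫ p, ⟪negPart m h.1 p, negPart m h'.1 p⟫_ℂ := by
  rw [inner_def]
  have h1 : ∫ x, ⟪(S.restrictPacket hm h).fn x, S.weight x ((S.restrictPacket hm h').fn x)⟫_ℂ
      = ∫ x, ((fourierConst ^ 2 : ℝ) : ℂ) * ⟪packet m (negPart m h.1) (S.param x),
        S.weight x (packet m (negPart m h'.1) (S.param x))⟫_ℂ := by
    refine integral_congr_ae ?_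
    filter_upwards [S.restrictPacket_fn hm h, S.restrictPacket_fn hm h'] with x e1 e2
    rw [e1, e2, map_smul, inner_smul_left, inner_smul_right, Complex.conj_ofReal]
    push_cast
    ring
  rw [h1, integral_const_mul, integral_inner_packet_param hm S (contDiff_negPart hm h.2.1)
    (hasCompactSupport_negPart m h.2.2) (fun p => act_slash_negProj hm p _)
    (contDiff_negPart hm h'.2.1) (hasCompactSupport_negPart m h'.2.2)
    (fun p => act_slash_negProj hm p _), integral_inner_packet_zero m (contDiff_negPart hm h.2.1)
    (hasCompactSupport_negPart m h.2.2) (contDiff_negPart hm h'.2.1)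
    (hasCompactSupport_negPart m h'.2.2), ← mul_assoc, ← Complex.ofReal_mul, fourierConst_sq]
  simp

lemma norm_restrictPacket_le {m : ℝ} (hm : 0 < m) (h : testFun) :
    ‖S.restrictPacket hm h‖ ≤ 1 * ‖testToLp h‖ := by
  rw [one_mul]
  refine abs_le_of_sq_le_sq' ?_ (norm_nonneg _) |>.2
  have hi : ∀ f : Space → Spinor, Continuous f → HasCompactSupport f →
      Integrable fun p => ⟪f p, f p⟫_ℂ := fun f hf hfc => by
    refine (hf.inner hf).integrable_of_hasCompactSupport (hfc.mono fun p hp hp' => hp ?_)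
    simp only [hp', inner_zero_left]
  have i1 := hi _ (contDiff_negPart hm h.2.1).continuous (hasCompactSupport_negPart m h.2.2)
  have i2 := hi _ h.2.1.continuous h.2.2
  rw [← inner_self_eq_norm_sq (𝕜 := ℂ), ← inner_self_eq_norm_sq (𝕜 := ℂ), inner_restrictPacket,
    inner_testToLp_testToLp, ← integral_re i1, ← integral_re i2]
  refine integral_mono i1.re i2.re fun p => ?_
  simp only [inner_self_eq_norm_sq]
  have := norm_act_negProj_le hm p (h.1 p)
  exact pow_le_pow_left₀ (norm_nonneg _) this 2

/-- The extension of `restrictPacket` to `L²`, a partial isometry onto the negative energy space. -/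
def packetOp {m : ℝ} (hm : 0 < m) : Lp Spinor 2 (volume : Measure Space) →L[ℂ] S.HilbertSpace :=
  (S.restrictPacket hm).extendOfNorm testToLp

lemma packetOp_apply {m : ℝ} (hm : 0 < m) (h : testFun) :
    S.packetOp hm (testToLp h) = S.restrictPacket hm h :=
  LinearMap.extendOfNorm_eq denseRange_testToLp ⟨1, S.norm_restrictPacket_le hm⟩ h

/-- A wave packet solution with amplitude `g` is the packet with `L²` amplitude `(m/p⁰) g`. -/
lemma wavePacket_eq (m : ℝ) (g : Space → Spinor) (x : Spacetime) :
    wavePacket m g x = (fourierConst : ℂ) •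
      packet m (fun p => ((m / negShell m p 0 : ℝ) : ℂ) • g p) x := by
  simp only [wavePacket, packet, fourierConst, smul_smul]

lemma packetOp_mem_negSpace {m : ℝ} (hm : 0 < m) (f : Lp Spinor 2 (volume : Measure Space)) :
    S.packetOp hm f ∈ S.negSpace m := by
  refine isClosed_property (p := fun f => S.packetOp hm f ∈ S.negSpace m) denseRange_testToLp
    ((Submodule.isClosed_topologicalClosure _).preimage (S.packetOp hm).continuous) (fun h => ?_) f
  rw [packetOp_apply]
  refine Submodule.le_topologicalClosure _ (Submodule.subset_span ?_)
  have hE : ∀ p, negShell m p 0 ≠ 0 := fun p => by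
    rw [negShell_zero]; exact neg_ne_zero.2 (energy_pos hm p).ne'
  have hs : ContDiff ℝ ∞ fun p : Space => ((negShell m p 0 / m : ℝ) : ℂ) := by
    simp only [negShell_zero]
    exact Complex.ofRealCLM.contDiff.comp ((contDiff_energy hm).neg.div_const m)
  refine ⟨_, ⟨fun p => ((negShell m p 0 / m : ℝ) : ℂ) • negPart m h.1 p,
    hs.smul (contDiff_negPart hm h.2.1), (hasCompactSupport_negPart m h.2.2).smul_left
      (f := fun p => ((negShell m p 0 / m : ℝ) : ℂ)), fun p => ?_, rfl⟩, ?_⟩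
  · simp only [map_smul, negPart, act_slash_negProj hm]
    rw [smul_comm]
  · filter_upwards [S.restrictPacket_fn hm h] with x hx
    rw [hx, wavePacket_eq]
    congr 2
    funext p
    rw [smul_smul, ← Complex.ofReal_mul, div_mul_div_comm, mul_comm m, div_self
      (mul_ne_zero (hE p) hm.ne'), Complex.ofReal_one, one_smul]

lemma adjoint_packetOp_packetOp {m : ℝ} (hm : 0 < m) (h : testFun)
    (hh : ∀ p, act (negProj m p) (h.1 p) = h.1 p) :
    ContinuousLinearMap.adjoint (S.packetOp hm) (S.packetOp hm (testToLp h)) = testToLp h := by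
  refine denseRange_testToLp.eq_of_inner_left (𝕜 := ℂ) fun h' => ?_
  rw [ContinuousLinearMap.adjoint_inner_left, packetOp_apply, packetOp_apply,
    inner_restrictPacket, inner_testToLp_testToLp]
  refine integral_congr_ae (Eventually.of_forall fun p => ?_)
  simp only [negPart]
  rw [← inner_act_negProj, act_negProj_idem hm, hh]

/-- The orthogonal projector onto the negative energy space is `J J*`, with `J = packetOp`. -/
lemma Pminus_apply {m : ℝ} (hm : 0 < m) (ψ : S.HilbertSpace) :
    S.Pminus m ψ = S.packetOp hm (ContinuousLinearMap.adjoint (S.packetOp hm) ψ) := by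
  refine Submodule.eq_starProjection_of_mem_orthogonal (S.packetOp_mem_negSpace hm _) ?_
  set v := ψ - S.packetOp hm (ContinuousLinearMap.adjoint (S.packetOp hm) ψ) with hv
  -- It remains to see that `ψ - J J* ψ` is orthogonal to the generators `J h` with `Π h = h`, which
  -- holds since `J* J h = h` for these.
  have h1 : S.negSpace m ≤ (ℂ ∙ v)ᗮ := by
    refine Submodule.topologicalClosure_minimal _ (Submodule.span_le.2 ?_)
      (Submodule.isClosed_orthogonal _)
    rintro η ⟨Ψ, ⟨g, hg, hgc, hgs, rfl⟩, hη⟩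
    have hE : ContDiff ℝ ∞ fun p : Space => ((m / negShell m p 0 : ℝ) : ℂ) := by
      simp only [negShell_zero]
      exact Complex.ofRealCLM.contDiff.comp (contDiff_const.div (contDiff_energy hm).neg
        fun p => neg_ne_zero.2 (energy_pos hm p).ne')
    let h0 : testFun := ⟨fun p => ((m / negShell m p 0 : ℝ) : ℂ) • g p, hE.smul hg,
      hgc.smul_left (f := fun p => ((m / negShell m p 0 : ℝ) : ℂ))⟩
    have hh0 : ∀ p, act (negProj m p) (h0.1 p) = h0.1 p := fun p => by
      simp only [h0]
      rw [map_smul, negProj_eq_self hm p _ (hgs p)]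
    have e : η = S.packetOp hm (testToLp h0) := by
      rw [packetOp_apply]
      refine hilbert_ext (hη.trans ?_)
      refine EventuallyEq.trans (Eventually.of_forall fun x => ?_) (S.restrictPacket_fn hm h0).symm
      simp only [wavePacket_eq]
      congr 2
      funext p
      exact (hh0 p).symm
    rw [SetLike.mem_coe, Submodule.mem_orthogonal_singleton_iff_inner_left, e, hv, inner_sub_right,
      ← ContinuousLinearMap.adjoint_inner_right, ← ContinuousLinearMap.adjoint_inner_left
        (S.packetOp hm) _ (S.packetOp hm (testToLp h0)), S.adjoint_packetOp_packetOp hm h0 hh0, sub_self]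
  rw [Submodule.mem_orthogonal]
  exact fun w hw => (Submodule.mem_orthogonal_singleton_iff_inner_left.1 (h1 hw))

/-- The Fourier transform `(2π)^{-3/2} ∫_Σ e^{ipx} γ⁰ i_γ(d⁴x) φ(x)` of a test spinor field on the
surface, at the point of the negative mass shell above `p`. -/
def hat (m : ℝ) (φ : TestSpinor) (p : Space) : Spinor :=
  (fourierConst : ℂ) • ∫ x : Space,
    Complex.exp (Complex.I * (mink (negShell m p) (S.param x) : ℝ)) • S.weight x (φ.1 x)

lemma continuous_weight_apply (φ : TestSpinor) : Continuous fun x => S.weight x (φ.1 x) :=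
  S.continuous_weight.clm_apply φ.2.1.continuous

lemma hasCompactSupport_weight_apply (φ : TestSpinor) :
    HasCompactSupport fun x => S.weight x (φ.1 x) :=
  φ.2.2.mono fun x hx hx' => hx (by simp only [hx', map_zero])

lemma integrable_weight_apply (φ : TestSpinor) : Integrable fun x => S.weight x (φ.1 x) :=
  (S.continuous_weight_apply φ).integrable_of_hasCompactSupport (S.hasCompactSupport_weight_apply φ)

lemma _root_.DiracSea.continuous_mink {X : Type*} [TopologicalSpace X] {f g : X → Spacetime}
    (hf : Continuous f) (hg : Continuous g) : Continuous fun x => mink (f x) (g x) := by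
  unfold mink
  fun_prop

lemma continuous_exp_mink_param (m : ℝ) (c : ℂ) {X : Type*} [TopologicalSpace X] {f g : X → Space}
    (hf : Continuous f) (hg : Continuous g) : Continuous fun x =>
    Complex.exp (c * (mink (negShell m (f x)) (S.param (g x)) : ℝ)) :=
  Complex.continuous_exp.comp (continuous_const.mul (Complex.continuous_ofReal.comp
    (continuous_mink ((continuous_negShell m).comp hf) (S.continuous_param.comp hg))))

lemma continuous_hat (m : ℝ) (φ : TestSpinor) : Continuous (S.hat m φ) := by
  have h : Continuous fun p => ∫ x : Space,
      Complex.exp (Complex.I * (mink (negShell m p) (S.param x) : ℝ)) • S.weight x (φ.1 x) := by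
    refine continuous_of_dominated (bound := fun x => ‖S.weight x (φ.1 x)‖)
      (fun p => ?_) (fun p => Eventually.of_forall fun x => ?_)
      (S.integrable_weight_apply φ).norm (Eventually.of_forall fun x => ?_)
    · exact ((S.continuous_exp_mink_param m _ continuous_const continuous_id).smul
        (S.continuous_weight_apply φ)).aestronglyMeasurable
    · rw [norm_smul, norm_exp_I_mul, one_mul]
    · exact (S.continuous_exp_mink_param m _ continuous_id continuous_const).smul continuous_const
  exact h.const_smul (fourierConst : ℂ)

lemma inner_ofTest_restrictPacket {m : ℝ} (hm : 0 < m) (φ : TestSpinor) (h : testFun) :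
    ⟪S.ofTest φ, S.restrictPacket hm h⟫_ℂ = ∫ p, ⟪S.hat m φ p, negPart m h.1 p⟫_ℂ := by
  set g := negPart m h.1 with hgdef
  have hg : Continuous g := (contDiff_negPart hm h.2.1).continuous
  have hgc : HasCompactSupport g := hasCompactSupport_negPart m h.2.2
  have hgi : Integrable g := hg.integrable_of_hasCompactSupport hgc
  set f := fun x => S.weight x (φ.1 x) with hfdef
  have hf : Continuous f := S.continuous_weight_apply φ
  have hfi : Integrable f := S.integrable_weight_apply φ
  have hint : Integrable (fun q : Space × Space => Complex.exp
      (-Complex.I * (mink (negShell m q.2) (S.param q.1) : ℝ)) * ⟪f q.1, g q.2⟫_ℂ)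
      (volume.prod volume) := by
    refine (hfi.norm.mul_prod hgi.norm).mono' ?_ (Eventually.of_forall fun q => ?_)
    · exact ((S.continuous_exp_mink_param m _ continuous_snd continuous_fst).mul
        ((hf.comp continuous_fst).inner (hg.comp continuous_snd))).aestronglyMeasurable
    · rw [norm_mul, norm_exp_neg_I_mul, one_mul]
      exact norm_inner_le_norm _ _
  have h1 : ⟪S.ofTest φ, S.restrictPacket hm h⟫_ℂ = ∫ x, (fourierConst : ℂ) * ∫ p,
      Complex.exp (-Complex.I * (mink (negShell m p) (S.param x) : ℝ)) * ⟪f x, g p⟫_ℂ := by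
    rw [inner_def]
    refine integral_congr_ae ?_
    filter_upwards [S.ofTest_fn φ, S.restrictPacket_fn hm h] with x e1 e2
    rw [e1, e2, ← inner_weight_symm, inner_smul_right, packet,
      ← integral_inner (integrable_packet m hgi _)]
    simp only [inner_smul_right]
    rfl
  have h2 : ∀ p, ⟪S.hat m φ p, g p⟫_ℂ = (fourierConst : ℂ) * ∫ x,
      Complex.exp (-Complex.I * (mink (negShell m p) (S.param x) : ℝ)) * ⟪f x, g p⟫_ℂ := by
    intro p
    have hi : Integrable fun x => Complex.exp (Complex.I * (mink (negShell m p) (S.param x) : ℝ))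
        • f x := by
      refine hfi.norm.mono' ((S.continuous_exp_mink_param m _ continuous_const
        continuous_id).smul hf).aestronglyMeasurable
        (Eventually.of_forall fun x => ?_)
      rw [norm_smul, norm_exp_I_mul, one_mul]
    rw [hat, inner_smul_left, Complex.conj_ofReal]
    congr 1
    rw [← inner_conj_symm, ← integral_inner hi, ← integral_conj]
    refine integral_congr_ae (Eventually.of_forall fun x => ?_)
    simp only [inner_smul_right, map_mul, inner_conj_symm, ← Complex.exp_conj, Complex.conj_I,
      Complex.conj_ofReal]
  simp only [h1, h2]
  rw [integral_const_mul, integral_const_mul, integral_integral_swap hint]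

/-- `J* φ` is the negative energy part of the Fourier transform of `φ`. -/
lemma adjoint_packetOp_ofTest {m : ℝ} (hm : 0 < m) (φ : TestSpinor) :
    ContinuousLinearMap.adjoint (S.packetOp hm) (S.ofTest φ) =ᵐ[volume]
      fun p => act (negProj m p) (S.hat m φ p) := by
  set k := ContinuousLinearMap.adjoint (S.packetOp hm) (S.ofTest φ) with hk
  have hc : Continuous fun p => act (negProj m p) (S.hat m φ p) :=
    (contDiff_act_negProj hm).continuous.clm_apply (S.continuous_hat m φ)
  have hkl : LocallyIntegrable (k : Space → Spinor) := (Lp.memLp k).locallyIntegrable (by norm_num)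
  have hl : LocallyIntegrable (fun p => (k : Space → Spinor) p - act (negProj m p) (S.hat m φ p)) :=
    hkl.sub hc.locallyIntegrable
  -- Both sides are locally integrable, so they may be compared by testing against `g • v`.
  have key := ae_eq_zero_of_integral_contDiff_smul_eq_zero hl fun g hg hgc => ?_
  · filter_upwards [key] with p hp
    exact sub_eq_zero.1 hp
  · have hgi : ∀ f : Space → Spinor, LocallyIntegrable f → Integrable fun p => g p • f p :=
      fun f hf => hf.integrable_smul_left_of_hasCompactSupport hg.continuous hgc
    refine ext_inner_right ℂ fun v => ?_
    rw [inner_zero_left, ← inner_conj_symm, ← integral_inner (hgi _ hl), map_eq_zero]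
    let h : testFun := ⟨fun p => (g p : ℂ) • v,
      (Complex.ofRealCLM.contDiff.comp hg).smul contDiff_const, by
        refine hgc.mono fun p hp hp' => hp ?_
        simp only [hp', Complex.ofReal_zero, zero_smul]⟩
    have e1 : ⟪k, testToLp h⟫_ℂ = ∫ p, ⟪S.hat m φ p, negPart m h.1 p⟫_ℂ := by
      rw [hk, ContinuousLinearMap.adjoint_inner_left, packetOp_apply, inner_ofTest_restrictPacket]
    rw [inner_testToLp] at e1
    have e2 : ∀ p, ⟪v, g p • ((k : Space → Spinor) p - act (negProj m p) (S.hat m φ p))⟫_ℂ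
        = (starRingEnd ℂ) (⟪(k : Space → Spinor) p, h.1 p⟫_ℂ
          - ⟪S.hat m φ p, negPart m h.1 p⟫_ℂ) := fun p => by
      simp only [h, negPart]
      rw [← inner_act_negProj, ← inner_sub_left, inner_conj_symm, ← Complex.coe_smul,
        inner_smul_left, inner_smul_right, Complex.conj_ofReal]
    simp only [e2]
    have i1 : Integrable fun p => ⟪(k : Space → Spinor) p, h.1 p⟫_ℂ := by
      refine ((hgi _ hkl).inner_const v).congr (Eventually.of_forall fun p => ?_)
      simp only [h]
      rw [← Complex.coe_smul, inner_smul_left, inner_smul_right, Complex.conj_ofReal]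
    have i2 : Integrable fun p => ⟪S.hat m φ p, negPart m h.1 p⟫_ℂ := by
      refine ((S.continuous_hat m φ).inner (contDiff_negPart hm h.2.1).continuous
        ).integrable_of_hasCompactSupport ((hasCompactSupport_negPart m h.2.2).mono
          fun p hp hp' => hp ?_)
      simp only [hp', inner_zero_right]
    rw [integral_conj, integral_sub i1 i2, e1, sub_self, map_zero]

/-- The matrix elements of `P_Σ^-` in momentum space. -/
lemma inner_Pminus_ofTest {m : ℝ} (hm : 0 < m) (φ ψ : TestSpinor) :
    Integrable (fun p => ⟪S.hat m φ p, act (negProj m p) (S.hat m ψ p)⟫_ℂ) ∧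
    ⟪S.ofTest φ, S.Pminus m (S.ofTest ψ)⟫_ℂ
      = ∫ p, ⟪S.hat m φ p, act (negProj m p) (S.hat m ψ p)⟫_ℂ := by
  have e : (fun p => ⟪(ContinuousLinearMap.adjoint (S.packetOp hm) (S.ofTest φ) : Space → Spinor) p,
      (ContinuousLinearMap.adjoint (S.packetOp hm) (S.ofTest ψ) : Space → Spinor) p⟫_ℂ)
      =ᵐ[volume] fun p => ⟪S.hat m φ p, act (negProj m p) (S.hat m ψ p)⟫_ℂ := by
    filter_upwards [S.adjoint_packetOp_ofTest hm φ, S.adjoint_packetOp_ofTest hm ψ] with p h1 h2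
    rw [h1, h2, inner_act_negProj, act_negProj_idem hm]
  refine ⟨(L2.integrable_inner _ _).congr e, ?_⟩
  rw [Pminus_apply S hm, ← ContinuousLinearMap.adjoint_inner_left, L2.inner_def]
  exact integral_congr_ae e

end CauchySurface


/-! ### The Bessel kernel as a Fourier integral at Euclidean points -/

/-- The substitution `v ↦ b/(2av)` in a Gaussian type integral. -/
lemma integral_gaussian_symm {a b : ℝ} (ha : 0 < a) (hb : 0 < b) :
    ∫ v in Ioi (0 : ℝ), Real.exp (-(a * v - b / (2 * v)) ^ 2)
      = ∫ v in Ioi (0 : ℝ), b / (2 * a * v ^ 2) * Real.exp (-(a * v - b / (2 * v)) ^ 2) := by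
  have him : (fun v : ℝ => b / (2 * a * v)) '' Ioi 0 = Ioi 0 := by
    ext y
    constructor
    · rintro ⟨v, hv, rfl⟩
      have : 0 < v := hv
      exact mem_Ioi.2 (by positivity)
    · intro hy
      have : 0 < y := hy
      refine ⟨b / (2 * a * y), mem_Ioi.2 (by positivity), ?_⟩
      field_simp
  have hd : ∀ v ∈ Ioi (0 : ℝ), HasDerivWithinAt (fun v : ℝ => b / (2 * a * v))
      (-(b / (2 * a * v ^ 2))) (Ioi 0) v := by
    intro v hv
    have hv0 : v ≠ 0 := (show 0 < v from hv).ne'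
    have h1 := ((hasDerivAt_inv hv0).const_mul (b / (2 * a))).hasDerivWithinAt (s := Ioi 0)
    refine (h1.congr_of_eventuallyEq (Eventually.of_forall fun v => ?_) ?_).congr_deriv ?_
    · field_simp
    · field_simp
    · field_simp
  have hinj : InjOn (fun v : ℝ => b / (2 * a * v)) (Ioi 0) := by
    intro v hv w hw h
    have hv0 : v ≠ 0 := (show 0 < v from hv).ne'
    have hw0 : w ≠ 0 := (show 0 < w from hw).ne'
    have h' : b / (2 * a * v) = b / (2 * a * w) := h
    field_simp at h'
    exact h'.symm
  have key := integral_image_eq_integral_abs_deriv_smul measurableSet_Ioi hd hinj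
    (fun v => Real.exp (-(a * v - b / (2 * v)) ^ 2))
  rw [him] at key
  rw [key]
  refine setIntegral_congr_fun measurableSet_Ioi fun v hv => ?_
  have hv0 : 0 < v := hv
  simp only [smul_eq_mul]
  rw [abs_neg, abs_of_pos (by positivity)]
  congr 3
  have : a * (b / (2 * a * v)) - b / (2 * (b / (2 * a * v))) = -(a * v - b / (2 * v)) := by
    field_simp
    ring
  rw [this, neg_sq]

/-- The substitution `u = av - b/(2v)`, which maps `(0, ∞)` onto `ℝ`, in the Gaussian integral. -/
lemma integral_gaussian_pullback {a b : ℝ} (ha : 0 < a) (hb : 0 < b) :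
    IntegrableOn (fun v => (a + b / (2 * v ^ 2)) * Real.exp (-(a * v - b / (2 * v)) ^ 2))
      (Ioi (0 : ℝ)) ∧
    ∫ v in Ioi (0 : ℝ), (a + b / (2 * v ^ 2)) * Real.exp (-(a * v - b / (2 * v)) ^ 2)
      = √Real.pi := by
  have him : (fun v : ℝ => a * v - b / (2 * v)) '' Ioi 0 = univ := by
    refine eq_univ_of_forall fun u => ?_
    have h1 : 0 < u ^ 2 + 2 * a * b := by positivity
    have h2 : |u| < √(u ^ 2 + 2 * a * b) := by
      rw [← Real.sqrt_sq_eq_abs]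
      exact Real.sqrt_lt_sqrt (sq_nonneg u) (by nlinarith [mul_pos ha hb])
    have h3 : 0 < u + √(u ^ 2 + 2 * a * b) := by linarith [neg_abs_le u]
    refine ⟨(u + √(u ^ 2 + 2 * a * b)) / (2 * a), mem_Ioi.2 (by positivity), ?_⟩
    have h4 := Real.sq_sqrt h1.le
    set q := √(u ^ 2 + 2 * a * b)
    have h5 : u + q ≠ 0 := h3.ne'
    field_simp
    nlinarith
  have hd : ∀ v ∈ Ioi (0 : ℝ), HasDerivWithinAt (fun v : ℝ => a * v - b / (2 * v))
      (a + b / (2 * v ^ 2)) (Ioi 0) v := by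
    intro v hv
    have hv0 : v ≠ 0 := (show 0 < v from hv).ne'
    have h1 := (((hasDerivAt_id v).const_mul a).sub
      ((hasDerivAt_inv hv0).const_mul (b / 2))).hasDerivWithinAt (s := Ioi 0)
    refine (h1.congr_of_eventuallyEq (Eventually.of_forall fun v => ?_) ?_).congr_deriv ?_
    · simp only [Pi.sub_apply, id]; field_simp
    · simp only [Pi.sub_apply, id]; field_simp
    · field_simp; ring
  have hinj : InjOn (fun v : ℝ => a * v - b / (2 * v)) (Ioi 0) := by
    refine StrictMonoOn.injOn fun v hv w hw h => ?_
    have hv0 : 0 < v := hv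
    have h1 : b / (2 * w) < b / (2 * v) := by gcongr
    have h2 : a * v < a * w := by gcongr
    linarith
  have key := integral_image_eq_integral_abs_deriv_smul measurableSet_Ioi hd hinj
    (fun u => Real.exp (-u ^ 2))
  have key2 := integrableOn_image_iff_integrableOn_abs_deriv_smul measurableSet_Ioi hd hinj
    (fun u => Real.exp (-u ^ 2))
  have hg : ∀ v ∈ Ioi (0 : ℝ), |a + b / (2 * v ^ 2)| • Real.exp (-(a * v - b / (2 * v)) ^ 2)
      = (a + b / (2 * v ^ 2)) * Real.exp (-(a * v - b / (2 * v)) ^ 2) := fun v hv => by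
    have hv0 : 0 < v := hv
    rw [smul_eq_mul, abs_of_pos (by positivity)]
  rw [him, setIntegral_univ] at key
  rw [him, integrableOn_univ] at key2
  have h1 := integral_gaussian 1
  have h2 := integrable_exp_neg_mul_sq one_pos
  simp only [neg_mul, one_mul, div_one] at h1 h2
  refine ⟨(key2.1 h2).congr_fun hg measurableSet_Ioi, ?_⟩
  rw [← setIntegral_congr_fun measurableSet_Ioi hg, ← key, h1]

/-- The subordination formula `∫_0^∞ exp(-a²v² - b²/(4v²)) dv = √π/(2a) e^{-ab}`. -/
lemma integral_subordination {a b : ℝ} (ha : 0 < a) (hb : 0 < b) :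
    ∫ v in Ioi (0 : ℝ), Real.exp (-(a ^ 2 * v ^ 2) - b ^ 2 / (4 * v ^ 2))
      = √Real.pi / (2 * a) * Real.exp (-(a * b)) := by
  obtain ⟨h1, h2⟩ := integral_gaussian_pullback ha hb
  have hm : ∀ f : ℝ → ℝ, (∀ v ∈ Ioi (0 : ℝ), 0 ≤ f v ∧ f v ≤ a + b / (2 * v ^ 2)) →
      Measurable f → IntegrableOn (fun v => f v * Real.exp (-(a * v - b / (2 * v)) ^ 2))
        (Ioi 0) := fun f hf hfm => by
    refine h1.mono' (by fun_prop) ((ae_restrict_iff' measurableSet_Ioi).2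
      (Eventually.of_forall fun v hv => ?_))
    rw [norm_mul, Real.norm_of_nonneg (hf v hv).1, Real.norm_of_nonneg (Real.exp_pos _).le]
    exact mul_le_mul_of_nonneg_right (hf v hv).2 (Real.exp_pos _).le
  have i1 := hm (fun _ => a) (fun v hv => ⟨ha.le, le_add_of_nonneg_right (by positivity)⟩)
    measurable_const
  have i2 := hm (fun v => b / (2 * v ^ 2)) (fun v hv => ⟨by positivity,
    le_add_of_nonneg_left ha.le⟩) (by fun_prop)
  have e1 := integral_gaussian_symm ha hb
  -- By the symmetry `v ↦ b/(2av)` the two summands of the Jacobian `a + b/(2v²)` contribute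
  -- equally to the Gaussian integral.
  simp only [add_mul] at h2
  rw [integral_add i1 i2, integral_const_mul] at h2
  have e2 : ∫ v in Ioi (0 : ℝ), b / (2 * v ^ 2) * Real.exp (-(a * v - b / (2 * v)) ^ 2)
      = a * ∫ v in Ioi (0 : ℝ), Real.exp (-(a * v - b / (2 * v)) ^ 2) := by
    rw [e1, ← integral_const_mul]
    refine setIntegral_congr_fun measurableSet_Ioi fun v hv => ?_
    have hv0 : 0 < v := hv
    field_simp
  rw [e2] at h2
  have e3 : ∀ v ∈ Ioi (0 : ℝ), Real.exp (-(a ^ 2 * v ^ 2) - b ^ 2 / (4 * v ^ 2))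
      = Real.exp (-(a * v - b / (2 * v)) ^ 2) * Real.exp (-(a * b)) := fun v hv => by
    have hv0 : 0 < v := hv
    rw [← Real.exp_add]
    congr 1
    field_simp
    ring
  rw [setIntegral_congr_fun measurableSet_Ioi e3, integral_mul_const]
  congr 1
  rw [eq_div_iff (by positivity)]
  linarith

lemma integrableOn_subordination {a b : ℝ} (ha : 0 < a) (hb : 0 < b) :
    IntegrableOn (fun v => Real.exp (-(a ^ 2 * v ^ 2) - b ^ 2 / (4 * v ^ 2))) (Ioi (0 : ℝ)) := by
  -- The integral of a function that is not integrable would be the junk value `0`.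
  by_contra h
  have h1 := integral_subordination ha hb
  rw [integral_undef h] at h1
  have : 0 < √Real.pi / (2 * a) * Real.exp (-(a * b)) := by positivity
  linarith

/-- `∫_1^∞ t √(t²-1) e^{-ct²} dt = √π/4 c^{-3/2} e^{-c}`, with `c = d²`. -/
lemma integral_mul_sqrt_mul_gaussian {d : ℝ} (hd : 0 < d) :
    ∫ t in Ioi (1 : ℝ), t * √(t ^ 2 - 1) * Real.exp (-(d ^ 2 * t ^ 2))
      = √Real.pi / 4 * (d ^ 3)⁻¹ * Real.exp (-d ^ 2) := by
  have him : (fun y : ℝ => √(1 + y ^ 2)) '' Ioi 0 = Ioi 1 := by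
    ext t
    constructor
    · rintro ⟨y, hy, rfl⟩
      have hy0 : 0 < y := hy
      exact mem_Ioi.2 (Real.lt_sqrt_of_sq_lt (by nlinarith))
    · intro ht
      have ht1 : 1 < t := ht
      have h1 : 0 < t ^ 2 - 1 := by nlinarith
      refine ⟨√(t ^ 2 - 1), Real.sqrt_pos.2 h1, ?_⟩
      simp only
      rw [Real.sq_sqrt h1.le, add_sub_cancel, Real.sqrt_sq (by linarith)]
  have hder : ∀ y ∈ Ioi (0 : ℝ), HasDerivWithinAt (fun y : ℝ => √(1 + y ^ 2))
      (y / √(1 + y ^ 2)) (Ioi 0) y := by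
    intro y hy
    have h1 : HasDerivAt (fun y : ℝ => 1 + y ^ 2) (2 * y) y := by
      simpa using (hasDerivAt_pow 2 y).const_add 1
    refine (h1.sqrt (by positivity)).hasDerivWithinAt.congr_deriv ?_
    field_simp
  have hinj : InjOn (fun y : ℝ => √(1 + y ^ 2)) (Ioi 0) := by
    refine StrictMonoOn.injOn fun v hv w hw h => ?_
    have hv0 : 0 < v := hv
    exact Real.sqrt_lt_sqrt (by positivity) (by nlinarith)
  have key := integral_image_eq_integral_abs_deriv_smul measurableSet_Ioi hder hinj
    (fun t => t * √(t ^ 2 - 1) * Real.exp (-(d ^ 2 * t ^ 2)))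
  rw [him] at key
  rw [key]
  have h1 : ∀ y ∈ Ioi (0 : ℝ), |y / √(1 + y ^ 2)| • (√(1 + y ^ 2) * √(√(1 + y ^ 2) ^ 2 - 1) *
      Real.exp (-(d ^ 2 * √(1 + y ^ 2) ^ 2)))
      = Real.exp (-d ^ 2) * (y ^ (2 : ℝ) * Real.exp (-(d ^ 2) * y ^ (2 : ℝ))) := by
    intro y hy
    have hy0 : 0 < y := hy
    have h2 : 0 < √(1 + y ^ 2) := Real.sqrt_pos.2 (by positivity)
    have h3 : √(1 + y ^ 2) ^ 2 = 1 + y ^ 2 := Real.sq_sqrt (by positivity)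
    rw [h3, add_sub_cancel_left, Real.sqrt_sq hy0.le, smul_eq_mul, abs_of_pos (by positivity),
      Real.rpow_two]
    have h4 : Real.exp (-(d ^ 2 * (1 + y ^ 2)))
        = Real.exp (-d ^ 2) * Real.exp (-(d ^ 2) * y ^ 2) := by
      rw [← Real.exp_add]; congr 1; ring
    rw [h4]
    field_simp
  rw [setIntegral_congr_fun measurableSet_Ioi h1, integral_const_mul,
    integral_rpow_mul_exp_neg_mul_rpow (by norm_num) (by norm_num) (by positivity)]
  have h5 : Real.Gamma ((2 + 1) / 2) = √Real.pi / 2 := by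
    have := Real.Gamma_add_one (s := 1 / 2) (by norm_num)
    rw [Real.Gamma_one_half_eq] at this
    rw [show ((2 : ℝ) + 1) / 2 = 1 / 2 + 1 by norm_num, this]
    ring
  have h6 : (d ^ 2) ^ (-((2 : ℝ) + 1) / 2) = (d ^ 3)⁻¹ := by
    rw [← Real.rpow_natCast d 2, ← Real.rpow_mul hd.le, ← Real.rpow_natCast, ← Real.rpow_neg hd.le]
    norm_num
  rw [h5, h6]
  ring

/-- `∫_1^∞ e^{-ξs} √(s²-1) ds`, the function `K₁(ξ)/ξ`. -/
def besselB (ξ : ℂ) : ℂ :=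
  ∫ s in Ioi (1 : ℝ), Complex.exp (-ξ * (s : ℂ)) * ((√(s ^ 2 - 1) : ℝ) : ℂ)

/-- Powers times exponentials of the norm are integrable on `ℝ³`. -/
lemma integrable_rpow_norm_mul_exp {s c : ℝ} (hs : -3 < s) (hc : 0 < c) :
    Integrable fun z : Space => ‖z‖ ^ s * Real.exp (-c * ‖z‖) := by
  have h := integrable_fun_norm_addHaar (volume : Measure Space)
    (f := fun r : ℝ => r ^ s * Real.exp (-c * r))
  refine h.2 ?_
  rw [finrank_euclideanSpace_fin]
  have h2 := integrableOn_rpow_mul_exp_neg_mul_rpow (s := 2 + s) (p := 1) (b := c) (by linarith)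
    one_pos hc
  refine h2.congr_fun (fun r hr => ?_) measurableSet_Ioi
  have hr0 : 0 < r := hr
  simp only [smul_eq_mul, Real.rpow_one]
  rw [Real.rpow_add hr0, Real.rpow_two]
  ring

lemma integrable_exp_neg_mul_norm {c : ℝ} (hc : 0 < c) :
    Integrable fun z : Space => Real.exp (-c * ‖z‖) := by
  simpa using integrable_rpow_norm_mul_exp (s := 0) (by norm_num) hc

lemma integrableOn_exp_mul_sqrt {a : ℝ} (ha : 0 < a) :
    IntegrableOn (fun t => Real.exp (-a * t) * √(t ^ 2 - 1)) (Ioi (1 : ℝ)) := by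
  have h := (integrableOn_rpow_mul_exp_neg_mul_rpow (s := 1) (p := 1) (b := a) (by norm_num)
    one_pos ha).mono_set (Ioi_subset_Ioi zero_le_one)
  refine h.mono' (by fun_prop) ((ae_restrict_iff' measurableSet_Ioi).2
    (Eventually.of_forall fun t ht => ?_))
  have ht1 : 1 < t := ht
  rw [Real.norm_of_nonneg (by positivity), Real.rpow_one, mul_comm]
  gcongr
  exact Real.sqrt_le_iff.2 ⟨by linarith, by linarith⟩

/-- The Bessel kernel at a real point as a Gaussian superposition. -/
lemma besselB_eq {m ρ : ℝ} (hm : 0 < m) (hρ : 0 < ρ) :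
    besselB ((m * ρ : ℝ) : ℂ) = ((2 * m ^ 2)⁻¹ * ∫ v in Ioi (0 : ℝ), (v ^ 3)⁻¹ *
      Real.exp (-(m ^ 2 * v ^ 2) - ρ ^ 2 / (4 * v ^ 2)) : ℝ) := by
  have e1 : besselB ((m * ρ : ℝ) : ℂ)
      = ((∫ t in Ioi (1 : ℝ), Real.exp (-(m * ρ) * t) * √(t ^ 2 - 1) : ℝ) : ℂ) := by
    rw [besselB, ← integral_complex_ofReal]
    refine integral_congr_ae (Eventually.of_forall fun t => ?_)
    simp
  rw [e1]
  congr 1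
  -- Subordination with `a = mt`, `b = ρ` writes `e^{-mρt}` as a superposition of Gaussians in `t`;
  -- then the two integrations are interchanged.
  let G : ℝ × ℝ → ℝ := fun q => (2 * m / √Real.pi) * (q.1 * √(q.1 ^ 2 - 1)) *
    Real.exp (-((m * q.1) ^ 2 * q.2 ^ 2) - ρ ^ 2 / (4 * q.2 ^ 2))
  have hpi : 0 < √Real.pi := Real.sqrt_pos.2 Real.pi_pos
  have hin : ∀ t ∈ Ioi (1 : ℝ), ∫ v in Ioi (0 : ℝ), G (t, v)
      = Real.exp (-(m * ρ) * t) * √(t ^ 2 - 1) := fun t ht => by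
    have ht1 : 0 < t := zero_lt_one.trans ht
    simp only [G]
    rw [integral_const_mul, integral_subordination (by positivity) hρ]
    rw [show -(m * t * ρ) = -(m * ρ) * t by ring]
    field_simp
  have hGm : Measurable G := by fun_prop
  have hG : Integrable G ((volume.restrict (Ioi 1)).prod (volume.restrict (Ioi 0))) := by
    rw [integrable_prod_iff hGm.aestronglyMeasurable]
    constructor
    · refine (ae_restrict_iff' measurableSet_Ioi).2 (Eventually.of_forall fun t ht => ?_)
      have ht1 : 0 < t := zero_lt_one.trans ht
      have h := integrableOn_subordination (a := m * t) (mul_pos hm ht1) hρ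
      exact h.const_mul (2 * m / √Real.pi * (t * √(t ^ 2 - 1)))
    · refine (integrableOn_exp_mul_sqrt (mul_pos hm hρ)).congr_fun (fun t ht => ?_)
        measurableSet_Ioi
      have ht1 : 0 < t := zero_lt_one.trans ht
      simp only
      rw [← hin t ht]
      refine integral_congr_ae (Eventually.of_forall fun v => ?_)
      exact (Real.norm_of_nonneg (by simp only [G]; positivity)).symm
  rw [← setIntegral_congr_fun measurableSet_Ioi hin, integral_integral_swap hG,
    ← integral_const_mul]
  refine setIntegral_congr_fun measurableSet_Ioi fun v hv => ?_
  have hv0 : 0 < v := hv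
  simp only [G]
  have h2 : ∀ t : ℝ, (2 * m / √Real.pi) * (t * √(t ^ 2 - 1)) *
      Real.exp (-((m * t) ^ 2 * v ^ 2) - ρ ^ 2 / (4 * v ^ 2)) =
      ((2 * m / √Real.pi) * Real.exp (-(ρ ^ 2 / (4 * v ^ 2)))) *
        (t * √(t ^ 2 - 1) * Real.exp (-((m * v) ^ 2 * t ^ 2))) := fun t => by
    rw [show -((m * t) ^ 2 * v ^ 2) - ρ ^ 2 / (4 * v ^ 2)
      = -(ρ ^ 2 / (4 * v ^ 2)) + -((m * v) ^ 2 * t ^ 2) by ring, Real.exp_add]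
    ring
  simp only [h2]
  rw [integral_const_mul, integral_mul_sqrt_mul_gaussian (mul_pos hm hv0)]
  rw [show -(m ^ 2 * v ^ 2) - ρ ^ 2 / (4 * v ^ 2)
    = -(ρ ^ 2 / (4 * v ^ 2)) + -(m * v) ^ 2 by ring, Real.exp_add]
  field_simp
  ring

lemma integrable_exp_energy {m τ : ℝ} (hm : 0 < m) (hτ : 0 < τ) :
    Integrable fun p : Space => (energy m p)⁻¹ * Real.exp (-(energy m p * τ)) := by
  have hc : Continuous fun p : Space => (energy m p)⁻¹ * Real.exp (-(energy m p * τ)) := by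
    have h := continuous_energy m
    have h2 := h.inv₀ fun p => (energy_pos hm p).ne'
    exact h2.mul (Real.continuous_exp.comp (h.mul continuous_const).neg)
  refine ((integrable_exp_neg_mul_norm hτ).const_mul m⁻¹).mono' hc.aestronglyMeasurable
    (Eventually.of_forall fun p => ?_)
  have h1 := energy_pos hm p
  rw [Real.norm_of_nonneg (by positivity)]
  have h2 := le_energy m p
  have h3 := norm_le_energy m p
  gcongr
  nlinarith

/-- The Fourier transform of `e^{-Eτ}/E`. -/
lemma integral_euclidean {m τ : ℝ} (hm : 0 < m) (hτ : 0 < τ) (x : Space) :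
    ∫ p : Space, ((energy m p)⁻¹ : ℂ) * Complex.exp (-(energy m p * τ : ℝ) -
      Complex.I * (⟪x, p⟫_ℝ : ℝ)) = 4 * Real.pi * m ^ 2 *
        besselB ((m * √(τ ^ 2 + ‖x‖ ^ 2) : ℝ) : ℂ) := by
  have hpi : 0 < √Real.pi := Real.sqrt_pos.2 Real.pi_pos
  have hρ : 0 < √(τ ^ 2 + ‖x‖ ^ 2) := Real.sqrt_pos.2 (by positivity)
  rw [besselB_eq hm hρ, Real.sq_sqrt (by positivity)]
  -- Subordination with `a = E(p)`, `b = τ` turns the exponential of the energy into Gaussians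
  -- in `p`, whose Fourier transforms are explicit.
  let R : Space × ℝ → ℝ := fun q => (2 / √Real.pi) *
    Real.exp (-(energy m q.1 ^ 2 * q.2 ^ 2) - τ ^ 2 / (4 * q.2 ^ 2))
  let G : Space × ℝ → ℂ := fun q => Complex.exp (-Complex.I * (⟪x, q.1⟫_ℝ : ℝ)) * (R q : ℂ)
  have hR : ∀ p : Space, ∫ v in Ioi (0 : ℝ), R (p, v)
      = (energy m p)⁻¹ * Real.exp (-(energy m p * τ)) := fun p => by
    have := energy_pos hm p
    simp only [R]
    rw [integral_const_mul, integral_subordination this hτ]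
    field_simp
  have hRi : ∀ p : Space, IntegrableOn (fun v => R (p, v)) (Ioi (0 : ℝ)) := fun p =>
    (integrableOn_subordination (energy_pos hm p) hτ).const_mul _
  have hRm : Measurable R := by
    have := (continuous_energy m).measurable
    fun_prop
  have hGm : Measurable G := by
    have : Continuous fun q : Space × ℝ => Complex.exp (-Complex.I * (⟪x, q.1⟫_ℝ : ℝ)) := by
      fun_prop
    exact this.measurable.mul (Complex.measurable_ofReal.comp hRm)
  have hGn : ∀ q, ‖G q‖ = R q := fun q => by
    simp only [G]
    rw [norm_mul, norm_exp_neg_I_mul, one_mul, Complex.norm_real,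
      Real.norm_of_nonneg (by simp only [R]; positivity)]
  have hG : Integrable G (volume.prod (volume.restrict (Ioi 0))) := by
    rw [integrable_prod_iff hGm.aestronglyMeasurable]
    constructor
    · exact Eventually.of_forall fun p => (hRi p).mono'
        (hGm.comp (measurable_const.prodMk measurable_id)).aestronglyMeasurable
        (Eventually.of_forall fun v => (hGn _).le)
    · simp only [hGn, hR]
      exact integrable_exp_energy hm hτ
  have e1 : ∀ p : Space, ((energy m p)⁻¹ : ℂ) * Complex.exp (-(energy m p * τ : ℝ) -
      Complex.I * (⟪x, p⟫_ℝ : ℝ)) = ∫ v in Ioi (0 : ℝ), G (p, v) := fun p => by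
    simp only [G]
    rw [integral_const_mul, integral_complex_ofReal, hR, sub_eq_add_neg, Complex.exp_add]
    push_cast
    ring_nf
  simp only [e1]
  rw [integral_integral_swap hG]
  have e2 : ∀ v ∈ Ioi (0 : ℝ), ∫ p : Space, G (p, v) = ((2 * Real.pi * ((v ^ 3)⁻¹ *
      Real.exp (-(m ^ 2 * v ^ 2) - (τ ^ 2 + ‖x‖ ^ 2) / (4 * v ^ 2))) : ℝ) : ℂ) := fun v hv => by
    have hv0 : 0 < v := hv
    have h1 : ∀ p : Space, G (p, v) = ((2 / √Real.pi *
        Real.exp (-(m ^ 2 * v ^ 2) - τ ^ 2 / (4 * v ^ 2)) : ℝ) : ℂ) *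
        Complex.exp (-((v ^ 2 : ℝ) : ℂ) * ‖p‖ ^ 2 + (-Complex.I) * (⟪x, p⟫_ℝ : ℝ)) := fun p => by
      simp only [G, R]
      rw [energy_sq, show -((‖p‖ ^ 2 + m ^ 2) * v ^ 2) - τ ^ 2 / (4 * v ^ 2)
        = -(m ^ 2 * v ^ 2) - τ ^ 2 / (4 * v ^ 2) + -(v ^ 2 * ‖p‖ ^ 2) by ring, Real.exp_add,
        Complex.exp_add]
      push_cast
      ring_nf
    simp only [h1]
    rw [integral_const_mul, GaussianFourier.integral_cexp_neg_mul_sq_norm_add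
      (by rw [Complex.ofReal_re]; positivity) (-Complex.I) x, finrank_euclideanSpace_fin]
    have h3 : ((Real.pi : ℂ) / ((v ^ 2 : ℝ) : ℂ)) ^ (((3 : ℕ) : ℂ) / 2)
        = ((√Real.pi * Real.pi * (v ^ 3)⁻¹ : ℝ) : ℂ) := by
      rw [← Complex.ofReal_div]
      have : (((3 : ℕ) : ℂ) / 2) = ((3 / 2 : ℝ) : ℂ) := by push_cast; ring
      rw [this, ← Complex.ofReal_cpow (by positivity)]
      congr 1
      rw [Real.div_rpow Real.pi_pos.le (by positivity), ← Real.rpow_natCast v 2,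
        ← Real.rpow_mul hv0.le, show (3 / 2 : ℝ) = 1 + 1 / 2 by norm_num,
        Real.rpow_add Real.pi_pos, Real.rpow_one, ← Real.sqrt_eq_rpow]
      rw [show ((2 : ℕ) : ℝ) * (1 + 1 / 2) = ((3 : ℕ) : ℝ) by norm_num, Real.rpow_natCast]
      field_simp
    have h4 : (-Complex.I) ^ 2 * (‖x‖ : ℂ) ^ 2 / (4 * ((v ^ 2 : ℝ) : ℂ))
        = ((-(‖x‖ ^ 2 / (4 * v ^ 2)) : ℝ) : ℂ) := by
      rw [neg_sq, Complex.I_sq]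
      push_cast
      ring
    rw [h3, h4, ← Complex.ofReal_exp, ← Complex.ofReal_mul, ← Complex.ofReal_mul]
    congr 1
    rw [show -(m ^ 2 * v ^ 2) - (τ ^ 2 + ‖x‖ ^ 2) / (4 * v ^ 2)
      = -(m ^ 2 * v ^ 2) - τ ^ 2 / (4 * v ^ 2) + -(‖x‖ ^ 2 / (4 * v ^ 2)) by ring, Real.exp_add]
    field_simp
  rw [setIntegral_congr_fun measurableSet_Ioi e2, integral_complex_ofReal, integral_const_mul]
  generalize (∫ v in Ioi (0 : ℝ), (v ^ 3)⁻¹ *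
    Real.exp (-(m ^ 2 * v ^ 2) - (τ ^ 2 + ‖x‖ ^ 2) / (4 * v ^ 2))) = J
  push_cast
  have : (m : ℂ) ≠ 0 := by exact_mod_cast hm.ne'
  field_simp
  ring


/-! ### Analyticity and decay of the kernel `p^-` -/

/-- The derivative of `besselB`. -/
def besselB' (ξ : ℂ) : ℂ :=
  ∫ s in Ioi (1 : ℝ), Complex.exp (-ξ * (s : ℂ)) * (-(s : ℂ)) * ((√(s ^ 2 - 1) : ℝ) : ℂ)

lemma norm_exp_neg_mul_le {ξ : ℂ} {a s : ℝ} (h : a ≤ ξ.re) (hs : 1 < s) :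
    ‖Complex.exp (-ξ * (s : ℂ))‖ ≤ Real.exp (-(a * s)) := by
  rw [Complex.norm_exp]
  simp only [Complex.mul_re, Complex.neg_re, Complex.ofReal_re, Complex.neg_im, Complex.ofReal_im,
    mul_zero, sub_zero]
  gcongr
  nlinarith

lemma sqrt_sq_sub_one_le {s : ℝ} (hs : 1 < s) : √(s ^ 2 - 1) ≤ s :=
  Real.sqrt_le_iff.2 ⟨by linarith, by linarith⟩

lemma norm_besselB_integrand_le {ξ : ℂ} {a s : ℝ} (h : a ≤ ξ.re) (hs : 1 < s) :
    ‖Complex.exp (-ξ * (s : ℂ)) * ((√(s ^ 2 - 1) : ℝ) : ℂ)‖ ≤ s ^ 2 * Real.exp (-(a * s)) := by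
  rw [norm_mul, Complex.norm_real, Real.norm_of_nonneg (Real.sqrt_nonneg _), mul_comm]
  have h1 := sqrt_sq_sub_one_le hs
  exact mul_le_mul (by nlinarith) (norm_exp_neg_mul_le h hs) (norm_nonneg _) (by positivity)

lemma norm_besselB'_integrand_le {ξ : ℂ} {a s : ℝ} (h : a ≤ ξ.re) (hs : 1 < s) :
    ‖Complex.exp (-ξ * (s : ℂ)) * (-(s : ℂ)) * ((√(s ^ 2 - 1) : ℝ) : ℂ)‖
      ≤ s ^ 2 * Real.exp (-(a * s)) := by
  rw [norm_mul, norm_mul, norm_neg, Complex.norm_real, Complex.norm_real,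
    Real.norm_of_nonneg (Real.sqrt_nonneg _), Real.norm_of_nonneg (by linarith : 0 ≤ s), mul_assoc,
    mul_comm]
  have h1 := sqrt_sq_sub_one_le hs
  exact mul_le_mul (by nlinarith) (norm_exp_neg_mul_le h hs) (norm_nonneg _) (by positivity)

lemma integrableOn_sq_mul_exp {a : ℝ} (ha : 0 < a) :
    IntegrableOn (fun s => s ^ 2 * Real.exp (-(a * s))) (Ioi (1 : ℝ)) := by
  have h := (integrableOn_rpow_mul_exp_neg_mul_rpow (s := 2) (p := 1) (b := a) (by norm_num)
    one_pos ha).mono_set (Ioi_subset_Ioi zero_le_one)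
  refine h.congr_fun (fun s _ => ?_) measurableSet_Ioi
  simp only [Real.rpow_two, Real.rpow_one, neg_mul]

lemma integral_sq_mul_exp_le {a : ℝ} (ha : 0 < a) :
    ∫ s in Ioi (1 : ℝ), s ^ 2 * Real.exp (-(a * s)) ≤ 16 * (a ^ 3)⁻¹ * Real.exp (-(a / 2)) := by
  have h2 : 0 < a / 2 := by positivity
  have hi := integrableOn_rpow_mul_exp_neg_mul_rpow (s := 2) (p := 1) (b := a / 2) (by norm_num)
    one_pos h2
  simp only [Real.rpow_two, Real.rpow_one, neg_mul] at hi
  have e : ∫ s in Ioi (0 : ℝ), s ^ 2 * Real.exp (-(a / 2 * s)) = 16 * (a ^ 3)⁻¹ := by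
    have := Real.integral_rpow_mul_exp_neg_mul_Ioi (a := 3) (by norm_num) h2
    rw [show (3 : ℝ) - 1 = 2 by norm_num] at this
    simp only [Real.rpow_two] at this
    rw [this, show (3 : ℝ) = (2 : ℕ) + 1 by norm_num, Real.Gamma_nat_eq_factorial,
      show ((2 : ℕ) : ℝ) + 1 = (3 : ℕ) by norm_num, Real.rpow_natCast]
    simp only [Nat.factorial]
    field_simp
    norm_num
  calc _ ≤ ∫ s in Ioi (1 : ℝ), s ^ 2 * Real.exp (-(a / 2 * s)) * Real.exp (-(a / 2)) := by
        refine setIntegral_mono_on (integrableOn_sq_mul_exp ha)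
          ((hi.mono_set (Ioi_subset_Ioi zero_le_one)).mul_const _) measurableSet_Ioi fun s hs => ?_
        have hs1 : 1 < s := hs
        rw [mul_assoc, ← Real.exp_add]
        gcongr
        nlinarith
    _ = (∫ s in Ioi (1 : ℝ), s ^ 2 * Real.exp (-(a / 2 * s))) * Real.exp (-(a / 2)) :=
        integral_mul_const _ _
    _ ≤ _ := by
        rw [← e]
        exact mul_le_mul_of_nonneg_right (setIntegral_mono_set hi
          (Eventually.of_forall fun s => by positivity)
          (Ioi_subset_Ioi zero_le_one).eventuallyLE) (Real.exp_pos _).le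

lemma norm_besselB_le {ξ : ℂ} {a : ℝ} (ha : 0 < a) (h : a ≤ ξ.re) :
    ‖besselB ξ‖ ≤ 16 * (a ^ 3)⁻¹ * Real.exp (-(a / 2)) :=
  (norm_integral_le_of_norm_le (integrableOn_sq_mul_exp ha)
    ((ae_restrict_iff' measurableSet_Ioi).2 (Eventually.of_forall fun _ hs =>
      norm_besselB_integrand_le h hs))).trans (integral_sq_mul_exp_le ha)

lemma norm_besselB'_le {ξ : ℂ} {a : ℝ} (ha : 0 < a) (h : a ≤ ξ.re) :
    ‖besselB' ξ‖ ≤ 16 * (a ^ 3)⁻¹ * Real.exp (-(a / 2)) :=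
  (norm_integral_le_of_norm_le (integrableOn_sq_mul_exp ha)
    ((ae_restrict_iff' measurableSet_Ioi).2 (Eventually.of_forall fun _ hs =>
      norm_besselB'_integrand_le h hs))).trans (integral_sq_mul_exp_le ha)

lemma hasDerivAt_besselB {ξ : ℂ} (h : 0 < ξ.re) : HasDerivAt besselB (besselB' ξ) ξ := by
  have h2 : 0 < ξ.re / 2 := by positivity
  have hU : {η : ℂ | ξ.re / 2 < η.re} ∈ 𝓝 ξ :=
    (isOpen_lt continuous_const Complex.continuous_re).mem_nhds (by change ξ.re / 2 < ξ.re; linarith)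
  have hm : ∀ η : ℂ, Continuous fun s : ℝ =>
      Complex.exp (-η * (s : ℂ)) * ((√(s ^ 2 - 1) : ℝ) : ℂ) := fun η => by fun_prop
  refine (hasDerivAt_integral_of_dominated_loc_of_deriv_le
    (bound := fun s => s ^ 2 * Real.exp (-(ξ.re / 2 * s)))
    (F' := fun ξ s => Complex.exp (-ξ * (s : ℂ)) * (-(s : ℂ)) * ((√(s ^ 2 - 1) : ℝ) : ℂ))
    hU (Eventually.of_forall fun η => (hm η).aestronglyMeasurable) ?_ ?_ ?_
    (integrableOn_sq_mul_exp h2) ?_).2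
  · exact (integrableOn_sq_mul_exp h2).mono' (hm ξ).aestronglyMeasurable
      ((ae_restrict_iff' measurableSet_Ioi).2 (Eventually.of_forall fun _ hs =>
        norm_besselB_integrand_le (by linarith) hs))
  · exact Continuous.aestronglyMeasurable (by fun_prop)
  · exact (ae_restrict_iff' measurableSet_Ioi).2 (Eventually.of_forall fun _ hs _ hη =>
      norm_besselB'_integrand_le (le_of_lt hη) hs)
  · refine Eventually.of_forall fun s η _ => ?_
    have h1 : HasDerivAt (fun η : ℂ => -η * (s : ℂ)) (-(s : ℂ)) η := by
      simpa using (hasDerivAt_id η).neg.mul_const (s : ℂ)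
    exact h1.cexp.mul_const _

lemma isOpen_re_pos : IsOpen {ξ : ℂ | 0 < ξ.re} :=
  isOpen_lt continuous_const Complex.continuous_re

lemma continuousOn_besselB : ContinuousOn besselB {ξ : ℂ | 0 < ξ.re} := fun _ h =>
  (hasDerivAt_besselB h).continuousAt.continuousWithinAt

lemma continuousOn_besselB' : ContinuousOn besselB' {ξ : ℂ | 0 < ξ.re} := by
  have h : DifferentiableOn ℂ besselB {ξ : ℂ | 0 < ξ.re} := fun _ h =>
    (hasDerivAt_besselB h).differentiableAt.differentiableWithinAt
  refine (h.analyticOnNhd isOpen_re_pos).deriv.continuousOn.congr fun ξ hξ => ?_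
  exact (hasDerivAt_besselB hξ).deriv.symm

/-- The domain `{w | -w_μ w^μ ∉ (-∞, 0]}` of the kernel. -/
def kernelDomain : Set CSpacetime := {w | -cminkSq w ∈ Complex.slitPlane}

lemma continuous_cminkSq : Continuous cminkSq := by
  unfold cminkSq
  fun_prop

lemma isOpen_kernelDomain : IsOpen kernelDomain :=
  Complex.isOpen_slitPlane.preimage continuous_cminkSq.neg

lemma rfun_sq (w : CSpacetime) : rfun w ^ 2 = -cminkSq w := by
  simp [rfun]

lemma rfun_re_pos {w : CSpacetime} (h : w ∈ kernelDomain) : 0 < (rfun w).re := by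
  rw [rfun, one_div, Complex.cpow_inv_two_re]
  refine Real.sqrt_pos.2 (div_pos ?_ two_pos)
  rcases Complex.mem_slitPlane_iff.1 h with h1 | h1
  · positivity
  · have := Complex.abs_re_lt_norm.2 h1
    linarith [neg_abs_le (-cminkSq w).re]

lemma rfun_ne_zero {w : CSpacetime} (h : w ∈ kernelDomain) : rfun w ≠ 0 := fun h0 => by
  have := rfun_re_pos h
  rw [h0] at this
  simp at this

lemma mul_rfun_re_pos {m : ℝ} (hm : 0 < m) {w : CSpacetime} (h : w ∈ kernelDomain) :
    0 < ((m : ℂ) * rfun w).re := by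
  rw [Complex.re_ofReal_mul]
  exact mul_pos hm (rfun_re_pos h)

lemma Dfun_eq {m : ℝ} (hm : 0 < m) {w : CSpacetime} (h : w ∈ kernelDomain) :
    Dfun m w = -((m : ℂ) ^ 3 / (2 * (Real.pi : ℂ) ^ 2)) * besselB (m * rfun w) := by
  have h1 : (m : ℂ) * rfun w ≠ 0 :=
    mul_ne_zero (by exact_mod_cast hm.ne') (rfun_ne_zero h)
  rw [Dfun, besselK1, ← besselB, mul_div_cancel_left₀ _ h1]

/-- The derivative of the Minkowski square. -/
def cminkSqDeriv (w : CSpacetime) : CSpacetime →L[ℂ] ℂ :=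
  ∑ μ, (2 * (metric μ : ℂ) * w μ) • ContinuousLinearMap.proj (R := ℂ) (φ := fun _ : Fin 4 => ℂ) μ

lemma hasFDerivAt_cminkSq (w : CSpacetime) : HasFDerivAt cminkSq (cminkSqDeriv w) w := by
  unfold cminkSqDeriv
  refine HasFDerivAt.fun_sum fun μ _ => ?_
  have h1 : HasFDerivAt (fun w : CSpacetime => w μ)
    (ContinuousLinearMap.proj (R := ℂ) (φ := fun _ : Fin 4 => ℂ) μ) w :=
    hasFDerivAt_apply μ w
  refine ((h1.const_mul (metric μ : ℂ)).mul h1).congr_fderiv ?_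
  ext v
  simp
  ring

lemma cminkSqDeriv_single (w : CSpacetime) (μ : Fin 4) :
    cminkSqDeriv w (Pi.single μ 1) = 2 * (metric μ : ℂ) * w μ := by
  simp [cminkSqDeriv, Pi.single_apply]

lemma hasFDerivAt_rfun {w : CSpacetime} (h : w ∈ kernelDomain) :
    HasFDerivAt rfun ((-(1 / (2 * rfun w))) • cminkSqDeriv w) w := by
  have h0 : -cminkSq w ≠ 0 := Complex.slitPlane_ne_zero h
  have h1 : HasDerivAt (fun z : ℂ => z ^ (1 / 2 : ℂ))
      ((1 / 2 : ℂ) * (-cminkSq w) ^ ((1 / 2 : ℂ) - 1) * 1) (-cminkSq w) :=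
    (hasDerivAt_id _).cpow_const h
  refine (h1.comp_hasFDerivAt w (hasFDerivAt_cminkSq w).neg).congr_fderiv ?_
  have h2 : (-cminkSq w) ^ ((1 / 2 : ℂ) - 1) = 1 / rfun w := by
    have e : (-cminkSq w) ^ (1 / 2 : ℂ) = rfun w := rfl
    rw [Complex.cpow_sub _ _ h0, Complex.cpow_one, e, ← rfun_sq w]
    have := rfun_ne_zero h
    field_simp
  rw [h2]
  have := rfun_ne_zero h
  ext v
  simp only [smul_neg, neg_apply, smul_apply, smul_eq_mul]
  field_simp

lemma hasFDerivAt_Dfun {m : ℝ} (hm : 0 < m) {w : CSpacetime} (h : w ∈ kernelDomain) :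
    HasFDerivAt (Dfun m) ((((m : ℂ) ^ 4 / (2 * (Real.pi : ℂ) ^ 2)) *
      (besselB' (m * rfun w) / (2 * rfun w))) • cminkSqDeriv w) w := by
  have h1 := (hasDerivAt_besselB (mul_rfun_re_pos hm h)).comp_hasFDerivAt w
    ((hasFDerivAt_rfun h).const_mul (m : ℂ))
  have h2 := h1.const_mul (-((m : ℂ) ^ 3 / (2 * (Real.pi : ℂ) ^ 2)))
  refine (h2.congr_of_eventuallyEq ?_).congr_fderiv ?_
  · filter_upwards [isOpen_kernelDomain.mem_nhds h] with w' hw'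
    exact Dfun_eq hm hw'
  · ext v
    simp only [smul_apply, smul_eq_mul]
    ring

/-- The slash `γ^μ w_μ` of a complex four-vector. -/
def cslash (w : CSpacetime) : Matrix (Fin 4) (Fin 4) ℂ := ∑ μ, ((metric μ : ℂ) * w μ) • gam μ

lemma pminus_eq {m : ℝ} (hm : 0 < m) {w : CSpacetime} (h : w ∈ kernelDomain) :
    pminus m w = (-((m : ℂ) ^ 3 / (4 * (Real.pi : ℂ) ^ 2))) •
      ((Complex.I * besselB' (m * rfun w) / rfun w) • cslash w
        + besselB (m * rfun w) • (1 : Matrix (Fin 4) (Fin 4) ℂ)) := by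
  have hm0 : (m : ℂ) ≠ 0 := by exact_mod_cast hm.ne'
  have hr := rfun_ne_zero h
  have hpi : (Real.pi : ℂ) ≠ 0 := by exact_mod_cast Real.pi_ne_zero
  rw [pminus, (hasFDerivAt_Dfun hm h).fderiv, Dfun_eq hm h, cslash]
  simp only [smul_apply, cminkSqDeriv_single, smul_eq_mul, smul_add, smul_smul, Finset.smul_sum]
  congr 1
  · refine Finset.sum_congr rfl fun μ _ => ?_
    congr 1
    field_simp
    ring
  · congr 1
    field_simp
    ring

lemma continuousOn_rfun : ContinuousOn rfun kernelDomain := fun _ h =>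
  (hasFDerivAt_rfun h).continuousAt.continuousWithinAt

lemma continuous_cslash : Continuous cslash := by
  unfold cslash
  refine continuous_finsetSum _ fun μ _ => ?_
  have h : Continuous fun w : CSpacetime => (metric μ : ℂ) * w μ := by fun_prop
  exact h.smul (continuous_const (y := gam μ))

lemma continuousOn_pminus {m : ℝ} (hm : 0 < m) : ContinuousOn (pminus m) kernelDomain := by
  have h1 : ContinuousOn (fun w => (m : ℂ) * rfun w) kernelDomain :=
    continuousOn_const.mul continuousOn_rfun
  have hmap : MapsTo (fun w => (m : ℂ) * rfun w) kernelDomain {ξ : ℂ | 0 < ξ.re} :=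
    fun w h => mul_rfun_re_pos hm h
  have h2 : ContinuousOn (fun w => besselB (m * rfun w)) kernelDomain :=
    continuousOn_besselB.comp h1 hmap
  have h3 : ContinuousOn (fun w => besselB' (m * rfun w)) kernelDomain :=
    continuousOn_besselB'.comp h1 hmap
  have h4 : ContinuousOn (fun w => Complex.I * besselB' (m * rfun w) / rfun w) kernelDomain :=
    (continuousOn_const.mul h3).div continuousOn_rfun fun w h => rfun_ne_zero h
  have h5 : ContinuousOn (fun w => (Complex.I * besselB' (m * rfun w) / rfun w) • cslash w
      + besselB (m * rfun w) • (1 : Matrix (Fin 4) (Fin 4) ℂ)) kernelDomain :=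
    (h4.smul continuous_cslash.continuousOn).add (h2.smul continuousOn_const)
  exact (h5.const_smul (-((m : ℂ) ^ 3 / (4 * (Real.pi : ℂ) ^ 2)))).congr fun w h =>
    pminus_eq hm h

lemma norm_act_gam_le : ∃ C : ℝ, 0 ≤ C ∧ ∀ μ, ‖act (gam μ)‖ ≤ C :=
  ⟨∑ μ, ‖act (gam μ)‖, Finset.sum_nonneg fun _ _ => norm_nonneg _, fun μ =>
    Finset.single_le_sum (f := fun μ => ‖act (gam μ)‖) (fun _ _ => norm_nonneg _)
      (Finset.mem_univ μ)⟩

lemma abs_metric (μ : Fin 4) : |metric μ| = 1 := by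
  fin_cases μ <;> simp [metric]

/-- The size of the kernel in terms of a lower bound `a` of `Re r(w)` and a bound `b` for
the ratio of the components of `w` and `a`. -/
lemma norm_act_pminus_le {m : ℝ} (hm : 0 < m) : ∃ C : ℝ, 0 ≤ C ∧ ∀ (w : CSpacetime) (a b : ℝ),
    w ∈ kernelDomain → 0 < a → 0 ≤ b → a ≤ (rfun w).re → (∀ μ, ‖w μ‖ ≤ b * a) →
      ‖act (pminus m w)‖ ≤ C * (b + 1) * (a ^ 3)⁻¹ * Real.exp (-(m * a / 2)) := by
  obtain ⟨C, hC0, hC⟩ := norm_act_gam_le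
  refine ⟨‖-((m : ℂ) ^ 3 / (4 * (Real.pi : ℂ) ^ 2))‖ * (16 * (m ^ 3)⁻¹) * (4 * C + 1),
    by positivity, fun w a b hw ha hb har hwb => ?_⟩
  have hma : 0 < m * a := mul_pos hm ha
  have hre : m * a ≤ ((m : ℂ) * rfun w).re := by
    rw [Complex.re_ofReal_mul]; gcongr
  have h1 := norm_besselB_le hma hre
  have h2 := norm_besselB'_le hma hre
  rw [mul_pow, mul_inv] at h1 h2
  have hr : a ≤ ‖rfun w‖ := har.trans (Complex.re_le_norm _)
  have h3 : ‖act (cslash w)‖ ≤ 4 * C * (b * a) := by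
    have e : act (cslash w) = ∑ μ, ((metric μ : ℂ) * w μ) • act (gam μ) := by
      ext1 v
      rw [cslash, act_sum]
      simp only [act_smul, sum_apply, smul_apply]
    rw [e]
    refine (norm_sum_le _ _).trans ?_
    calc _ ≤ ∑ _μ : Fin 4, (b * a) * C := by
          refine Finset.sum_le_sum fun μ _ => ?_
          rw [norm_smul, norm_mul, Complex.norm_real, Real.norm_eq_abs, abs_metric, one_mul]
          exact mul_le_mul (hwb μ) (hC μ) (norm_nonneg _) (by positivity)
      _ = _ := by simp; ring
  have e2 : act (pminus m w) = (-((m : ℂ) ^ 3 / (4 * (Real.pi : ℂ) ^ 2))) •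
      ((Complex.I * besselB' (m * rfun w) / rfun w) • act (cslash w)
        + besselB (m * rfun w) • act 1) := by
    rw [pminus_eq hm hw]
    ext1 v
    simp only [act_smul, act_add, smul_apply, add_apply]
  have h4 : ‖act 1‖ ≤ 1 := ContinuousLinearMap.opNorm_le_bound _ zero_le_one fun v => by
    rw [act_one, one_mul]
  rw [e2, norm_smul]
  set B := 16 * ((m ^ 3)⁻¹ * (a ^ 3)⁻¹) * Real.exp (-(m * a / 2))
  have hB : 0 ≤ B := by positivity
  have h5 : ‖(Complex.I * besselB' (m * rfun w) / rfun w) • act (cslash w)‖ ≤ B * (4 * C * b) := by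
    rw [norm_smul, norm_div, norm_mul, Complex.norm_I, one_mul]
    calc _ ≤ B / a * (4 * C * (b * a)) := by gcongr
      _ = _ := by field_simp
  have h6 : ‖besselB (m * rfun w) • act 1‖ ≤ B * 1 := by
    rw [norm_smul]
    gcongr
  calc _ ≤ ‖-((m : ℂ) ^ 3 / (4 * (Real.pi : ℂ) ^ 2))‖ * (B * (4 * C * b) + B * 1) := by
        gcongr
        exact (norm_add_le _ _).trans (add_le_add h5 h6)
    _ ≤ ‖-((m : ℂ) ^ 3 / (4 * (Real.pi : ℂ) ^ 2))‖ * (B * ((4 * C + 1) * (b + 1))) := by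
        rw [← mul_add]
        gcongr
        nlinarith
    _ = _ := by simp only [B]; ring


/-! ### The kernel as a Fourier integral over the negative mass shell -/

/-- The spatial part of a real four-vector. -/
def spat (b : Spacetime) : Space := WithLp.toLp 2 fun k => b k.succ

lemma spat_apply (b : Spacetime) (k : Fin 3) : spat b k = b k.succ := rfl

lemma point_spat (b : Spacetime) : point (b 0) (spat b) = b := point_eta b

lemma spat_point (b0 : ℝ) (b : Space) : spat (point b0 b) = b := by
  ext k; fin_cases k <;> rfl

lemma continuous_spat : Continuous spat :=
  (PiLp.continuous_toLp 2 _).comp (continuous_pi fun k => continuous_apply k.succ)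

lemma norm_spat_sq (b : Spacetime) : ‖spat b‖ ^ 2 = b 1 ^ 2 + b 2 ^ 2 + b 3 ^ 2 := by
  rw [EuclideanSpace.norm_sq_eq]
  simp only [Fin.sum_univ_three, Real.norm_eq_abs, sq_abs]
  rfl

lemma mink_self (b : Spacetime) : mink b b = b 0 ^ 2 - ‖spat b‖ ^ 2 := by
  rw [norm_spat_sq, mink]
  simp [Fin.sum_univ_four, metric]
  ring

/-- The quantity `-b⁰ - |b|`, positive exactly for the past-directed time-like vectors `b`. It is
the rate of the exponential decay in `p` of `e^{-p_μ b^μ}` on the negative mass shell. -/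
def coneGap (b : Spacetime) : ℝ := -b 0 - ‖spat b‖

lemma continuous_coneGap : Continuous coneGap :=
  (continuous_apply 0).neg.sub continuous_spat.norm

lemma coneGap_pos_iff (b : Spacetime) : 0 < coneGap b ↔ b ∈ Past := by
  have h0 := norm_nonneg (spat b)
  rw [coneGap]
  constructor
  · intro h
    have h1 : b 0 < 0 := by linarith
    exact ⟨by rw [mink_self]; nlinarith, h1⟩
  · rintro ⟨h1, h2⟩
    rw [mink_self] at h1
    nlinarith

lemma coneGap_mul_norm_le (m : ℝ) {b : Spacetime} (hb : 0 < coneGap b) (p : Space) :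
    coneGap b * ‖p‖ ≤ mink (negShell m p) b := by
  conv_rhs => rw [← point_spat b, mink_point]
  have h1 := real_inner_le_norm p (spat b)
  have h2 := norm_le_energy m p
  have h3 := ((coneGap_pos_iff b).1 hb).2
  rw [coneGap]
  nlinarith

/-- The functional `w ↦ p_μ w^μ` on complex four-vectors. -/
def cmink (p : Spacetime) : CSpacetime →L[ℂ] ℂ :=
  ∑ μ, ((metric μ * p μ : ℝ) : ℂ) • ContinuousLinearMap.proj (R := ℂ) (φ := fun _ : Fin 4 => ℂ) μ

lemma cmink_apply (p : Spacetime) (w : CSpacetime) :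
    cmink p w = ∑ μ, ((metric μ * p μ : ℝ) : ℂ) * w μ := by
  simp [cmink]

lemma cmink_single (p : Spacetime) (μ : Fin 4) :
    cmink p (Pi.single μ 1) = ((metric μ * p μ : ℝ) : ℂ) := by
  simp [cmink_apply, Pi.single_apply]

lemma continuous_cmink : Continuous cmink := by
  unfold cmink
  fun_prop

/-- The imaginary part of a complex four-vector. -/
def imVec (w : CSpacetime) : Spacetime := fun μ => (w μ).im

lemma continuous_imVec : Continuous imVec :=
  continuous_pi fun μ => Complex.continuous_im.comp (continuous_apply μ)

lemma cmink_im (p : Spacetime) (w : CSpacetime) : (cmink p w).im = mink p (imVec w) := by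
  rw [cmink_apply, Complex.im_sum, mink]
  exact Finset.sum_congr rfl fun μ _ => Complex.im_ofReal_mul _ _

lemma norm_exp_cmink (p : Spacetime) (w : CSpacetime) :
    ‖Complex.exp (Complex.I * cmink p w)‖ = Real.exp (-mink p (imVec w)) := by
  rw [Complex.norm_exp]
  simp [cmink_im]

/-- The tube of complex four-vectors with past-directed time-like imaginary part. -/
def tube : Set CSpacetime := {w | imVec w ∈ Past}

lemma isOpen_tube : IsOpen tube := by
  have : tube = {w | 0 < coneGap (imVec w)} := by
    ext w; exact (coneGap_pos_iff _).symm
  rw [this]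
  exact isOpen_lt continuous_const (continuous_coneGap.comp continuous_imVec)

lemma tube_subset_kernelDomain : tube ⊆ kernelDomain := by
  intro w hw
  obtain ⟨h1, h2⟩ := hw
  have e : -cminkSq w = ((-((w 0).re ^ 2 - (w 1).re ^ 2 - (w 2).re ^ 2 - (w 3).re ^ 2) +
      mink (imVec w) (imVec w) : ℝ) : ℂ) - 2 * Complex.I * (((w 0).re * (w 0).im -
      (w 1).re * (w 1).im - (w 2).re * (w 2).im - (w 3).re * (w 3).im : ℝ) : ℂ) := by
    simp only [cminkSq, mink, imVec, metric, Fin.sum_univ_four]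
    apply Complex.ext <;> simp [pow_two] <;> ring
  change -cminkSq w ∈ Complex.slitPlane
  rw [Complex.mem_slitPlane_iff, e]
  set s := (w 0).re * (w 0).im - (w 1).re * (w 1).im - (w 2).re * (w 2).im - (w 3).re * (w 3).im
    with hs
  set q := (w 0).re ^ 2 - (w 1).re ^ 2 - (w 2).re ^ 2 - (w 3).re ^ 2 with hq
  by_cases h : s = 0
  · left
    rw [h]
    have h3 : q ≤ 0 := by
      rw [mink_self, norm_spat_sq] at h1
      simp only [imVec] at h1 h2
      set a0 := (w 0).re; set a1 := (w 1).re; set a2 := (w 2).re; set a3 := (w 3).re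
      set b0 := (w 0).im; set b1 := (w 1).im; set b2 := (w 2).im; set b3 := (w 3).im
      have h4 : a0 * b0 = a1 * b1 + a2 * b2 + a3 * b3 := by linarith
      have h5 : (a1 * b1 + a2 * b2 + a3 * b3) ^ 2
          ≤ (a1 ^ 2 + a2 ^ 2 + a3 ^ 2) * (b1 ^ 2 + b2 ^ 2 + b3 ^ 2) := by
        nlinarith [sq_nonneg (a1 * b2 - a2 * b1), sq_nonneg (a1 * b3 - a3 * b1),
          sq_nonneg (a2 * b3 - a3 * b2)]
      rw [← h4] at h5
      have h6 : a0 ^ 2 * b0 ^ 2 ≤ (a1 ^ 2 + a2 ^ 2 + a3 ^ 2) * b0 ^ 2 := by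
        have : 0 ≤ a1 ^ 2 + a2 ^ 2 + a3 ^ 2 := by positivity
        nlinarith
      have h7 := le_of_mul_le_mul_right h6 (by nlinarith)
      rw [hq]
      linarith
    simp
    linarith
  · right
    simp
    exact h

/-- The Fourier integral of the invariant measure on the negative mass shell. -/
def shellIntegral (m : ℝ) (w : CSpacetime) : ℂ :=
  ∫ p : Space, ((energy m p)⁻¹ : ℂ) * Complex.exp (Complex.I * cmink (negShell m p) w)

lemma continuous_cmink_negShell (m : ℝ) (w : CSpacetime) :
    Continuous fun p => cmink (negShell m p) w := by
  simp only [cmink_apply]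
  refine continuous_finsetSum _ fun μ _ => ?_
  exact (Complex.continuous_ofReal.comp (continuous_const.mul
    ((continuous_apply μ).comp (continuous_negShell m)))).mul continuous_const

lemma continuous_exp_cmink (m : ℝ) (w : CSpacetime) :
    Continuous fun p => Complex.exp (Complex.I * cmink (negShell m p) w) :=
  Complex.continuous_exp.comp (continuous_const.mul (continuous_cmink_negShell m w))

lemma continuous_shell_integrand {m : ℝ} (hm : 0 < m) (w : CSpacetime) : Continuous fun p : Space =>
    ((energy m p)⁻¹ : ℂ) * Complex.exp (Complex.I * cmink (negShell m p) w) := by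
  have h2 : Continuous fun p : Space => ((energy m p : ℝ) : ℂ)⁻¹ :=
    (Complex.continuous_ofReal.comp (continuous_energy m)).inv₀ fun p =>
      Complex.ofReal_ne_zero.2 (energy_pos hm p).ne'
  exact h2.mul (continuous_exp_cmink m w)

lemma norm_exp_cmink_le (m : ℝ) {w : CSpacetime} {c : ℝ} (hc : 0 < c) (h : c ≤ coneGap (imVec w))
    (p : Space) :
    ‖Complex.exp (Complex.I * cmink (negShell m p) w)‖ ≤ Real.exp (-c * ‖p‖) := by
  rw [norm_exp_cmink]
  have h1 := coneGap_mul_norm_le m (hc.trans_le h) p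
  have h2 := mul_le_mul_of_nonneg_right h (norm_nonneg p)
  gcongr
  linarith

lemma integrable_exp_cmink (m : ℝ) {w : CSpacetime} (hw : w ∈ tube) :
    Integrable fun p => Complex.exp (Complex.I * cmink (negShell m p) w) := by
  have h := (coneGap_pos_iff _).2 hw
  exact (integrable_exp_neg_mul_norm h).mono' (continuous_exp_cmink m w).aestronglyMeasurable
    (Eventually.of_forall fun p => norm_exp_cmink_le m h le_rfl p)

lemma abs_negShell_le (m : ℝ) (p : Space) (μ : Fin 4) : |negShell m p μ| ≤ energy m p := by
  refine Fin.cases ?_ (fun k => ?_) μ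
  · rw [negShell_zero, abs_neg, abs_of_nonneg (show 0 ≤ energy m p from Real.sqrt_nonneg _)]
  · rw [negShell_succ]
    exact (PiLp.norm_apply_le p k).trans (norm_le_energy m p)

lemma norm_cmink_negShell_le (m : ℝ) (p : Space) : ‖cmink (negShell m p)‖ ≤ 4 * energy m p := by
  have hE : 0 ≤ energy m p := Real.sqrt_nonneg _
  refine ContinuousLinearMap.opNorm_le_bound _ (by positivity) fun w => ?_
  rw [cmink_apply]
  refine (norm_sum_le _ _).trans ?_
  calc _ ≤ ∑ _μ : Fin 4, energy m p * ‖w‖ := by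
        refine Finset.sum_le_sum fun μ _ => ?_
        rw [norm_mul, Complex.norm_real, Real.norm_eq_abs, abs_mul, abs_metric, one_mul]
        exact mul_le_mul (abs_negShell_le m p μ) (norm_le_pi_norm w μ) (norm_nonneg _) hE
    _ = _ := by simp; ring

lemma integrable_shell_integrand {m : ℝ} (hm : 0 < m) {w : CSpacetime} (hw : w ∈ tube) :
    Integrable fun p : Space =>
      ((energy m p)⁻¹ : ℂ) * Complex.exp (Complex.I * cmink (negShell m p) w) := by
  refine ((integrable_exp_cmink m hw).norm.const_mul m⁻¹).mono'
    (continuous_shell_integrand hm w).aestronglyMeasurable (Eventually.of_forall fun p => ?_)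
  rw [norm_mul, norm_inv, Complex.norm_real, Real.norm_of_nonneg (energy_pos hm p).le]
  have := le_energy m p
  gcongr

/-- The derivative in `w` of the integrand of `shellIntegral`. -/
def shellDeriv (m : ℝ) (w : CSpacetime) (p : Space) : CSpacetime →L[ℂ] ℂ :=
  (((energy m p)⁻¹ : ℂ) * Complex.exp (Complex.I * cmink (negShell m p) w)) •
    (Complex.I • cmink (negShell m p))

lemma norm_shellDeriv_le {m : ℝ} (hm : 0 < m) {w : CSpacetime} {c : ℝ} (hc : 0 < c)
    (h : c ≤ coneGap (imVec w)) (p : Space) :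
    ‖shellDeriv m w p‖ ≤ 4 * Real.exp (-c * ‖p‖) := by
  have hE := energy_pos hm p
  rw [shellDeriv, norm_smul, norm_smul, Complex.norm_I, one_mul, norm_mul, norm_inv,
    Complex.norm_real, Real.norm_of_nonneg hE.le]
  calc _ ≤ (energy m p)⁻¹ * Real.exp (-c * ‖p‖) * (4 * energy m p) := by
        gcongr
        · exact norm_exp_cmink_le m hc h p
        · exact norm_cmink_negShell_le m p
    _ = _ := by field_simp

lemma continuous_shellDeriv {m : ℝ} (hm : 0 < m) (w : CSpacetime) :
    Continuous (shellDeriv m w) :=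
  (continuous_shell_integrand hm w).smul
    ((continuous_cmink.comp (continuous_negShell m)).const_smul Complex.I)

lemma integrable_shellDeriv {m : ℝ} (hm : 0 < m) {w : CSpacetime} (hw : w ∈ tube) :
    Integrable (shellDeriv m w) := by
  have h := (coneGap_pos_iff _).2 hw
  exact ((integrable_exp_neg_mul_norm h).const_mul 4).mono'
    (continuous_shellDeriv hm w).aestronglyMeasurable
    (Eventually.of_forall fun p => norm_shellDeriv_le hm h le_rfl p)

lemma hasFDerivAt_shellIntegral {m : ℝ} (hm : 0 < m) {w : CSpacetime} (hw : w ∈ tube) :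
    HasFDerivAt (shellIntegral m) (∫ p, shellDeriv m w p) w := by
  have h := (coneGap_pos_iff _).2 hw
  have h2 : 0 < coneGap (imVec w) / 2 := by positivity
  have hU : {w' : CSpacetime | coneGap (imVec w) / 2 < coneGap (imVec w')} ∈ 𝓝 w :=
    (isOpen_lt continuous_const (continuous_coneGap.comp continuous_imVec)).mem_nhds
      (by change coneGap (imVec w) / 2 < coneGap (imVec w); linarith)
  refine hasFDerivAt_integral_of_dominated_of_fderiv_le
    (bound := fun p => 4 * Real.exp (-(coneGap (imVec w) / 2) * ‖p‖)) hU
    (Eventually.of_forall fun w' => (continuous_shell_integrand hm w').aestronglyMeasurable)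
    (integrable_shell_integrand hm hw) (continuous_shellDeriv hm w).aestronglyMeasurable
    (Eventually.of_forall fun p w' hw' => norm_shellDeriv_le hm h2 (le_of_lt hw') p)
    ((integrable_exp_neg_mul_norm h2).const_mul 4)
    (Eventually.of_forall fun p w' _ => ?_)
  have h1 := ((cmink (negShell m p)).hasFDerivAt (x := w')).const_mul Complex.I
  refine (h1.cexp.const_mul ((energy m p)⁻¹ : ℂ)).congr_fderiv ?_
  rw [shellDeriv, smul_smul]

/-- The complex line through `z + ib` (at `θ = 1`) along which the Fourier representation is
continued analytically. For purely imaginary `θ` the time component is purely imaginary and the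
spatial components are real, so that the point is Euclidean. -/
def tubeLine (z b : Spacetime) (θ : ℂ) : CSpacetime :=
  Fin.cons (Complex.I * b 0 + θ * z 0) fun k : Fin 3 => z k.succ + Complex.I * θ * b k.succ

lemma tubeLine_zero (z b : Spacetime) (θ : ℂ) :
    tubeLine z b θ 0 = Complex.I * b 0 + θ * z 0 := rfl

lemma tubeLine_succ (z b : Spacetime) (θ : ℂ) (k : Fin 3) :
    tubeLine z b θ k.succ = z k.succ + Complex.I * θ * b k.succ := rfl

lemma differentiable_tubeLine (z b : Spacetime) : Differentiable ℂ (tubeLine z b) := by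
  rw [differentiable_pi]
  refine Fin.cases ?_ fun k => ?_
  · simp only [tubeLine_zero]
    fun_prop
  · simp only [tubeLine_succ]
    fun_prop

/-- The part of the line `tubeLine` inside the tube. -/
def tubeLineDomain (z b : Spacetime) : Set ℂ :=
  {θ | z 0 * θ.im + ‖spat b‖ * θ.re < -b 0} ∩ {θ | z 0 * θ.im - ‖spat b‖ * θ.re < -b 0}

lemma convex_tubeLineDomain (z b : Spacetime) : Convex ℝ (tubeLineDomain z b) := by
  refine Convex.inter ?_ ?_
  · refine convex_halfSpace_lt (f := fun θ : ℂ => z 0 * θ.im + ‖spat b‖ * θ.re) ⟨?_, ?_⟩ _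
    · intro x y; simp; ring
    · intro c x; simp; ring
  · refine convex_halfSpace_lt (f := fun θ : ℂ => z 0 * θ.im - ‖spat b‖ * θ.re) ⟨?_, ?_⟩ _
    · intro x y; simp; ring
    · intro c x; simp; ring

lemma isOpen_tubeLineDomain (z b : Spacetime) : IsOpen (tubeLineDomain z b) :=
  (isOpen_lt (by fun_prop) (by fun_prop)).inter (isOpen_lt (by fun_prop) (by fun_prop))

lemma tubeLine_mem_tube {z b : Spacetime} {θ : ℂ} (h : θ ∈ tubeLineDomain z b) :
    tubeLine z b θ ∈ tube := by
  refine (coneGap_pos_iff _).1 ?_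
  have e : spat (imVec (tubeLine z b θ)) = θ.re • spat b := by
    ext k
    simp only [spat_apply, imVec, tubeLine_succ, PiLp.smul_apply]
    simp
  rw [coneGap, e, norm_smul, Real.norm_eq_abs]
  have e2 : imVec (tubeLine z b θ) 0 = b 0 + z 0 * θ.im := by
    simp only [imVec, tubeLine_zero]
    simp
    ring
  rw [e2]
  obtain ⟨h1, h2⟩ := h
  change z 0 * θ.im + ‖spat b‖ * θ.re < -b 0 at h1
  change z 0 * θ.im - ‖spat b‖ * θ.re < -b 0 at h2
  rcases abs_cases θ.re with ⟨h3, _⟩ | ⟨h3, _⟩ <;> rw [h3] <;> nlinarith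

/-- At Euclidean points, with imaginary time and real position, the kernel is the Fourier integral. -/
lemma Dfun_eq_shellIntegral_euclidean {m : ℝ} (hm : 0 < m) {τ : ℝ} (hτ : 0 < τ) (x : Space)
    {w : CSpacetime} (h0 : w 0 = -(Complex.I * τ)) (hk : ∀ k : Fin 3, w k.succ = x k) :
    Dfun m w = -((m : ℂ) / (2 * Real.pi) ^ 3) * shellIntegral m w := by
  have hpi : (Real.pi : ℂ) ≠ 0 := by exact_mod_cast Real.pi_ne_zero
  have hpos : 0 < τ ^ 2 + ‖x‖ ^ 2 := by positivity
  have hsq : -cminkSq w = ((√(τ ^ 2 + ‖x‖ ^ 2) : ℝ) : ℂ) ^ 2 := by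
    rw [← Complex.ofReal_pow, Real.sq_sqrt hpos.le, cminkSq, Fin.sum_univ_succ]
    simp only [h0, hk, metric_succ, EuclideanSpace.norm_sq_eq, Real.norm_eq_abs, sq_abs]
    have : metric 0 = 1 := rfl
    rw [this, Fin.sum_univ_three, Fin.sum_univ_three]
    push_cast
    linear_combination (-(τ : ℂ) ^ 2) * Complex.I_sq
  have hr : rfun w = (√(τ ^ 2 + ‖x‖ ^ 2) : ℝ) := by
    rw [rfun, hsq, one_div, Complex.sq_cpow_two_inv]
    rw [Complex.ofReal_re]
    exact Real.sqrt_pos.2 hpos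
  have hdom : w ∈ kernelDomain := by
    change -cminkSq w ∈ Complex.slitPlane
    rw [hsq, ← Complex.ofReal_pow, Real.sq_sqrt hpos.le]
    exact Complex.ofReal_mem_slitPlane.2 hpos
  rw [Dfun_eq hm hdom, hr, ← Complex.ofReal_mul]
  have e : shellIntegral m w = ∫ p : Space, ((energy m p)⁻¹ : ℂ) * Complex.exp
      (-(energy m p * τ : ℝ) - Complex.I * (⟪x, p⟫_ℝ : ℝ)) := by
    refine integral_congr_ae (Eventually.of_forall fun p => ?_)
    simp only
    congr 2
    rw [cmink_apply, Fin.sum_univ_succ]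
    simp only [h0, hk, metric_succ, negShell_zero, negShell_succ, PiLp.inner_apply]
    have : metric 0 = 1 := rfl
    rw [this, Fin.sum_univ_three, Fin.sum_univ_three]
    simp only [RCLike.inner_apply, conj_trivial]
    push_cast
    linear_combination ((energy m p : ℂ) * τ) * Complex.I_sq
  rw [e, integral_euclidean hm hτ]
  field_simp
  ring

/-- The Fourier representation of the kernel on the whole tube, by analytic continuation from the
Euclidean points. -/
lemma Dfun_eq_shellIntegral {m : ℝ} (hm : 0 < m) {w : CSpacetime} (hw : w ∈ tube) :
    Dfun m w = -((m : ℂ) / (2 * Real.pi) ^ 3) * shellIntegral m w := by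
  set z : Spacetime := fun μ => (w μ).re with hz
  set b : Spacetime := imVec w with hb
  have hgap : 0 < coneGap b := (coneGap_pos_iff _).2 hw
  rw [coneGap] at hgap
  have hn := norm_nonneg (spat b)
  -- Both sides are analytic in the convex set of the parameters `θ` for which the point is in the tube.
  have hf : AnalyticOnNhd ℂ (fun θ => Dfun m (tubeLine z b θ)) (tubeLineDomain z b) := by
    refine DifferentiableOn.analyticOnNhd (fun θ hθ => ?_) (isOpen_tubeLineDomain z b)
    exact ((hasFDerivAt_Dfun hm (tube_subset_kernelDomain
      (tubeLine_mem_tube hθ))).differentiableAt.comp θ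
      (differentiable_tubeLine z b θ)).differentiableWithinAt
  have hg : AnalyticOnNhd ℂ (fun θ => -((m : ℂ) / (2 * Real.pi) ^ 3) *
      shellIntegral m (tubeLine z b θ)) (tubeLineDomain z b) := by
    refine DifferentiableOn.analyticOnNhd (fun θ hθ => ?_) (isOpen_tubeLineDomain z b)
    exact (((hasFDerivAt_shellIntegral hm (tubeLine_mem_tube hθ)).differentiableAt.comp θ
      (differentiable_tubeLine z b θ)).const_mul _).differentiableWithinAt
  have h0 : (0 : ℂ) ∈ tubeLineDomain z b := by
    refine ⟨?_, ?_⟩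
    · change z 0 * (0 : ℂ).im + ‖spat b‖ * (0 : ℂ).re < -b 0
      simp
      linarith
    · change z 0 * (0 : ℂ).im - ‖spat b‖ * (0 : ℂ).re < -b 0
      simp
      linarith
  have h1 : (1 : ℂ) ∈ tubeLineDomain z b := by
    refine ⟨?_, ?_⟩
    · change z 0 * (1 : ℂ).im + ‖spat b‖ * (1 : ℂ).re < -b 0
      simp
      linarith
    · change z 0 * (1 : ℂ).im - ‖spat b‖ * (1 : ℂ).re < -b 0
      simp
      linarith
  -- The points with `θ` purely imaginary are Euclidean, and such `θ` accumulate at `0`. The given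
  -- point has `θ = 1`.
  have hu0 : Tendsto (fun n : ℕ => ((1 / ((n : ℝ) + 1) : ℝ) : ℂ) * Complex.I) atTop (𝓝 0) := by
    have := ((Complex.continuous_ofReal.tendsto 0).comp
      (tendsto_one_div_add_atTop_nhds_zero_nat (𝕜 := ℝ))).mul_const Complex.I
    simpa using this
  have hu : Tendsto (fun n : ℕ => ((1 / ((n : ℝ) + 1) : ℝ) : ℂ) * Complex.I) atTop (𝓝[≠] 0) := by
    refine tendsto_nhdsWithin_iff.2 ⟨hu0, Eventually.of_forall fun n => ?_⟩
    refine mul_ne_zero ?_ Complex.I_ne_zero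
    have : (1 / ((n : ℝ) + 1)) ≠ 0 := by positivity
    exact_mod_cast this
  have hfr : ∃ᶠ θ in 𝓝[≠] (0 : ℂ), Dfun m (tubeLine z b θ) =
      -((m : ℂ) / (2 * Real.pi) ^ 3) * shellIntegral m (tubeLine z b θ) := by
    refine hu.frequently (Eventually.frequently ?_)
    filter_upwards [hu0.eventually ((isOpen_tubeLineDomain z b).mem_nhds h0)] with n hn
    set η : ℝ := 1 / ((n : ℝ) + 1)
    have hτ : 0 < -(b 0 + η * z 0) := by
      have := hn.1
      change z 0 * ((η : ℂ) * Complex.I).im + ‖spat b‖ * ((η : ℂ) * Complex.I).re < -b 0 at this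
      simp at this
      linarith
    refine Dfun_eq_shellIntegral_euclidean hm hτ (spat z - η • spat b) ?_ fun k => ?_
    · rw [tubeLine_zero]; push_cast; ring
    · rw [tubeLine_succ]
      simp only [PiLp.sub_apply, PiLp.smul_apply, spat_apply, smul_eq_mul]
      push_cast
      linear_combination ((η : ℂ) * b k.succ) * Complex.I_sq
  have key := hf.eqOn_of_preconnected_of_frequently_eq hg
    (convex_tubeLineDomain z b).isPreconnected h0 hfr h1
  have e : tubeLine z b 1 = w := by
    funext μ
    refine Fin.cases ?_ (fun k => ?_) μ
    · rw [tubeLine_zero]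
      apply Complex.ext <;> simp [hz, hb, imVec]
    · rw [tubeLine_succ]
      apply Complex.ext <;> simp [hz, hb, imVec]
  simp only [e] at key
  exact key

/-- The kernel on the tube as a Fourier integral of the projections onto negative energy. -/
lemma act_pminus_gam_zero {m : ℝ} (hm : 0 < m) {w : CSpacetime} (hw : w ∈ tube) (v : Spinor) :
    act (pminus m w) (act (gam 0) v) = (((2 * Real.pi) ^ 3 : ℝ) : ℂ)⁻¹ •
      ∫ p : Space, Complex.exp (Complex.I * cmink (negShell m p) w) • act (negProj m p) v := by
  have hm0 : (m : ℂ) ≠ 0 := by exact_mod_cast hm.ne'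
  have hpi : (Real.pi : ℂ) ≠ 0 := by exact_mod_cast Real.pi_ne_zero
  have hD : HasFDerivAt (Dfun m)
      ((-((m : ℂ) / (2 * Real.pi) ^ 3)) • ∫ p, shellDeriv m w p) w := by
    refine ((hasFDerivAt_shellIntegral hm hw).const_mul _).congr_of_eventuallyEq ?_
    filter_upwards [isOpen_tube.mem_nhds hw] with w' hw'
    exact Dfun_eq_shellIntegral hm hw'
  have hi := integrable_shellDeriv hm hw
  have hi0 := integrable_shell_integrand hm hw
  have hiμ : ∀ μ, Integrable fun p => shellDeriv m w p (Pi.single μ 1) := fun μ =>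
    hi.apply_continuousLinearMap _
  -- Differentiation under the integral yields `(p̸ + m) γ⁰`, which is `2 p⁰ Π(p)` on the shell.
  have e1 : ∀ p : Space, Complex.exp (Complex.I * cmink (negShell m p) w) • act (negProj m p) v
      = (∑ μ, (Complex.I / 2 * shellDeriv m w p (Pi.single μ 1)) • act (gam μ) (act (gam 0) v))
        + (-(m : ℂ) / 2 * (((energy m p)⁻¹ : ℂ) *
          Complex.exp (Complex.I * cmink (negShell m p) w))) • act (gam 0) v := fun p => by
    have hE : ((energy m p : ℝ) : ℂ) ≠ 0 := by exact_mod_cast (energy_pos hm p).ne'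
    have h1 := congrArg (fun M => act M v) (slash_add_mul_gam_zero hm p)
    simp only [act_mul, act_smul, act_add, act_one, slash, act_sum] at h1
    have h2 : act (negProj m p) v = (-(2 * (energy m p : ℂ)))⁻¹ •
        ((∑ μ, ((metric μ * negShell m p μ : ℝ) : ℂ) • act (gam μ) (act (gam 0) v))
          + (m : ℂ) • act (gam 0) v) := by
      rw [h1, smul_smul]
      rw [show (-(2 * (energy m p : ℂ)))⁻¹ * (-2 * (energy m p : ℂ)) = 1 by field_simp, one_smul]
    rw [h2]
    simp only [shellDeriv, smul_apply, cmink_single, smul_eq_mul, smul_add, Finset.smul_sum,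
      smul_smul]
    congr 1
    · refine Finset.sum_congr rfl fun μ _ => ?_
      congr 1
      field_simp
      linear_combination (-(((metric μ * negShell m p μ : ℝ) : ℂ))) * Complex.I_sq
    · congr 1
      field_simp
  simp only [e1]
  rw [integral_add (integrable_finsetSum _ fun μ _ =>
      (((hiμ μ).const_mul (Complex.I / 2)).smul_const _))
      ((hi0.const_mul (-(m : ℂ) / 2)).smul_const _),
    integral_finsetSum _ fun μ _ => (((hiμ μ).const_mul (Complex.I / 2)).smul_const _)]
  simp only [integral_smul_const, integral_const_mul]
  rw [← shellIntegral, pminus, hD.fderiv, Dfun_eq_shellIntegral hm hw]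
  simp only [smul_apply, act_smul, act_add, act_sum, act_one,
    ContinuousLinearMap.integral_apply hi, smul_eq_mul, smul_add, Finset.smul_sum, smul_smul]
  push_cast
  congr 1
  · refine Finset.sum_congr rfl fun μ _ => ?_
    congr 1
    field_simp
  · congr 1
    field_simp


/-! ### The regularized matrix elements without gauge factor -/

lemma mink_sub_right (p x y : Spacetime) : mink p (x - y) = mink p x - mink p y := by
  simp only [← minkL_apply, map_sub]

lemma cmink_shift (p z : Spacetime) (ε : ℝ) (u : Spacetime) :
    cmink p (shift z ε u) = (mink p z : ℝ) + Complex.I * ((ε * mink p u : ℝ) : ℂ) := by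
  simp only [cmink_apply, shift, mink, Finset.mul_sum]
  push_cast
  rw [Finset.mul_sum, ← Finset.sum_add_distrib]
  refine Finset.sum_congr rfl fun μ _ => ?_
  ring

lemma imVec_shift (z : Spacetime) (ε : ℝ) (u : Spacetime) : imVec (shift z ε u) = ε • u := by
  ext μ
  simp [imVec, shift]

lemma coneGap_smul {ε : ℝ} (hε : 0 ≤ ε) (u : Spacetime) : coneGap (ε • u) = ε * coneGap u := by
  have e : spat (ε • u) = ε • spat u := rfl
  rw [coneGap, coneGap, e, norm_smul, Real.norm_of_nonneg hε, Pi.smul_apply, smul_eq_mul]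
  ring

lemma shift_mem_tube (z : Spacetime) {ε : ℝ} (hε : 0 < ε) {u : Spacetime} (hu : u ∈ Past) :
    shift z ε u ∈ tube := by
  change imVec _ ∈ Past
  rw [imVec_shift, ← coneGap_pos_iff, coneGap_smul hε.le]
  exact mul_pos hε ((coneGap_pos_iff u).2 hu)

lemma mink_negShell_nonneg (m : ℝ) {u : Spacetime} (hu : u ∈ Past) (p : Space) :
    0 ≤ mink (negShell m p) u :=
  (mul_nonneg ((coneGap_pos_iff u).2 hu).le (norm_nonneg p)).trans
    (coneGap_mul_norm_le m ((coneGap_pos_iff u).2 hu) p)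

/-- The damping factor `e^{-ε p_μ u^μ}` of the regularization in momentum space. -/
def damping (m ε : ℝ) (u : Spacetime) (p : Space) : ℝ :=
  Real.exp (-(ε * mink (negShell m p) u))

lemma continuous_damping (m ε : ℝ) (u : Spacetime) : Continuous (damping m ε u) :=
  Real.continuous_exp.comp (continuous_const.mul (continuous_mink_left m u)).neg

lemma damping_pos (m ε : ℝ) (u : Spacetime) (p : Space) : 0 < damping m ε u p := Real.exp_pos _

lemma damping_le_one (m : ℝ) {ε : ℝ} (hε : 0 ≤ ε) {u : Spacetime} (hu : u ∈ Past) (p : Space) :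
    damping m ε u p ≤ 1 :=
  Real.exp_le_one_iff.2 (by have := mul_nonneg hε (mink_negShell_nonneg m hu p); linarith)

lemma integrable_damping (m : ℝ) {ε : ℝ} (hε : 0 < ε) {u : Spacetime} (hu : u ∈ Past) :
    Integrable (damping m ε u) := by
  have h := (coneGap_pos_iff u).2 hu
  refine (integrable_exp_neg_mul_norm (mul_pos hε h)).mono'
    (continuous_damping m ε u).aestronglyMeasurable (Eventually.of_forall fun p => ?_)
  rw [Real.norm_of_nonneg (damping_pos m ε u p).le]
  refine Real.exp_le_exp.2 ?_
  have := mul_le_mul_of_nonneg_left (coneGap_mul_norm_le m h p) hε.le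
  linarith

lemma exp_cmink_shift (m : ℝ) (p : Space) (x y : Spacetime) (ε : ℝ) (u : Spacetime) :
    Complex.exp (Complex.I * cmink (negShell m p) (shift (y - x) ε u))
      = (damping m ε u p : ℂ) * (Complex.exp (-Complex.I * (mink (negShell m p) x : ℝ)) *
        Complex.exp (Complex.I * (mink (negShell m p) y : ℝ))) := by
  rw [cmink_shift, mink_sub_right, damping, Complex.ofReal_exp, ← Complex.exp_add,
    ← Complex.exp_add]
  congr 1
  push_cast
  linear_combination ((ε : ℂ) * (mink (negShell m p) u : ℂ)) * Complex.I_sq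

namespace CauchySurface

variable (S : CauchySurface)

lemma norm_hat_le (m : ℝ) (φ : TestSpinor) (p : Space) :
    ‖S.hat m φ p‖ ≤ fourierConst * ∫ x, ‖S.weight x (φ.1 x)‖ := by
  rw [hat, norm_smul, Complex.norm_real, Real.norm_of_nonneg fourierConst_pos.le]
  refine mul_le_mul_of_nonneg_left ((norm_integral_le_integral_norm _).trans_eq ?_)
    fourierConst_pos.le
  refine integral_congr_ae (Eventually.of_forall fun x => ?_)
  simp only [norm_smul, norm_exp_I_mul, one_mul]

lemma Gam_eq (y : Space) : S.Gam y = gam 0 * (gam 0 * S.Gam y) := by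
  rw [← mul_assoc, gam_zero_sq, one_mul]

lemma act_mul_Gam (M : Matrix (Fin 4) (Fin 4) ℂ) (y : Space) (v : Spinor) :
    act (M * S.Gam y) v = act M (act (gam 0) (S.weight y v)) := by
  rw [S.Gam_eq y, act_mul, act_mul]
  rfl

/-- The regularized vacuum kernel applied to a test spinor field. -/
lemma integral_pminus_Gam {m : ℝ} (hm : 0 < m) {ε : ℝ} (hε : 0 < ε) {u : Spacetime} (hu : u ∈ Past)
    (ψ : TestSpinor) (x : Spacetime) :
    ∫ y : Space, act (pminus m (shift (S.param y - x) ε u) * S.Gam y) (ψ.1 y)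
      = (fourierConst : ℂ) • ∫ p : Space, ((damping m ε u p : ℂ) *
        Complex.exp (-Complex.I * (mink (negShell m p) x : ℝ))) •
          act (negProj m p) (S.hat m ψ p) := by
  let F : Space → Space → Spinor := fun y p =>
    Complex.exp (Complex.I * cmink (negShell m p) (shift (S.param y - x) ε u)) •
      act (negProj m p) (S.weight y (ψ.1 y))
  have hF : Integrable (Function.uncurry F) (volume.prod volume) := by
    refine ((S.integrable_weight_apply ψ).norm.mul_prod (integrable_damping m hε hu)).mono' ?_
      (Eventually.of_forall fun q => ?_)
    · have h1 : Continuous fun q : Space × Space => Complex.exp (Complex.I *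
          (mink (negShell m q.2) (S.param q.1) : ℝ)) :=
        S.continuous_exp_mink_param m _ continuous_snd continuous_fst
      have h2 : Continuous fun q : Space × Space => Complex.exp (-Complex.I *
          (mink (negShell m q.2) x : ℝ)) :=
        Complex.continuous_exp.comp (continuous_const.mul (Complex.continuous_ofReal.comp
          ((continuous_mink_left m x).comp continuous_snd)))
      have h3 : Continuous fun q : Space × Space => (damping m ε u q.2 : ℂ) :=
        Complex.continuous_ofReal.comp ((continuous_damping m ε u).comp continuous_snd)
      have h4 : Continuous fun q : Space × Space =>
          act (negProj m q.2) (S.weight q.1 (ψ.1 q.1)) :=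
        ((contDiff_act_negProj hm).continuous.comp continuous_snd).clm_apply
          ((S.continuous_weight_apply ψ).comp continuous_fst)
      have h5 := (h3.mul (h2.mul h1)).smul h4
      refine h5.aestronglyMeasurable.congr (Eventually.of_forall fun q => ?_)
      simp only [F, Function.uncurry, exp_cmink_shift]
      rfl
    · simp only [F, Function.uncurry, exp_cmink_shift]
      rw [norm_smul, norm_mul, norm_mul, norm_exp_I_mul, norm_exp_neg_I_mul, Complex.norm_real,
        Real.norm_of_nonneg (damping_pos m ε u q.2).le, mul_one, mul_one, mul_comm]
      exact mul_le_mul_of_nonneg_right (norm_act_negProj_le hm _ _) (damping_pos m ε u q.2).le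
  have e1 : ∀ y, act (pminus m (shift (S.param y - x) ε u) * S.Gam y) (ψ.1 y)
      = (((2 * Real.pi) ^ 3 : ℝ) : ℂ)⁻¹ • ∫ p, F y p := fun y => by
    rw [act_mul_Gam, act_pminus_gam_zero hm (shift_mem_tube _ hε hu)]
  simp only [e1]
  rw [integral_smul, integral_integral_swap hF]
  have e2 : ∀ p, ∫ y, F y p = ((fourierConst : ℂ)⁻¹) • (((damping m ε u p : ℂ) *
        Complex.exp (-Complex.I * (mink (negShell m p) x : ℝ))) •
          act (negProj m p) (S.hat m ψ p)) := fun p => by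
    have hf : (fourierConst : ℂ) ≠ 0 := by exact_mod_cast fourierConst_pos.ne'
    have hi : Integrable fun y : Space => Complex.exp (Complex.I *
        (mink (negShell m p) (S.param y) : ℝ)) • S.weight y (ψ.1 y) := by
      refine (S.integrable_weight_apply ψ).norm.mono' ((S.continuous_exp_mink_param m _
        continuous_const continuous_id).smul
        (S.continuous_weight_apply ψ)).aestronglyMeasurable (Eventually.of_forall fun y => ?_)
      rw [norm_smul, norm_exp_I_mul, one_mul]
    simp only [F, exp_cmink_shift]
    rw [hat, map_smul, ← ContinuousLinearMap.integral_comp_comm _ hi, smul_comm _ (fourierConst : ℂ),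
      smul_smul (fourierConst : ℂ)⁻¹, inv_mul_cancel₀ hf, one_smul, ← integral_smul]
    refine integral_congr_ae (Eventually.of_forall fun y => ?_)
    simp only [map_smul, smul_smul, mul_assoc]
  simp only [e2]
  rw [integral_smul, smul_smul]
  congr 1
  have h := fourierConst_sq
  have h2 : (fourierConst : ℂ) ^ 2 * (((2 * Real.pi) ^ 3 : ℝ) : ℂ) = 1 := by exact_mod_cast h
  have hf : (fourierConst : ℂ) ≠ 0 := by exact_mod_cast fourierConst_pos.ne'
  have h3 : (((2 * Real.pi) ^ 3 : ℝ) : ℂ) ≠ 0 := fun h0 => by rw [h0] at h2; simp at h2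
  generalize (((2 * Real.pi) ^ 3 : ℝ) : ℂ) = X at *
  field_simp
  linear_combination -h2

/-- The regularized vacuum matrix elements in momentum space. -/
lemma regElement_zero {m : ℝ} (hm : 0 < m) {ε : ℝ} (hε : 0 < ε) {u : Spacetime} (hu : u ∈ Past)
    (φ ψ : TestSpinor) :
    S.regElement m (fun _ _ => 0) ε u φ ψ =
      ∫ p, (damping m ε u p : ℂ) * ⟪S.hat m φ p, act (negProj m p) (S.hat m ψ p)⟫_ℂ := by
  have hf : (fourierConst : ℂ) ≠ 0 := by exact_mod_cast fourierConst_pos.ne'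
  set C : ℝ := fourierConst * ∫ x, ‖S.weight x (ψ.1 x)‖
  let V : Space → Space → Spinor := fun x p => ((damping m ε u p : ℂ) *
    Complex.exp (-Complex.I * (mink (negShell m p) (S.param x) : ℝ))) •
      act (negProj m p) (S.hat m ψ p)
  have hVc : Continuous (Function.uncurry V) := by
    have h2 : Continuous fun q : Space × Space => Complex.exp (-Complex.I *
        (mink (negShell m q.2) (S.param q.1) : ℝ)) :=
      S.continuous_exp_mink_param m _ continuous_snd continuous_fst
    have h3 : Continuous fun q : Space × Space => (damping m ε u q.2 : ℂ) :=
      Complex.continuous_ofReal.comp ((continuous_damping m ε u).comp continuous_snd)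
    have h4 : Continuous fun q : Space × Space => act (negProj m q.2) (S.hat m ψ q.2) :=
      (((contDiff_act_negProj hm).continuous.clm_apply (S.continuous_hat m ψ))).comp continuous_snd
    exact (h3.mul h2).smul h4
  have hVn : ∀ x p, ‖V x p‖ ≤ damping m ε u p * C := fun x p => by
    simp only [V]
    rw [norm_smul, norm_mul, norm_exp_neg_I_mul, Complex.norm_real,
        Real.norm_of_nonneg (damping_pos m ε u p).le, mul_one]
    exact mul_le_mul_of_nonneg_left ((norm_act_negProj_le hm _ _).trans (S.norm_hat_le m ψ p))
      (damping_pos m ε u p).le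
  have hVi : ∀ x, Integrable (V x) := fun x =>
    ((integrable_damping m hε hu).mul_const C).mono'
      (hVc.comp (continuous_const.prodMk continuous_id)).aestronglyMeasurable
      (Eventually.of_forall (hVn x))
  let F : Space → Space → ℂ := fun x p => ⟪S.weight x (φ.1 x), V x p⟫_ℂ
  have hF : Integrable (Function.uncurry F) (volume.prod volume) := by
    refine ((S.integrable_weight_apply φ).norm.mul_prod
      ((integrable_damping m hε hu).mul_const C)).mono' ?_ (Eventually.of_forall fun q => ?_)
    · exact (((S.continuous_weight_apply φ).comp continuous_fst).inner hVc).aestronglyMeasurable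
    · exact (norm_inner_le_norm _ _).trans
        (mul_le_mul_of_nonneg_left (hVn _ _) (norm_nonneg _))
  have e1 : ∀ x : Space, ⟪φ.1 x, act (gam 0 * S.Gam x) (∫ y : Space,
      Complex.exp (-Complex.I * ((0 : ℝ) : ℂ)) •
        act (pminus m (shift (S.param y - S.param x) ε u) * S.Gam y) (ψ.1 y))⟫_ℂ
      = (fourierConst : ℂ) * ∫ p, F x p := fun x => by
    simp only [Complex.ofReal_zero, mul_zero, Complex.exp_zero, one_smul]
    rw [S.integral_pminus_Gam hm hε hu ψ (S.param x)]
    change ⟪_, S.weight x _⟫_ℂ = _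
    rw [← S.inner_weight_symm, inner_smul_right]
    congr 1
    exact (integral_inner (hVi x) (S.weight x (φ.1 x))).symm
  rw [regElement]
  simp only [e1]
  rw [integral_const_mul, integral_integral_swap hF, ← integral_const_mul]
  refine integral_congr_ae (Eventually.of_forall fun p => ?_)
  simp only [F, V]
  have hi : Integrable fun y : Space => Complex.exp (Complex.I *
      (mink (negShell m p) (S.param y) : ℝ)) • S.weight y (φ.1 y) := by
    refine (S.integrable_weight_apply φ).norm.mono' ((S.continuous_exp_mink_param m _
      continuous_const continuous_id).smul
      (S.continuous_weight_apply φ)).aestronglyMeasurable (Eventually.of_forall fun y => ?_)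
    rw [norm_smul, norm_exp_I_mul, one_mul]
  have e3 : ⟪S.hat m φ p, act (negProj m p) (S.hat m ψ p)⟫_ℂ = (fourierConst : ℂ) *
      ∫ x, ⟪Complex.exp (Complex.I * (mink (negShell m p) (S.param x) : ℝ)) •
        S.weight x (φ.1 x), act (negProj m p) (S.hat m ψ p)⟫_ℂ := by
    have eh : S.hat m φ p = (fourierConst : ℂ) • ∫ x : Space, Complex.exp (Complex.I *
      (mink (negShell m p) (S.param x) : ℝ)) • S.weight x (φ.1 x) := rfl
    conv_lhs => rw [← inner_conj_symm]
    conv_lhs => rw [eh, inner_smul_right, map_mul, Complex.conj_ofReal, ← integral_inner hi,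
      ← integral_conj]
    simp only [inner_conj_symm]
  rw [e3, mul_left_comm, ← integral_const_mul (damping m ε u p : ℂ)]
  congr 1
  refine integral_congr_ae (Eventually.of_forall fun x => ?_)
  simp only [inner_smul_left, inner_smul_right, ← Complex.exp_conj, map_mul, Complex.conj_I,
    Complex.conj_ofReal, mul_assoc]

/-- Without gauge factor the regularized matrix elements converge to those of `P_Σ^-`. -/
lemma isRegLimit_Pminus {m : ℝ} (hm : 0 < m) {u : Spacetime} (hu : u ∈ Past) :
    S.IsRegLimit m (fun _ _ => 0) u (S.Pminus m) := by
  intro φ ψ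
  obtain ⟨hi, he⟩ := S.inner_Pminus_ofTest hm φ ψ
  rw [he]
  have h : Tendsto (fun ε : ℝ => ∫ p, (damping m ε u p : ℂ) *
      ⟪S.hat m φ p, act (negProj m p) (S.hat m ψ p)⟫_ℂ) (𝓝[>] 0)
      (𝓝 (∫ p, ⟪S.hat m φ p, act (negProj m p) (S.hat m ψ p)⟫_ℂ)) := by
    refine tendsto_integral_filter_of_dominated_convergence
      (fun p => ‖⟪S.hat m φ p, act (negProj m p) (S.hat m ψ p)⟫_ℂ‖) ?_ ?_ hi.norm ?_
    · exact Eventually.of_forall fun ε => ((Complex.continuous_ofReal.comp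
        (continuous_damping m ε u)).aestronglyMeasurable).mul hi.aestronglyMeasurable
    · filter_upwards [self_mem_nhdsWithin] with ε hε
      refine Eventually.of_forall fun p => ?_
      rw [norm_mul, Complex.norm_real, Real.norm_of_nonneg (damping_pos m ε u p).le]
      exact mul_le_of_le_one_left (norm_nonneg _) (damping_le_one m (le_of_lt hε) hu p)
    · refine Eventually.of_forall fun p => ?_
      have h1 : Continuous fun ε : ℝ => (damping m ε u p : ℂ) *
          ⟪S.hat m φ p, act (negProj m p) (S.hat m ψ p)⟫_ℂ := by
        unfold damping
        fun_prop
      have h2 := h1.tendsto 0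
      simp only [damping, zero_mul, neg_zero, Real.exp_zero, Complex.ofReal_one, one_mul] at h2
      exact h2.mono_left nhdsWithin_le_nhds
  refine h.congr' ?_
  filter_upwards [self_mem_nhdsWithin] with ε hε
  exact (S.regElement_zero hm hε hu φ ψ).symm

end CauchySurface


/-! ### Kernel estimates on a Cauchy surface -/

lemma neg_cminkSq_shift (z : Spacetime) (ε : ℝ) (u : Spacetime) :
    -cminkSq (shift z ε u) = ((-mink z z + ε ^ 2 * mink u u : ℝ) : ℂ)
      - Complex.I * ((2 * ε * mink z u : ℝ) : ℂ) := by
  simp only [cminkSq, shift, mink, Fin.sum_univ_four]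
  push_cast
  linear_combination (-((ε : ℂ) ^ 2 * ((metric 0 : ℂ) * u 0 * u 0 + (metric 1 : ℂ) * u 1 * u 1 +
    (metric 2 : ℂ) * u 2 * u 2 + (metric 3 : ℂ) * u 3 * u 3))) * Complex.I_sq

lemma le_rfun_re {w : CSpacetime} {a : ℝ} (ha : 0 < a) (h : a ^ 2 ≤ (-cminkSq w).re) :
    w ∈ kernelDomain ∧ a ≤ (rfun w).re := by
  have h1 : w ∈ kernelDomain := Complex.mem_slitPlane_iff.2 (Or.inl (by nlinarith))
  refine ⟨h1, ?_⟩
  have h2 := rfun_re_pos h1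
  rw [← rfun_sq, pow_two (rfun w), Complex.mul_re] at h
  nlinarith [sq_nonneg (rfun w).im]

lemma abs_apply_le_norm_spat {z : Spacetime} (h : |z 0| ≤ ‖spat z‖) (μ : Fin 4) :
    |z μ| ≤ ‖spat z‖ :=
  Fin.cases h (fun k => PiLp.norm_apply_le (spat z) k) μ

/-- A bound for the regularized kernel between points whose separation has slope at most `V < 1`,
uniform in the regularization. -/
lemma exists_norm_pminus_shift_le {m : ℝ} (hm : 0 < m) {V : ℝ} (hV0 : 0 ≤ V) (hV1 : V < 1)
    {u : Spacetime} (hu : u ∈ Past) : ∃ C c : ℝ, 0 ≤ C ∧ 0 < c ∧ ∀ (z : Spacetime) (ε : ℝ),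
      0 ≤ ε → |z 0| ≤ V * ‖spat z‖ → 0 < ‖spat z‖ → shift z ε u ∈ kernelDomain ∧
        ‖act (pminus m (shift z ε u))‖ ≤ C * (‖spat z‖ ^ 3)⁻¹ * Real.exp (-c * ‖spat z‖) := by
  obtain ⟨C, hC0, hC⟩ := norm_act_pminus_le hm
  have hq : 0 < 1 - V ^ 2 := by nlinarith
  set κ := √(1 - V ^ 2) with hκ
  have hκ0 : 0 < κ := Real.sqrt_pos.2 hq
  have hκ2 : κ ^ 2 = 1 - V ^ 2 := Real.sq_sqrt hq.le
  have hu0 := hu.1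
  set ν := √(mink u u) with hν
  have hν0 : 0 < ν := Real.sqrt_pos.2 hu0
  have hν2 : ν ^ 2 = mink u u := Real.sq_sqrt hu0.le
  -- Here `Re r(w) ≥ a` with `a² = κ² |z|² + ε² ν²`, while the components of `w` are at most `b a`;
  -- this makes the bound uniform in `ε`.
  set b := κ⁻¹ + ν⁻¹ * ∑ μ, |u μ|
  have hb : 0 ≤ b := by
    have : 0 ≤ ∑ μ, |u μ| := Finset.sum_nonneg fun _ _ => abs_nonneg _
    positivity
  refine ⟨C * (b + 1) * (κ ^ 3)⁻¹, m * κ / 2, by positivity, by positivity, fun z ε hε hz hz0 => ?_⟩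
  set ρ := ‖spat z‖
  set a := √(κ ^ 2 * ρ ^ 2 + ε ^ 2 * ν ^ 2) with ha
  have hpos : 0 < κ ^ 2 * ρ ^ 2 + ε ^ 2 * ν ^ 2 := by positivity
  have ha0 : 0 < a := Real.sqrt_pos.2 hpos
  have ha2 : a ^ 2 = κ ^ 2 * ρ ^ 2 + ε ^ 2 * ν ^ 2 := Real.sq_sqrt hpos.le
  have h1 : κ * ρ ≤ a := Real.le_sqrt_of_sq_le (by nlinarith [sq_nonneg (ε * ν)])
  have h2 : ε * ν ≤ a := Real.le_sqrt_of_sq_le (by nlinarith [sq_nonneg (κ * ρ)])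
  have hz2 : (z 0) ^ 2 ≤ V ^ 2 * ρ ^ 2 := by
    rw [← mul_pow, ← sq_abs]
    gcongr
  obtain ⟨hw, hr⟩ := le_rfun_re (w := shift z ε u) ha0 (by
    have e : (Complex.I * ((2 * ε * mink z u : ℝ) : ℂ)).re = 0 := by simp
    rw [neg_cminkSq_shift, ha2, hκ2, hν2, Complex.sub_re, Complex.ofReal_re, e, mink_self z]
    linarith)
  refine ⟨hw, (hC _ a b hw ha0 hb hr fun μ => ?_).trans ?_⟩
  · have hzμ : |z μ| ≤ ρ := abs_apply_le_norm_spat (hz.trans (by nlinarith)) μ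
    have huμ : |u μ| ≤ ∑ μ, |u μ| :=
      Finset.single_le_sum (f := fun μ => |u μ|) (fun _ _ => abs_nonneg _) (Finset.mem_univ μ)
    calc ‖shift z ε u μ‖ ≤ |z μ| + ε * |u μ| := by
          refine (norm_add_le _ _).trans (add_le_add (by simp) ?_)
          rw [norm_mul, Complex.norm_I, one_mul, Complex.norm_real, Real.norm_eq_abs, abs_mul,
            abs_of_nonneg hε]
      _ ≤ κ⁻¹ * a + ν⁻¹ * a * ∑ μ, |u μ| := by
          refine add_le_add ?_ (mul_le_mul ?_ huμ (abs_nonneg _) (by positivity))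
          · rw [inv_mul_eq_div, le_div_iff₀ hκ0]
            nlinarith
          · rw [inv_mul_eq_div, le_div_iff₀ hν0]
            exact h2
      _ = b * a := by simp only [b]; ring
  · rw [mul_assoc _ (κ ^ 3)⁻¹, ← mul_inv, ← mul_pow]
    gcongr
    nlinarith

namespace CauchySurface

variable (S : CauchySurface)

lemma spat_param_sub (x y : Space) : spat (S.param y - S.param x) = y - x := by
  have h : ∀ x, spat (S.param x) = x := fun x => spat_point _ _
  calc spat (S.param y - S.param x) = spat (S.param y) - spat (S.param x) := rfl
    _ = _ := by rw [h, h]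

lemma param_sub_zero (x y : Space) : (S.param y - S.param x) 0 = S.t y - S.t x := rfl

/-- The regularized kernel `p^-(y - x + iεu) Γ(y)` between points of the surface. -/
def kernelMap (m ε : ℝ) (u : Spacetime) (x y : Space) : Spinor →L[ℂ] Spinor :=
  act (pminus m (shift (S.param y - S.param x) ε u) * S.Gam y)

lemma kernelMap_eq (m ε : ℝ) (u : Spacetime) (x y : Space) : S.kernelMap m ε u x y =
    (act (pminus m (shift (S.param y - S.param x) ε u))).comp
      ((act (gam 0)).comp (S.weight y)) := by
  ext1 v
  exact S.act_mul_Gam _ y v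

lemma continuous_shift {X : Type*} [TopologicalSpace X] {f : X → Spacetime} {g : X → ℝ}
    (hf : Continuous f) (hg : Continuous g) (u : Spacetime) :
    Continuous fun x => shift (f x) (g x) u := by
  unfold shift
  fun_prop

lemma continuousOn_kernelMap {m : ℝ} (hm : 0 < m) (u : Spacetime) {s : Set (ℝ × Space × Space)}
    (hs : ∀ q ∈ s, shift (S.param q.2.2 - S.param q.2.1) q.1 u ∈ kernelDomain) :
    ContinuousOn (fun q : ℝ × Space × Space => S.kernelMap m q.1 u q.2.1 q.2.2) s := by
  have h1 : Continuous fun q : ℝ × Space × Space =>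
      shift (S.param q.2.2 - S.param q.2.1) q.1 u :=
    continuous_shift ((S.continuous_param.comp (continuous_snd.comp continuous_snd)).sub
      (S.continuous_param.comp (continuous_fst.comp continuous_snd))) continuous_fst u
  have h2 : ContinuousOn (fun q : ℝ × Space × Space =>
      act (pminus m (shift (S.param q.2.2 - S.param q.2.1) q.1 u))) s :=
    continuous_act.comp_continuousOn ((continuousOn_pminus hm).comp h1.continuousOn hs)
  have h3 : Continuous fun q : ℝ × Space × Space => (act (gam 0)).comp (S.weight q.2.2) :=
    continuous_const.clm_comp (S.continuous_weight.comp (continuous_snd.comp continuous_snd))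
  exact (h2.clm_comp h3.continuousOn).congr fun q _ => S.kernelMap_eq m q.1 u q.2.1 q.2.2

end CauchySurface

lemma exists_norm_kernelMap_le {m : ℝ} (hm : 0 < m) {V : ℝ} (hV0 : 0 ≤ V) (hV1 : V < 1)
    {u : Spacetime} (hu : u ∈ Past) : ∃ C c : ℝ, 0 ≤ C ∧ 0 < c ∧ ∀ S : CauchySurface,
      (∀ x, ‖∇ S.t x‖ ≤ V) → ∀ (ε : ℝ) (x y : Space), 0 ≤ ε → x ≠ y →
        shift (S.param y - S.param x) ε u ∈ kernelDomain ∧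
        ‖S.kernelMap m ε u x y‖ ≤ C * (‖y - x‖ ^ 3)⁻¹ * Real.exp (-c * ‖y - x‖) := by
  obtain ⟨C, c, hC0, hc, h⟩ := exists_norm_pminus_shift_le hm hV0 hV1 hu
  refine ⟨C * (‖act (gam 0)‖ * 2), c, by positivity, hc, fun S hS ε x y hε hxy => ?_⟩
  have h0 : 0 < ‖y - x‖ := norm_pos_iff.2 (sub_ne_zero.2 hxy.symm)
  have h1 := h (S.param y - S.param x) ε hε
    (by rw [S.spat_param_sub]; exact S.abs_t_sub_le hS x y) (by rwa [S.spat_param_sub])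
  rw [S.spat_param_sub] at h1
  refine ⟨h1.1, ?_⟩
  rw [S.kernelMap_eq]
  have h2 : ‖S.weight y‖ ≤ 2 :=
    ContinuousLinearMap.opNorm_le_bound _ zero_le_two (S.norm_weight_le y)
  calc _ ≤ ‖act (pminus m (shift (S.param y - S.param x) ε u))‖ *
        (‖act (gam 0)‖ * ‖S.weight y‖) :=
        (ContinuousLinearMap.opNorm_comp_le _ _).trans
          (mul_le_mul_of_nonneg_left (ContinuousLinearMap.opNorm_comp_le _ _) (norm_nonneg _))
    _ ≤ (C * (‖y - x‖ ^ 3)⁻¹ * Real.exp (-c * ‖y - x‖)) * (‖act (gam 0)‖ * 2) := by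
        gcongr
        exact h1.2
    _ = _ := by ring

/-- The indicator function of a ball around the origin of `ℝ³`. -/
def ballInd (R : ℝ) (x : Space) : ℝ := (Metric.closedBall (0 : Space) R).indicator (fun _ => 1) x

lemma ballInd_nonneg (R : ℝ) (x : Space) : 0 ≤ ballInd R x :=
  indicator_nonneg (fun _ _ => zero_le_one) x

lemma ballInd_le_one (R : ℝ) (x : Space) : ballInd R x ≤ 1 :=
  indicator_le_self' (fun _ _ => zero_le_one) x

lemma measurable_ballInd (R : ℝ) : Measurable (ballInd R) :=
  measurable_const.indicator Metric.isClosed_closedBall.measurableSet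

/-- The gauge factor `e^{-iλ} - 1` vanishes at the diagonal to first order, and wherever both
points are outside of a ball. -/
lemma exists_gauge_factor_le {A : Spacetime → Spacetime} {lam : Spacetime → Spacetime → ℝ}
    (hlam : IsLocalGauge A lam) : ∃ L R : ℝ, 0 ≤ L ∧ ∀ (S : CauchySurface) (V : ℝ), V ≤ 1 →
      (∀ x, ‖∇ S.t x‖ ≤ V) → ∀ x y : Space,
        ‖Complex.exp (-Complex.I * (lam (S.param x) (S.param y) : ℝ)) - 1‖
          ≤ L * ‖y - x‖ * (ballInd R x + ballInd R y) := by
  obtain ⟨K, hK, hsupp⟩ := hlam.support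
  obtain ⟨ρ, hρ⟩ := hK.isBounded.subset_closedBall 0
  set s : Set (Spacetime × Spacetime) :=
    Metric.closedBall 0 (ρ + 1) ×ˢ Metric.closedBall 0 (ρ + 1)
  have hs : IsCompact s := (isCompact_closedBall _ _).prod (isCompact_closedBall _ _)
  have hsc : Convex ℝ s := (convex_closedBall _ _).prod (convex_closedBall _ _)
  obtain ⟨L, hL⟩ := hlam.smooth.contDiffOn.exists_lipschitzOnWith (by simp) hsc hs
  refine ⟨max L 2, 2 * ρ, by positivity, fun S V hV hS x y => ?_⟩
  have hexp : ∀ r : ℝ, ‖Complex.exp (-Complex.I * (r : ℂ)) - 1‖ ≤ |r| := fun r => by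
    have := Real.norm_exp_I_mul_ofReal_sub_one_le (x := -r)
    rwa [norm_neg, Complex.ofReal_neg, mul_neg, ← neg_mul] at this
  have hb : ∀ x, 0 ≤ ballInd (2 * ρ) x := ballInd_nonneg _
  have hpar : ∀ x : Space, S.param x ∈ K → ballInd (2 * ρ) x = 1 := fun x hx => by
    have h1 := hρ hx
    rw [mem_closedBall_zero_iff] at h1
    have h2 : ∀ k : Fin 3, |x k| ≤ ρ := fun k => by
      have h3 := (norm_le_pi_norm (S.param x) k.succ).trans h1
      have h4 : S.param x k.succ = x k := by fin_cases k <;> rfl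
      rwa [h4] at h3
    have hρ0 : 0 ≤ ρ := (abs_nonneg _).trans (h2 0)
    refine indicator_of_mem (mem_closedBall_zero_iff.2 ?_) _
    rw [EuclideanSpace.norm_eq]
    refine Real.sqrt_le_iff.2 ⟨by positivity, ?_⟩
    rw [Fin.sum_univ_three]
    have h5 : ∀ k : Fin 3, ‖x k‖ ^ 2 ≤ ρ ^ 2 := fun k => by
      rw [Real.norm_eq_abs]
      exact pow_le_pow_left₀ (abs_nonneg _) (h2 k) 2
    nlinarith [h5 0, h5 1, h5 2]
  by_cases hK' : S.param x ∈ K ∨ S.param y ∈ K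
  · have h1 : 1 ≤ ballInd (2 * ρ) x + ballInd (2 * ρ) y := by
      rcases hK' with h | h
      · rw [hpar x h]; linarith [hb y]
      · rw [hpar y h]; linarith [hb x]
    suffices h2 : ‖Complex.exp (-Complex.I * (lam (S.param x) (S.param y) : ℝ)) - 1‖
        ≤ max L 2 * ‖y - x‖ by
      refine h2.trans (le_mul_of_one_le_right (by positivity) h1)
    have hd : ‖S.param y - S.param x‖ ≤ ‖y - x‖ := by
      have e := S.spat_param_sub x y
      refine (pi_norm_le_iff_of_nonneg (norm_nonneg _)).2 fun μ => ?_
      rw [← e]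
      refine abs_apply_le_norm_spat ?_ μ
      rw [e, S.param_sub_zero]
      exact (S.abs_t_sub_le hS x y).trans (mul_le_of_le_one_left (norm_nonneg _) hV)
    -- For points at distance at most `1`, both are in the ball where `λ` is Lipschitz and
    -- `λ(x, x) = 0`; for the others the trivial bound `2` suffices.
    rcases le_or_gt ‖y - x‖ 1 with hle | hgt
    · have hd1 := hd.trans hle
      have hmem : S.param x ∈ Metric.closedBall (0 : Spacetime) (ρ + 1) ∧
          S.param y ∈ Metric.closedBall (0 : Spacetime) (ρ + 1) := by
        simp only [mem_closedBall_zero_iff]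
        rcases hK' with h | h
        · have h3 := mem_closedBall_zero_iff.1 (hρ h)
          have h4 := norm_le_norm_add_norm_sub (S.param x) (S.param y)
          rw [norm_sub_rev] at h4
          exact ⟨by linarith, by linarith⟩
        · have h3 := mem_closedBall_zero_iff.1 (hρ h)
          have h4 := norm_le_norm_add_norm_sub (S.param y) (S.param x)
          exact ⟨by linarith, by linarith⟩
      have h5 := hL.dist_le_mul (S.param x, S.param y) ⟨hmem.1, hmem.2⟩
        (S.param x, S.param x) ⟨hmem.1, hmem.1⟩
      simp only [Function.uncurry, hlam.diag, dist_zero_right, Prod.dist_eq, dist_self] at h5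
      rw [max_eq_right dist_nonneg, dist_eq_norm, Real.norm_eq_abs] at h5
      calc _ ≤ |lam (S.param x) (S.param y)| := hexp _
        _ ≤ L * ‖S.param y - S.param x‖ := h5
        _ ≤ max L 2 * ‖y - x‖ := by gcongr; exact le_max_left _ _
    · calc _ ≤ ‖Complex.exp (-Complex.I * (lam (S.param x) (S.param y) : ℝ))‖ + ‖(1 : ℂ)‖ :=
            norm_sub_le _ _
        _ = 2 := by rw [norm_exp_neg_I_mul, norm_one]; norm_num
        _ ≤ max L 2 * ‖y - x‖ := by
            have : (2 : ℝ) ≤ max L 2 := le_max_right _ _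
            nlinarith
  · have h0 : lam (S.param x) (S.param y) = 0 := by
      by_contra hne
      have h1 : (S.param x, S.param y) ∈ tsupport (Function.uncurry lam) :=
        subset_tsupport _ hne
      rcases hsupp h1 with h2 | h2
      · exact hK' (Or.inl h2.1)
      · exact hK' (Or.inr h2.2)
    rw [h0]
    simp only [Complex.ofReal_zero, mul_zero, Complex.exp_zero, sub_self, norm_zero]
    have := hb x; have := hb y
    positivity

/-- The majorant `C |y - x|^{-2} e^{-c|y - x|} (1_B(x) + 1_B(y))` of the kernel
`(e^{-iλ(x,y)} - 1) p^-(y - x) Γ(y)`: the gauge factor removes one power of the singularity. -/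
def majorant (C c R : ℝ) (x y : Space) : ℝ :=
  C * (‖y - x‖ ^ (-2 : ℝ) * Real.exp (-c * ‖y - x‖)) * (ballInd R x + ballInd R y)

lemma majorant_nonneg {C : ℝ} (hC : 0 ≤ C) (c R : ℝ) (x y : Space) : 0 ≤ majorant C c R x y := by
  have := ballInd_nonneg R x
  have := ballInd_nonneg R y
  unfold majorant
  positivity

lemma measurable_majorant (C c R : ℝ) : Measurable (Function.uncurry (majorant C c R)) := by
  have h1 : Measurable fun q : Space × Space => ballInd R q.1 :=
    (measurable_ballInd R).comp measurable_fst
  have h2 : Measurable fun q : Space × Space => ballInd R q.2 :=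
    (measurable_ballInd R).comp measurable_snd
  have h3 : Measurable fun q : Space × Space => ‖q.2 - q.1‖ :=
    (measurable_snd.sub measurable_fst).norm
  exact (measurable_const.mul ((h3.pow_const _).mul
    (Real.measurable_exp.comp (measurable_const.mul h3)))).mul (h1.add h2)

lemma exists_majorant {m : ℝ} (hm : 0 < m) {V : ℝ} (hV0 : 0 ≤ V) (hV1 : V < 1)
    {u : Spacetime} (hu : u ∈ Past) {A : Spacetime → Spacetime} {lam : Spacetime → Spacetime → ℝ}
    (hlam : IsLocalGauge A lam) : ∃ C c R : ℝ, 0 ≤ C ∧ 0 < c ∧ ∀ S : CauchySurface,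
      (∀ x, ‖∇ S.t x‖ ≤ V) → ∀ (ε : ℝ) (x y : Space), 0 ≤ ε → x ≠ y →
        ‖(Complex.exp (-Complex.I * (lam (S.param x) (S.param y) : ℝ)) - 1) •
          S.kernelMap m ε u x y‖ ≤ majorant C c R x y := by
  obtain ⟨C, c, hC, hc, h1⟩ := exists_norm_kernelMap_le hm hV0 hV1 hu
  obtain ⟨L, R, hL, h2⟩ := exists_gauge_factor_le hlam
  refine ⟨L * C, c, R, by positivity, hc, fun S hS ε x y hε hxy => ?_⟩
  have h0 : 0 < ‖y - x‖ := norm_pos_iff.2 (sub_ne_zero.2 hxy.symm)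
  rw [norm_smul]
  have hb : 0 ≤ ballInd R x + ballInd R y := add_nonneg (ballInd_nonneg R x) (ballInd_nonneg R y)
  calc _ ≤ (L * ‖y - x‖ * (ballInd R x + ballInd R y)) *
        (C * (‖y - x‖ ^ 3)⁻¹ * Real.exp (-c * ‖y - x‖)) := by
        gcongr
        · exact h2 S V hV1.le hS x y
        · exact (h1 S hS ε x y hε hxy).2
    _ = _ := by
        rw [majorant, Real.rpow_neg h0.le, Real.rpow_two]
        field_simp

/-- The past-directed unit vector `(-1, 0, 0, 0)`. -/
def refPast : Spacetime := point (-1) 0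

lemma refPast_mem : refPast ∈ Past := by
  rw [← coneGap_pos_iff, coneGap, refPast, spat_point]
  simp [point]

lemma shift_zero (z u : Spacetime) : shift z 0 u = fun μ => (z μ : ℂ) := by
  ext μ
  simp [shift]

namespace CauchySurface

variable (S : CauchySurface)

open Classical in
/-- The kernel `(e^{-iλ(x,y)} - 1) p^-(y - x) Γ(y)`, set to zero on the diagonal, where `p^-` takes
a junk value. Off the diagonal the direction `refPast` is immaterial, as `ε = 0`. -/
def diffKernel (m : ℝ) (lam : Spacetime → Spacetime → ℝ) (x y : Space) : Spinor →L[ℂ] Spinor :=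
  if x = y then 0 else (Complex.exp (-Complex.I * (lam (S.param x) (S.param y) : ℝ)) - 1) •
    S.kernelMap m 0 refPast x y

lemma diffKernel_of_ne (m : ℝ) (lam : Spacetime → Spacetime → ℝ) (u : Spacetime) {x y : Space}
    (h : x ≠ y) : S.diffKernel m lam x y =
      (Complex.exp (-Complex.I * (lam (S.param x) (S.param y) : ℝ)) - 1) •
        S.kernelMap m 0 u x y := by
  rw [diffKernel, if_neg h, kernelMap, kernelMap, shift_zero, shift_zero]

lemma diffIntegrand_eq (m : ℝ) (lam : Spacetime → Spacetime → ℝ) (ψ : S.HilbertSpace) {x y : Space}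
    (h : x ≠ y) : S.diffIntegrand m lam ψ x y = S.diffKernel m lam x y (ψ.fn y) := by
  rw [S.diffKernel_of_ne m lam refPast h, kernelMap, shift_zero]
  rfl

lemma continuous_gauge_factor {A : Spacetime → Spacetime} {lam : Spacetime → Spacetime → ℝ}
    (hlam : IsLocalGauge A lam) : Continuous fun q : Space × Space =>
      Complex.exp (-Complex.I * (lam (S.param q.1) (S.param q.2) : ℝ)) :=
  Complex.continuous_exp.comp (continuous_const.mul (Complex.continuous_ofReal.comp
    (hlam.smooth.continuous.comp ((S.continuous_param.comp continuous_fst).prodMk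
      (S.continuous_param.comp continuous_snd)))))

lemma shift_mem_kernelDomain (x y : Space) {ε : ℝ} (hε : 0 ≤ ε) {u : Spacetime}
    (hu : u ∈ Past) (h : x ≠ y) : shift (S.param y - S.param x) ε u ∈ kernelDomain := by
  obtain ⟨V, hV, hS⟩ := S.spacelike
  have hV0 : 0 ≤ V := (norm_nonneg _).trans (hS 0)
  obtain ⟨_, _, _, _, h1⟩ := exists_norm_kernelMap_le one_pos hV0 hV hu
  exact (h1 S hS ε x y hε h).1

lemma measurable_diffKernel {m : ℝ} (hm : 0 < m) {A : Spacetime → Spacetime}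
    {lam : Spacetime → Spacetime → ℝ} (hlam : IsLocalGauge A lam) :
    StronglyMeasurable (Function.uncurry (S.diffKernel m lam)) := by
  classical
  have hcl : IsClosed {q : Space × Space | q.1 = q.2} := isClosed_eq continuous_fst continuous_snd
  have h1 : ContinuousOn (fun q : Space × Space => S.kernelMap m 0 refPast q.1 q.2)
      {q : Space × Space | q.1 = q.2}ᶜ := by
    refine ContinuousOn.comp (s := {q : Space × Space | q.1 = q.2}ᶜ)
      (g := fun q : ℝ × Space × Space => S.kernelMap m q.1 refPast q.2.1 q.2.2)
      (f := fun q : Space × Space => ((0 : ℝ), q)) (t := {q | q.1 = 0 ∧ q.2.1 ≠ q.2.2}) ?_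
      (continuous_const.prodMk continuous_id).continuousOn (fun q hq => ⟨rfl, hq⟩)
    refine S.continuousOn_kernelMap hm refPast fun q hq => ?_
    rw [hq.1]
    exact S.shift_mem_kernelDomain _ _ le_rfl refPast_mem hq.2
  have h2 : ContinuousOn (fun q : Space × Space =>
      (Complex.exp (-Complex.I * (lam (S.param q.1) (S.param q.2) : ℝ)) - 1) •
        S.kernelMap m 0 refPast q.1 q.2) {q : Space × Space | q.1 = q.2}ᶜ :=
    ((S.continuous_gauge_factor hlam).sub continuous_const).continuousOn.smul h1
  have h3 := ContinuousOn.measurable_piecewise (f := fun _ => (0 : Spinor →L[ℂ] Spinor))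
    continuousOn_const h2 hcl.measurableSet
  have : ProperSpace (Spinor →L[ℂ] Spinor) := FiniteDimensional.proper ℂ _
  refine Measurable.stronglyMeasurable ?_
  convert h3 using 2 with q
  rfl

end CauchySurface


/-! ### Integral operators with a kernel fulfilling the Schur test -/

open scoped ENNReal

lemma lintegral_mul_sq_le {α : Type*} [MeasurableSpace α] {μ : Measure α} {f g : α → ℝ≥0∞}
    (hf : AEMeasurable f μ) (hg : AEMeasurable g μ) :
    (∫⁻ a, f a * g a ∂μ) ^ 2 ≤ (∫⁻ a, f a ^ 2 ∂μ) * ∫⁻ a, g a ^ 2 ∂μ := by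
  have h := ENNReal.lintegral_mul_le_Lp_mul_Lq μ Real.HolderConjugate.two_two hf hg
  simp only [Pi.mul_apply, ENNReal.rpow_two] at h
  have e : ∀ c : ℝ≥0∞, (c ^ (1 / 2 : ℝ)) ^ 2 = c := fun c => by
    rw [← ENNReal.rpow_two, ← ENNReal.rpow_mul]
    norm_num
  calc _ ≤ ((∫⁻ a, f a ^ 2 ∂μ) ^ (1 / 2 : ℝ) * (∫⁻ a, g a ^ 2 ∂μ) ^ (1 / 2 : ℝ)) ^ 2 := by gcongr
    _ = _ := by rw [mul_pow, e, e]

lemma memLp_two_iff_lintegral {f : Space → Spinor} (hf : AEStronglyMeasurable f volume) :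
    MemLp f 2 volume ↔ ∫⁻ x, ‖f x‖ₑ ^ 2 < ⊤ := by
  rw [MemLp, eLpNorm_lt_top_iff_lintegral_rpow_enorm_lt_top two_ne_zero ENNReal.ofNat_ne_top]
  simp [hf]

/-- The data of the Schur test: `K` is measurable with a majorant `k` whose integrals over either
variable are at most `M < ⊤`. -/
structure SchurKernel (K : Space → Space → Spinor →L[ℂ] Spinor) (k : Space → Space → ℝ≥0∞)
    (M : ℝ≥0∞) : Prop where
  meas : StronglyMeasurable (Function.uncurry K)
  kmeas : Measurable (Function.uncurry k)
  bound : ∀ x y, ‖K x y‖ₑ ≤ k x y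
  right : ∀ x, ∫⁻ y, k x y ≤ M
  left : ∀ y, ∫⁻ x, k x y ≤ M
  lt_top : M < ⊤

/-- The integral operator with kernel `K`, on functions. -/
def intOp (K : Space → Space → Spinor →L[ℂ] Spinor) (f : Space → Spinor) (x : Space) : Spinor :=
  ∫ y, K x y (f y)

namespace SchurKernel

variable {K : Space → Space → Spinor →L[ℂ] Spinor} {k : Space → Space → ℝ≥0∞} {M : ℝ≥0∞}

lemma kmeas_left (h : SchurKernel K k M) (x : Space) : Measurable (k x) :=
  h.kmeas.comp measurable_prodMk_left

lemma aemeasurable_kmul (h : SchurKernel K k M) {r : Space → ℝ≥0∞} (hr : AEMeasurable r volume) :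
    AEMeasurable (fun q : Space × Space => k q.1 q.2 * r q.2) (volume.prod volume) :=
  h.kmeas.aemeasurable.mul
    (hr.comp_quasiMeasurePreserving Measure.quasiMeasurePreserving_snd)

/-- The Schur test for the majorant. -/
lemma lintegral_sq_le (h : SchurKernel K k M) {r : Space → ℝ≥0∞} (hr : AEMeasurable r volume) :
    ∫⁻ x, (∫⁻ y, k x y * r y) ^ 2 ≤ M ^ 2 * ∫⁻ y, r y ^ 2 := by
  have e : ∀ c : ℝ≥0∞, c ^ (1 / 2 : ℝ) * c ^ (1 / 2 : ℝ) = c := fun c => by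
    rw [← ENNReal.rpow_add_of_nonneg _ _ (by norm_num) (by norm_num)]
    norm_num
  have h1 : ∀ x, (∫⁻ y, k x y * r y) ^ 2 ≤ M * ∫⁻ y, k x y * r y ^ 2 := fun x => by
    have hk : AEMeasurable (fun y => k x y ^ (1 / 2 : ℝ)) volume :=
      ((h.kmeas_left x).pow_const _).aemeasurable
    have h2 := lintegral_mul_sq_le hk (hk.mul hr)
    have e1 : ∀ y, k x y ^ (1 / 2 : ℝ) * (k x y ^ (1 / 2 : ℝ) * r y) = k x y * r y := fun y => by
      rw [← mul_assoc, e]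
    have e2 : ∀ y, (k x y ^ (1 / 2 : ℝ)) ^ 2 = k x y := fun y => by rw [pow_two, e]
    simp only [Pi.mul_apply, e1, mul_pow, e2] at h2
    exact h2.trans (mul_le_mul_left (h.right x) _)
  calc ∫⁻ x, (∫⁻ y, k x y * r y) ^ 2 ≤ ∫⁻ x, M * ∫⁻ y, k x y * r y ^ 2 := lintegral_mono h1
    _ = M * ∫⁻ x, ∫⁻ y, k x y * r y ^ 2 := lintegral_const_mul' _ _ h.lt_top.ne
    _ = M * ∫⁻ y, ∫⁻ x, k x y * r y ^ 2 := by
        rw [lintegral_lintegral_swap (h.aemeasurable_kmul (hr.pow_const 2))]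
    _ ≤ M * ∫⁻ y, M * r y ^ 2 := by
        gcongr with y
        have hm : Measurable fun x => k x y := h.kmeas.comp measurable_prodMk_right
        rw [lintegral_mul_const _ hm]
        exact mul_le_mul_left (h.left y) _
    _ = _ := by
        rw [lintegral_const_mul' _ _ h.lt_top.ne, ← mul_assoc, pow_two]

lemma enorm_apply_le (h : SchurKernel K k M) (x y : Space) (v : Spinor) :
    ‖K x y v‖ₑ ≤ k x y * ‖v‖ₑ :=
  ((K x y).le_opENorm v).trans (mul_le_mul_left (h.bound x y) _)

lemma aestronglyMeasurable_prod (h : SchurKernel K k M) {f : Space → Spinor}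
    (hf : AEStronglyMeasurable f volume) :
    AEStronglyMeasurable (fun q : Space × Space => K q.1 q.2 (f q.2)) (volume.prod volume) :=
  (isBoundedBilinearMap_apply (𝕜 := ℂ) (E := Spinor) (F := Spinor)).continuous
    |>.comp_aestronglyMeasurable (h.meas.aestronglyMeasurable.prodMk hf.comp_snd)

lemma aestronglyMeasurable_right (h : SchurKernel K k M) {f : Space → Spinor}
    (hf : AEStronglyMeasurable f volume) (x : Space) :
    AEStronglyMeasurable (fun y => K x y (f y)) volume :=
  (isBoundedBilinearMap_apply (𝕜 := ℂ) (E := Spinor) (F := Spinor)).continuous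
    |>.comp_aestronglyMeasurable (h.meas.of_uncurry_left.aestronglyMeasurable.prodMk hf)

lemma aestronglyMeasurable_intOp (h : SchurKernel K k M) {f : Space → Spinor}
    (hf : AEStronglyMeasurable f volume) : AEStronglyMeasurable (intOp K f) volume :=
  (h.aestronglyMeasurable_prod hf).integral_prod_right'

lemma enorm_intOp_le (h : SchurKernel K k M) (f : Space → Spinor) (x : Space) :
    ‖intOp K f x‖ₑ ≤ ∫⁻ y, k x y * ‖f y‖ₑ :=
  (enorm_integral_le_lintegral_enorm _).trans (lintegral_mono fun y => h.enorm_apply_le x y _)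

lemma lintegral_intOp_le (h : SchurKernel K k M) {f : Space → Spinor}
    (hf : AEStronglyMeasurable f volume) :
    ∫⁻ x, ‖intOp K f x‖ₑ ^ 2 ≤ M ^ 2 * ∫⁻ x, ‖f x‖ₑ ^ 2 :=
  (lintegral_mono fun x => pow_le_pow_left' (h.enorm_intOp_le f x) 2).trans
    (h.lintegral_sq_le hf.enorm)

lemma memLp_intOp (h : SchurKernel K k M) {f : Space → Spinor} (hf : MemLp f 2 volume) :
    MemLp (intOp K f) 2 volume := by
  rw [memLp_two_iff_lintegral (h.aestronglyMeasurable_intOp hf.1)]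
  exact (h.lintegral_intOp_le hf.1).trans_lt
    (ENNReal.mul_lt_top (ENNReal.pow_lt_top h.lt_top) ((memLp_two_iff_lintegral hf.1).1 hf))

lemma ae_integrable (h : SchurKernel K k M) {f : Space → Spinor} (hf : MemLp f 2 volume) :
    ∀ᵐ x : Space, Integrable fun y => K x y (f y) := by
  have h1 : ∫⁻ x, (∫⁻ y, k x y * ‖f y‖ₑ) ^ 2 ≠ ⊤ :=
    ((h.lintegral_sq_le hf.1.enorm).trans_lt (ENNReal.mul_lt_top (ENNReal.pow_lt_top h.lt_top)
      ((memLp_two_iff_lintegral hf.1).1 hf))).ne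
  have h2 : AEMeasurable (fun x => (∫⁻ y, k x y * ‖f y‖ₑ) ^ 2) volume :=
    ((h.aemeasurable_kmul hf.1.enorm).lintegral_prod_right').pow_const 2
  filter_upwards [ae_lt_top' h2 h1] with x hx
  refine ⟨h.aestronglyMeasurable_right hf.1 x, ?_⟩
  refine (lintegral_mono fun y => h.enorm_apply_le x y _).trans_lt ?_
  by_contra hne
  rw [not_lt, top_le_iff] at hne
  rw [hne] at hx
  simp at hx

/-- The majorant of the kernel defines a bounded bilinear form on `L²`. -/
lemma lintegral_bilin_lt_top (h : SchurKernel K k M) {q r : Space → ℝ≥0∞}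
    (hq : AEMeasurable q volume) (hr : AEMeasurable r volume) (hq2 : ∫⁻ x, q x ^ 2 < ⊤)
    (hr2 : ∫⁻ x, r x ^ 2 < ⊤) :
    ∫⁻ z : Space × Space, q z.1 * (k z.1 z.2 * r z.2) ∂(volume.prod volume) < ⊤ := by
  have hm : AEMeasurable (fun z : Space × Space => q z.1 * (k z.1 z.2 * r z.2))
      (volume.prod volume) :=
    (hq.comp_quasiMeasurePreserving Measure.quasiMeasurePreserving_fst).mul
      (h.aemeasurable_kmul hr)
  have hm2 : AEMeasurable (fun x => ∫⁻ y, k x y * r y) volume :=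
    (h.aemeasurable_kmul hr).lintegral_prod_right'
  rw [lintegral_prod _ hm]
  have h2 : ∫⁻ x, ∫⁻ y, q x * (k x y * r y) = ∫⁻ x, q x * ∫⁻ y, k x y * r y :=
    lintegral_congr fun x => lintegral_const_mul'' _ ((h.kmeas_left x).aemeasurable.mul hr)
  rw [h2]
  have h4 := ((lintegral_mul_sq_le hq hm2).trans
    (mul_le_mul_right (h.lintegral_sq_le hr) _)).trans_lt (ENNReal.mul_lt_top hq2
    (ENNReal.mul_lt_top (ENNReal.pow_lt_top h.lt_top) hr2))
  by_contra hne
  rw [not_lt, top_le_iff] at hne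
  rw [hne] at h4
  simp at h4

lemma integrable_inner (h : SchurKernel K k M) {f g : Space → Spinor} (hf : MemLp f 2 volume)
    (hg : MemLp g 2 volume) :
    Integrable (fun q : Space × Space => ⟪g q.1, K q.1 q.2 (f q.2)⟫_ℂ) (volume.prod volume) := by
  refine ⟨hg.1.comp_fst.inner (h.aestronglyMeasurable_prod hf.1), ?_⟩
  refine lt_of_le_of_lt (lintegral_mono fun q => ?_) (h.lintegral_bilin_lt_top hg.1.enorm
    hf.1.enorm ((memLp_two_iff_lintegral hg.1).1 hg) ((memLp_two_iff_lintegral hf.1).1 hf))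
  refine (?_ : _ ≤ ‖g q.1‖ₑ * ‖K q.1 q.2 (f q.2)‖ₑ).trans
    (mul_le_mul_right (h.enorm_apply_le _ _ _) _)
  rw [← ofReal_norm, ← ofReal_norm, ← ofReal_norm, ← ENNReal.ofReal_mul (norm_nonneg _)]
  exact ENNReal.ofReal_le_ofReal (norm_inner_le_norm _ _)

lemma integral_inner_intOp (h : SchurKernel K k M) {f g : Space → Spinor} (hf : MemLp f 2 volume)
    (hg : MemLp g 2 volume) :
    ∫ x, ⟪g x, intOp K f x⟫_ℂ
      = ∫ q : Space × Space, ⟪g q.1, K q.1 q.2 (f q.2)⟫_ℂ ∂(volume.prod volume) := by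
  rw [integral_prod _ (h.integrable_inner hf hg)]
  refine integral_congr_ae ?_
  filter_upwards [h.ae_integrable hf] with x hx
  exact (integral_inner hx (g x)).symm

lemma intOp_add (h : SchurKernel K k M) {f g : Space → Spinor} (hf : MemLp f 2 volume)
    (hg : MemLp g 2 volume) :
    intOp K (fun x => f x + g x) =ᵐ[volume] fun x => intOp K f x + intOp K g x := by
  filter_upwards [h.ae_integrable hf, h.ae_integrable hg] with x h1 h2
  simp only [intOp, map_add]
  exact integral_add h1 h2

end SchurKernel

lemma intOp_smul (K : Space → Space → Spinor →L[ℂ] Spinor) (c : ℂ) (f : Space → Spinor)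
    (x : Space) : intOp K (fun x => c • f x) x = c • intOp K f x := by
  simp only [intOp, map_smul]
  exact integral_smul _ _

lemma intOp_congr (K : Space → Space → Spinor →L[ℂ] Spinor) {f g : Space → Spinor}
    (h : f =ᵐ[volume] g) (x : Space) : intOp K f x = intOp K g x :=
  integral_congr_ae (h.mono fun y hy => by simp only [hy])

namespace CauchySurface

variable (S : CauchySurface)

lemma lintegral_fn_eq (ψ : S.HilbertSpace) :
    ∫⁻ x, ‖ψ.fn x‖ₑ ^ 2 = ENNReal.ofReal (∫ x, ‖ψ.fn x‖ ^ 2) := by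
  rw [ofReal_integral_eq_lintegral_ofReal (ψ.memLp.integrable_norm_pow (by norm_num))
    (Eventually.of_forall fun x => sq_nonneg _)]
  refine lintegral_congr fun x => ?_
  rw [← ofReal_norm, ENNReal.ofReal_pow (norm_nonneg _)]

lemma enorm_sq_eq (ψ : S.HilbertSpace) : ‖ψ‖ₑ ^ 2 = ENNReal.ofReal (‖ψ‖ ^ 2) := by
  rw [← ofReal_norm, ENNReal.ofReal_pow (norm_nonneg _)]

lemma _root_.DiracSea.two_mul_ofReal (a : ℝ) :
    2 * ENNReal.ofReal a = ENNReal.ofReal (2 * a) := by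
  rw [ENNReal.ofReal_mul zero_le_two, ENNReal.ofReal_ofNat]

lemma enorm_sq_le (ψ : S.HilbertSpace) : ‖ψ‖ₑ ^ 2 ≤ 2 * ∫⁻ x, ‖ψ.fn x‖ₑ ^ 2 := by
  rw [S.enorm_sq_eq, S.lintegral_fn_eq, two_mul_ofReal, S.integral_norm_sq]
  exact ENNReal.ofReal_le_ofReal (S.norm_sq_le ψ)

lemma lintegral_fn_le {V : ℝ} (hV : V < 1) (hS : ∀ x, ‖∇ S.t x‖ ≤ V) (ψ : S.HilbertSpace) :
    ∫⁻ x, ‖ψ.fn x‖ₑ ^ 2 ≤ ENNReal.ofReal (1 - V)⁻¹ * ‖ψ‖ₑ ^ 2 := by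
  have h0 : 0 < 1 - V := by linarith
  rw [S.enorm_sq_eq, S.lintegral_fn_eq, ← ENNReal.ofReal_mul (by positivity)]
  refine ENNReal.ofReal_le_ofReal ?_
  have h := S.re_innerL2_self_ge hS ψ
  have h4 : RCLike.re (S.innerL2 ψ ψ) = ‖ψ‖ ^ 2 := inner_self_eq_norm_sq (𝕜 := ℂ) ψ
  rw [h4] at h
  rw [inv_mul_eq_div, le_div_iff₀ h0, mul_comm]
  exact h

variable {K : Space → Space → Spinor →L[ℂ] Spinor} {k : Space → Space → ℝ≥0∞} {M : ℝ≥0∞}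

/-- The Schur test, in the norm of the surface. The factor `2 / (1 - V)` compares this norm with
the unweighted one. -/
lemma norm_toHilbert_intOp_le (h : SchurKernel K k M) {V : ℝ} (hV : V < 1)
    (hS : ∀ x, ‖∇ S.t x‖ ≤ V) (ψ : S.HilbertSpace) :
    ‖S.toHilbert (intOp K ψ.fn) (h.memLp_intOp ψ.memLp)‖
      ≤ √(2 * M.toReal ^ 2 * (1 - V)⁻¹) * ‖ψ‖ := by
  have h0 : 0 < 1 - V := by linarith
  have h1 := S.enorm_sq_le (S.toHilbert (intOp K ψ.fn) (h.memLp_intOp ψ.memLp))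
  have h2 : ∫⁻ x, ‖(S.toHilbert (intOp K ψ.fn) (h.memLp_intOp ψ.memLp)).fn x‖ₑ ^ 2
      = ∫⁻ x, ‖intOp K ψ.fn x‖ₑ ^ 2 := by
    refine lintegral_congr_ae ?_
    filter_upwards [S.toHilbert_fn _ (h.memLp_intOp ψ.memLp)] with x hx
    rw [hx]
  rw [h2] at h1
  have h3 := h1.trans (mul_le_mul_right ((h.lintegral_intOp_le ψ.memLp.1).trans
    (mul_le_mul_right (S.lintegral_fn_le hV hS ψ) _)) 2)
  have hM : M ^ 2 = ENNReal.ofReal (M.toReal ^ 2) := by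
    rw [ENNReal.ofReal_pow ENNReal.toReal_nonneg, ENNReal.ofReal_toReal h.lt_top.ne]
  rw [hM, S.enorm_sq_eq, S.enorm_sq_eq, ← ENNReal.ofReal_mul (by positivity),
    ← ENNReal.ofReal_mul (by positivity), two_mul_ofReal,
    ENNReal.ofReal_le_ofReal_iff (by positivity)] at h3
  refine abs_le_of_sq_le_sq' ?_ (by positivity) |>.2
  rw [mul_pow, Real.sq_sqrt (by positivity)]
  linarith

/-- The integral operator with kernel `K` on the Hilbert space of the surface. -/
def kernelOp (h : SchurKernel K k M) : S.HilbertSpace →L[ℂ] S.HilbertSpace :=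
  LinearMap.mkContinuousOfExistsBound
    { toFun := fun ψ => S.toHilbert (intOp K ψ.fn) (h.memLp_intOp ψ.memLp)
      map_add' := fun φ ψ => by
        refine hilbert_ext ((S.toHilbert_fn _ _).trans ?_)
        refine EventuallyEq.trans ?_ (HilbertSpace.fn_add _ _).symm
        filter_upwards [S.toHilbert_fn _ (h.memLp_intOp φ.memLp),
          S.toHilbert_fn _ (h.memLp_intOp ψ.memLp), h.intOp_add φ.memLp ψ.memLp] with x h1 h2 h3
        rw [h1, h2, ← h3]
        exact intOp_congr K (HilbertSpace.fn_add φ ψ) x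
      map_smul' := fun c ψ => by
        refine hilbert_ext ((S.toHilbert_fn _ _).trans ?_)
        refine EventuallyEq.trans ?_ (HilbertSpace.fn_smul _ _).symm
        filter_upwards [S.toHilbert_fn _ (h.memLp_intOp ψ.memLp)] with x h1
        rw [RingHom.id_apply, h1, ← intOp_smul]
        exact intOp_congr K (HilbertSpace.fn_smul c ψ) x } (by
    obtain ⟨V, hV, hS⟩ := S.spacelike
    exact ⟨_, S.norm_toHilbert_intOp_le h hV hS⟩)

lemma kernelOp_fn (h : SchurKernel K k M) (ψ : S.HilbertSpace) :
    (S.kernelOp h ψ).fn =ᵐ[volume] intOp K ψ.fn :=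
  S.toHilbert_fn _ (h.memLp_intOp ψ.memLp)

lemma norm_kernelOp_le (h : SchurKernel K k M) {V : ℝ} (hV : V < 1) (hS : ∀ x, ‖∇ S.t x‖ ≤ V) :
    ‖S.kernelOp h‖ ≤ √(2 * M.toReal ^ 2 * (1 - V)⁻¹) :=
  ContinuousLinearMap.opNorm_le_bound _ (Real.sqrt_nonneg _) (S.norm_toHilbert_intOp_le h hV hS)

lemma inner_kernelOp (h : SchurKernel K k M) (φ ψ : S.HilbertSpace) :
    ⟪φ, S.kernelOp h ψ⟫_ℂ = ∫ q : Space × Space,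
      ⟪S.weight q.1 (φ.fn q.1), K q.1 q.2 (ψ.fn q.2)⟫_ℂ ∂(volume.prod volume) := by
  rw [← h.integral_inner_intOp ψ.memLp (S.memLp_weight φ.memLp), inner_def]
  refine integral_congr_ae ?_
  filter_upwards [S.kernelOp_fn h ψ] with x hx
  rw [hx, S.inner_weight_symm]

/-- A kernel that is Hermitian for the weighted scalar product yields a self-adjoint operator. -/
lemma isSelfAdjoint_kernelOp (h : SchurKernel K k M)
    (hsymm : ∀ x y v w, ⟪S.weight x v, K x y w⟫_ℂ = ⟪K y x v, S.weight y w⟫_ℂ) :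
    IsSelfAdjoint (S.kernelOp h) := by
  rw [ContinuousLinearMap.isSelfAdjoint_iff_isSymmetric]
  intro φ ψ
  change ⟪S.kernelOp h φ, ψ⟫_ℂ = ⟪φ, S.kernelOp h ψ⟫_ℂ
  rw [← inner_conj_symm, inner_kernelOp, inner_kernelOp, ← integral_conj, ← integral_prod_swap]
  refine integral_congr_ae (Eventually.of_forall fun q => ?_)
  simp only [Prod.fst_swap, Prod.snd_swap, inner_conj_symm]
  exact (hsymm _ _ _ _).symm

end CauchySurface


/-! ### Compactness and the Hilbert–Schmidt property -/

open scoped ENNReal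

section Abstract

variable {H : Type} [NormedAddCommGroup H] [InnerProductSpace ℂ H]

/-- The orthogonal projection onto the span of finitely many members of an orthonormal family. -/
def finProj {ι : Type*} (b : ι → H) (s : Finset ι) : H →L[ℂ] H :=
  ∑ i ∈ s, (innerSL ℂ (b i)).smulRight (b i)

lemma finProj_apply {ι : Type*} (b : ι → H) (s : Finset ι) (x : H) :
    finProj b s x = ∑ i ∈ s, ⟪b i, x⟫_ℂ • b i := by
  simp [finProj]

lemma isCompactOperator_finProj {ι : Type*} (b : ι → H) (s : Finset ι) :
    IsCompactOperator (finProj b s) := by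
  classical
  induction s using Finset.induction_on with
  | empty =>
    have : (finProj b ∅ : H → H) = 0 := by ext x; simp [finProj]
    rw [this]
    exact isCompactOperator_zero
  | insert i s hi ih =>
    have h1 : IsCompactOperator ((innerSL ℂ (b i)).smulRight (b i)) := by
      have h2 : IsCompactOperator (ContinuousLinearMap.toSpanSingleton ℂ (b i)) :=
        isCompactOperator_of_locallyCompactSpace_rng _
      exact h2.comp_clm (innerSL ℂ (b i))
    have e : finProj b (insert i s) = (innerSL ℂ (b i)).smulRight (b i) + finProj b s := by
      rw [finProj, Finset.sum_insert hi, finProj]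
    rw [e]
    exact h1.add ih

/-- An operator `T` with `T^* T` Hilbert–Schmidt is compact: it is the norm limit of its
restrictions to the spans of finitely many basis vectors. -/
lemma isCompactOperator_of_isHilbertSchmidt [CompleteSpace H] (T : H →L[ℂ] H)
    (h : IsHilbertSchmidt (ContinuousLinearMap.adjoint T ∘L T)) : IsCompactOperator T := by
  classical
  obtain ⟨w, b, -⟩ := exists_hilbertBasis ℂ H
  have hsum := h w b
  set A := ContinuousLinearMap.adjoint T ∘L T with hA
  have key : ∀ (δ : ℝ), 0 ≤ δ → ∀ s : Finset w,
      (∀ t : Finset w, Disjoint t s → ∑ i ∈ t, ‖A (b i)‖ ^ 2 ≤ δ ^ 4) →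
        ‖T ∘L finProj b s - T‖ ≤ δ := by
    intro δ hδ s hs
    refine ContinuousLinearMap.opNorm_le_bound _ hδ fun x => ?_
    set x' := x - finProj b s x with hx'
    have hlim : Tendsto (fun G : Finset w => ∑ i ∈ G \ s, ⟪b i, x⟫_ℂ • b i) atTop (𝓝 x') := by
      have h1 := b.hasSum_repr x
      simp only [HilbertBasis.repr_apply_apply] at h1
      have h2 : Tendsto (fun G : Finset w => ∑ i ∈ G, ⟪b i, x⟫_ℂ • b i) atTop (𝓝 x) := h1
      refine (h2.sub_const (finProj b s x)).congr' ?_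
      filter_upwards [eventually_ge_atTop s] with G hG
      rw [finProj_apply, ← Finset.sum_sdiff hG, add_sub_cancel_right]
    have hbessel : ∀ G : Finset w, ∑ i ∈ G, ‖⟪b i, x⟫_ℂ‖ ^ 2 ≤ ‖x‖ ^ 2 := fun G =>
      b.orthonormal.sum_inner_products_le x
    -- The part `x'` of `x` beyond `s` has `‖T x'‖² = ⟪x', A x'⟫ ≤ ‖x'‖ ‖A x'‖`.
    have hn1 : ‖x'‖ ≤ ‖x‖ := by
      refine le_of_tendsto hlim.norm (Eventually.of_forall fun G => ?_)
      refine abs_le_of_sq_le_sq' ?_ (norm_nonneg _) |>.2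
      refine le_trans (le_of_eq ?_) (hbessel (G \ s))
      rw [← inner_self_eq_norm_sq (𝕜 := ℂ), b.orthonormal.inner_sum, map_sum]
      refine Finset.sum_congr rfl fun i _ => ?_
      rw [mul_comm, RCLike.mul_conj]
      norm_cast
    -- Cauchy–Schwarz for `A x' = ∑ ⟪b i, x⟫ A (b i)`, summed over `i ∉ s`.
    have hn2 : ‖A x'‖ ≤ ‖x‖ * δ ^ 2 := by
      have hlim2 : Tendsto (fun G : Finset w => A (∑ i ∈ G \ s, ⟪b i, x⟫_ℂ • b i)) atTop
          (𝓝 (A x')) := (A.continuous.tendsto x').comp hlim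
      refine le_of_tendsto hlim2.norm (Eventually.of_forall fun G => ?_)
      rw [map_sum]
      refine (norm_sum_le _ _).trans ?_
      simp only [map_smul, norm_smul]
      refine abs_le_of_sq_le_sq' ?_ (by positivity) |>.2
      refine (Finset.sum_mul_sq_le_sq_mul_sq _ _ _).trans ?_
      rw [mul_pow, ← pow_mul]
      exact mul_le_mul (hbessel _) (hs _ Finset.sdiff_disjoint)
        (Finset.sum_nonneg fun _ _ => sq_nonneg _) (sq_nonneg _)
    have e : (T ∘L finProj b s - T) x = -T x' := by
      rw [hx', map_sub, neg_sub]; rfl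
    rw [e, norm_neg]
    refine abs_le_of_sq_le_sq' ?_ (by positivity) |>.2
    have h3 : ‖T x'‖ ^ 2 ≤ ‖x'‖ * ‖A x'‖ := by
      rw [← inner_self_eq_norm_sq (𝕜 := ℂ), ← ContinuousLinearMap.adjoint_inner_right]
      exact (RCLike.re_le_norm _).trans (norm_inner_le_norm _ _)
    calc ‖T x'‖ ^ 2 ≤ ‖x'‖ * ‖A x'‖ := h3
      _ ≤ ‖x‖ * (‖x‖ * δ ^ 2) := by gcongr
      _ = (δ * ‖x‖) ^ 2 := by ring
  have hlim : Tendsto (fun s : Finset w => T ∘L finProj b s) atTop (𝓝 T) := by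
    rw [tendsto_iff_norm_sub_tendsto_zero, Metric.tendsto_atTop]
    intro ε hε
    obtain ⟨s, hs⟩ := summable_iff_vanishing_norm.1 hsum ((ε / 2) ^ 4) (by positivity)
    refine ⟨s, fun s' hs' => ?_⟩
    rw [Real.dist_eq, sub_zero, abs_norm]
    refine (key (ε / 2) (by positivity) s' fun t ht => ?_).trans_lt (by linarith)
    exact (le_abs_self _).trans (hs t (ht.mono_right hs')).le
  exact isCompactOperator_of_tendsto hlim
    (Eventually.of_forall fun s => (isCompactOperator_finProj b s).clm_comp T)

/-- Bessel's inequality for a spinor valued functional, from the one for its four components. -/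
lemma sum_norm_sq_apply_le [CompleteSpace H] (f : H →L[ℂ] Spinor) {ι : Type*} {v : ι → H}
    (hv : Orthonormal ℂ v) (s : Finset ι) : ∑ i ∈ s, ‖f (v i)‖ ^ 2 ≤ 4 * ‖f‖ ^ 2 := by
  have e : ∀ i, ‖f (v i)‖ ^ 2 = ∑ a : Fin 4, ‖⟪v i,
      ContinuousLinearMap.adjoint f (EuclideanSpace.single a 1)⟫_ℂ‖ ^ 2 := fun i => by
    rw [EuclideanSpace.norm_sq_eq]
    refine Finset.sum_congr rfl fun a _ => ?_
    rw [ContinuousLinearMap.adjoint_inner_right, EuclideanSpace.inner_single_right]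
    simp
  simp only [e]
  rw [Finset.sum_comm]
  calc _ ≤ ∑ _a : Fin 4, ‖f‖ ^ 2 := by
        refine Finset.sum_le_sum fun a _ => (hv.sum_inner_products_le _).trans ?_
        have h1 := (ContinuousLinearMap.adjoint f).le_opNorm (EuclideanSpace.single a (1 : ℂ))
        rw [LinearIsometryEquiv.norm_map, PiLp.norm_single, norm_one, mul_one] at h1
        gcongr
    _ = _ := by simp

end Abstract

/-- The majorant `∫ k(z,x) k(z,y) dz` of the kernel of `T^* T`. -/
def sqMajorant (k : Space → Space → ℝ≥0∞) (x y : Space) : ℝ≥0∞ := ∫⁻ z, k z x * k z y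

lemma measurable_sqMajorant {k : Space → Space → ℝ≥0∞} (hk : Measurable (Function.uncurry k)) :
    Measurable (Function.uncurry (sqMajorant k)) := by
  have h : Measurable fun q : (Space × Space) × Space => k q.2 q.1.1 * k q.2 q.1.2 :=
    (hk.comp (measurable_snd.prodMk (measurable_fst.comp measurable_fst))).mul
      (hk.comp (measurable_snd.prodMk (measurable_snd.comp measurable_fst)))
  exact h.lintegral_prod_right'

/-- Cauchy–Schwarz for `k k' = (k k')^{2/3} (k k')^{1/3}`. -/
lemma sqMajorant_sq_le {k : Space → Space → ℝ≥0∞} (hk : Measurable (Function.uncurry k))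
    {N : ℝ≥0∞} (hcol : ∀ x, ∫⁻ z, k z x ^ (4 / 3 : ℝ) ≤ N) (x y : Space) :
    sqMajorant k x y ^ 2 ≤ (∫⁻ z, k z x ^ (4 / 3 : ℝ) * k z y ^ (4 / 3 : ℝ)) * (2 * N) := by
  have hx : ∀ x, Measurable fun z => k z x := fun x => hk.comp measurable_prodMk_right
  have e : ∀ (r s : ℝ), 0 ≤ r → 0 ≤ s → ∀ c : ℝ≥0∞, c ^ r * c ^ s = c ^ (r + s) :=
    fun r s hr hs c => (ENNReal.rpow_add_of_nonneg _ _ hr hs).symm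
  have h := lintegral_mul_sq_le (μ := (volume : Measure Space))
    (f := fun z => k z x ^ (2 / 3 : ℝ) * k z y ^ (2 / 3 : ℝ))
    (g := fun z => k z x ^ (1 / 3 : ℝ) * k z y ^ (1 / 3 : ℝ))
    (((hx x).pow_const _).mul ((hx y).pow_const _)).aemeasurable
    (((hx x).pow_const _).mul ((hx y).pow_const _)).aemeasurable
  have e1 : ∀ z, k z x ^ (2 / 3 : ℝ) * k z y ^ (2 / 3 : ℝ) *
      (k z x ^ (1 / 3 : ℝ) * k z y ^ (1 / 3 : ℝ)) = k z x * k z y := fun z => by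
    rw [mul_mul_mul_comm, e _ _ (by norm_num) (by norm_num), e _ _ (by norm_num) (by norm_num)]
    norm_num
  have e2 : ∀ z, (k z x ^ (2 / 3 : ℝ) * k z y ^ (2 / 3 : ℝ)) ^ 2
      = k z x ^ (4 / 3 : ℝ) * k z y ^ (4 / 3 : ℝ) := fun z => by
    rw [pow_two, mul_mul_mul_comm, e _ _ (by norm_num) (by norm_num),
      e _ _ (by norm_num) (by norm_num)]
    norm_num
  simp only [e1, e2] at h
  refine h.trans (mul_le_mul_right ?_ _)
  have e3 : ∀ z, (k z x ^ (1 / 3 : ℝ) * k z y ^ (1 / 3 : ℝ)) ^ 2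
      ≤ k z x ^ (4 / 3 : ℝ) + k z y ^ (4 / 3 : ℝ) := fun z => by
    have e4 : ∀ c : ℝ≥0∞, c ^ (4 / 3 : ℝ) = c ^ (2 / 3 : ℝ) * c ^ (2 / 3 : ℝ) := fun c => by
      rw [e _ _ (by norm_num) (by norm_num)]
      norm_num
    rw [pow_two, mul_mul_mul_comm, e _ _ (by norm_num) (by norm_num),
      e _ _ (by norm_num) (by norm_num), e4, e4]
    norm_num
    rcases le_total (k z x ^ (2 / 3 : ℝ)) (k z y ^ (2 / 3 : ℝ)) with hle | hle
    · exact (mul_le_mul_left hle _).trans le_add_self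
    · exact (mul_le_mul_right hle _).trans le_self_add
  calc _ ≤ ∫⁻ z, (k z x ^ (4 / 3 : ℝ) + k z y ^ (4 / 3 : ℝ)) := lintegral_mono e3
    _ = (∫⁻ z, k z x ^ (4 / 3 : ℝ)) + ∫⁻ z, k z y ^ (4 / 3 : ℝ) :=
        lintegral_add_left ((hx x).pow_const _) _
    _ ≤ N + N := add_le_add (hcol x) (hcol y)
    _ = 2 * N := (two_mul N).symm

/-- The kernel of `T^* T` is square integrable if the kernel of `T` is in `L^{4/3}`, jointly and
uniformly in either variable. -/
lemma lintegral_sqMajorant_lt_top {k : Space → Space → ℝ≥0∞} (hk : Measurable (Function.uncurry k))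
    {N : ℝ≥0∞} (hN : N < ⊤) (hrow : ∀ z, ∫⁻ x, k z x ^ (4 / 3 : ℝ) ≤ N)
    (hcol : ∀ x, ∫⁻ z, k z x ^ (4 / 3 : ℝ) ≤ N)
    (htot : ∫⁻ z, ∫⁻ x, k z x ^ (4 / 3 : ℝ) < ⊤) :
    ∫⁻ x, ∫⁻ y, sqMajorant k x y ^ 2 < ⊤ := by
  have hN2 : (2 * N : ℝ≥0∞) < ⊤ := ENNReal.mul_lt_top ENNReal.ofNat_lt_top hN
  let p : Space → Space → ℝ≥0∞ := fun z x => k z x ^ (4 / 3 : ℝ)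
  have hp : Measurable (Function.uncurry p) := hk.pow_const _
  have hpr : Measurable fun z => ∫⁻ y, p z y := hp.lintegral_prod_right'
  have hpl : ∀ x, Measurable fun z => p z x := fun x => hp.comp measurable_prodMk_right
  have hpz : ∀ z, Measurable (p z) := fun z => hp.comp measurable_prodMk_left
  have h1 : ∀ x, ∫⁻ y, sqMajorant k x y ^ 2 ≤ (∫⁻ z, p z x * ∫⁻ y, p z y) * (2 * N) := fun x => by
    have hm : Measurable (Function.uncurry fun y z => p z x * p z y) :=
      ((hpl x).comp measurable_snd).mul (hp.comp measurable_swap)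
    calc _ ≤ ∫⁻ y, (∫⁻ z, p z x * p z y) * (2 * N) :=
          lintegral_mono fun y => sqMajorant_sq_le hk hcol x y
      _ = (∫⁻ y, ∫⁻ z, p z x * p z y) * (2 * N) := lintegral_mul_const' _ _ hN2.ne
      _ = _ := by
          rw [lintegral_lintegral_swap hm.aemeasurable]
          congr 1
          exact lintegral_congr fun z => lintegral_const_mul _ (hpz z)
  have hm2 : Measurable (Function.uncurry fun x z => p z x * ∫⁻ y, p z y) :=
    (hp.comp measurable_swap).mul (hpr.comp measurable_snd)
  calc ∫⁻ x, ∫⁻ y, sqMajorant k x y ^ 2 ≤ ∫⁻ x, (∫⁻ z, p z x * ∫⁻ y, p z y) * (2 * N) :=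
        lintegral_mono h1
    _ = (∫⁻ x, ∫⁻ z, p z x * ∫⁻ y, p z y) * (2 * N) := lintegral_mul_const' _ _ hN2.ne
    _ = (∫⁻ z, (∫⁻ x, p z x) * ∫⁻ y, p z y) * (2 * N) := by
        rw [lintegral_lintegral_swap hm2.aemeasurable]
        congr 1
        exact lintegral_congr fun z => lintegral_mul_const _ (hpz z)
    _ ≤ (∫⁻ z, N * ∫⁻ y, p z y) * (2 * N) := by
        gcongr with z
        exact hrow z
    _ = N * (∫⁻ z, ∫⁻ y, p z y) * (2 * N) := by rw [lintegral_const_mul' _ _ hN.ne]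
    _ < ⊤ := ENNReal.mul_lt_top (ENNReal.mul_lt_top hN htot) hN2

namespace CauchySurface

variable (S : CauchySurface) {K : Space → Space → Spinor →L[ℂ] Spinor}
  {k : Space → Space → ℝ≥0∞} {M : ℝ≥0∞}

/-- The kernel `K(z,x)^* γ⁰ Γ(z)` of the operator adjoint to the one with kernel `K`, from the
weighted scalar product to the unweighted one. -/
def adjKernel (K : Space → Space → Spinor →L[ℂ] Spinor) (x z : Space) : Spinor →L[ℂ] Spinor :=
  (ContinuousLinearMap.adjoint (K z x)).comp (S.weight z)

lemma schurKernel_adjKernel (h : SchurKernel K k M) :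
    SchurKernel (S.adjKernel K) (fun x z => 2 * k z x) (2 * M) where
  meas := by
    have h1 : StronglyMeasurable fun q : Space × Space => K q.2 q.1 :=
      h.meas.comp_measurable measurable_swap
    have h2 : StronglyMeasurable fun q : Space × Space => S.weight q.2 :=
      (S.continuous_weight.comp continuous_snd).stronglyMeasurable
    have h3 : StronglyMeasurable fun q : Space × Space =>
        ContinuousLinearMap.adjoint (K q.2 q.1) :=
      (ContinuousLinearMap.adjoint (𝕜 := ℂ) (E := Spinor) (F := Spinor)).continuous
        |>.comp_stronglyMeasurable h1
    exact (isBoundedBilinearMap_comp (𝕜 := ℂ) (E := Spinor) (F := Spinor)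
      (G := Spinor)).continuous.comp_stronglyMeasurable (h3.prodMk h2)
  kmeas := (h.kmeas.comp measurable_swap).const_mul 2
  bound x z := by
    have h1 : ‖S.adjKernel K x z‖ ≤ 2 * ‖K z x‖ := by
      refine (ContinuousLinearMap.opNorm_comp_le _ _).trans ?_
      rw [LinearIsometryEquiv.norm_map, mul_comm]
      exact mul_le_mul_of_nonneg_right (ContinuousLinearMap.opNorm_le_bound _ zero_le_two
        (S.norm_weight_le z)) (norm_nonneg _)
    rw [← ofReal_norm]
    refine (ENNReal.ofReal_le_ofReal h1).trans ?_
    rw [← two_mul_ofReal, ofReal_norm]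
    exact mul_le_mul_right (h.bound z x) _
  right x := by
    rw [lintegral_const_mul' _ _ ENNReal.ofNat_ne_top]
    exact mul_le_mul_right (h.left x) _
  left z := by
    rw [lintegral_const_mul' _ _ ENNReal.ofNat_ne_top]
    exact mul_le_mul_right (h.right z) _
  lt_top := ENNReal.mul_lt_top ENNReal.ofNat_lt_top h.lt_top

lemma inner_adjoint_kernelOp (h : SchurKernel K k M) (φ ψ : S.HilbertSpace) :
    ⟪φ, (ContinuousLinearMap.adjoint (S.kernelOp h) ∘L S.kernelOp h) ψ⟫_ℂ
      = ∫ x, ⟪φ.fn x, intOp (S.adjKernel K) (intOp K ψ.fn) x⟫_ℂ := by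
  have hG := h.memLp_intOp ψ.memLp
  have e1 : ⟪φ, (ContinuousLinearMap.adjoint (S.kernelOp h) ∘L S.kernelOp h) ψ⟫_ℂ
      = ⟪S.kernelOp h φ, S.kernelOp h ψ⟫_ℂ := by
    rw [ContinuousLinearMap.comp_apply, ContinuousLinearMap.adjoint_inner_right]
  have e2 : ⟪S.kernelOp h φ, S.kernelOp h ψ⟫_ℂ
      = (starRingEnd ℂ) (∫ x, ⟪S.weight x (intOp K ψ.fn x), intOp K φ.fn x⟫_ℂ) := by
    rw [inner_def, ← integral_conj]
    refine integral_congr_ae ?_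
    filter_upwards [S.kernelOp_fn h φ, S.kernelOp_fn h ψ] with x h1 h2
    rw [h1, h2, inner_conj_symm]
  have e3 := h.integral_inner_intOp φ.memLp (S.memLp_weight hG)
  have e4 := (S.schurKernel_adjKernel h).integral_inner_intOp hG φ.memLp
  rw [e1, e2, e3, e4, ← integral_conj, ← integral_prod_swap]
  refine integral_congr_ae (Eventually.of_forall fun q => ?_)
  simp only [Prod.fst_swap, Prod.snd_swap, inner_conj_symm, adjKernel,
    ContinuousLinearMap.comp_apply, ContinuousLinearMap.adjoint_inner_right]

/-- The adjoint refers to the weighted scalar product, so `intOp (S.adjKernel K)` is not the adjoint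
itself; its norm controls that of the adjoint by duality. -/
lemma enorm_adjoint_kernelOp_sq_le (h : SchurKernel K k M) {V : ℝ} (hV : V < 1)
    (hS : ∀ x, ‖∇ S.t x‖ ≤ V) (ψ : S.HilbertSpace) :
    ‖(ContinuousLinearMap.adjoint (S.kernelOp h) ∘L S.kernelOp h) ψ‖ₑ ^ 2
      ≤ ENNReal.ofReal (1 - V)⁻¹ * ∫⁻ x, ‖intOp (S.adjKernel K) (intOp K ψ.fn) x‖ₑ ^ 2 := by
  set φ := (ContinuousLinearMap.adjoint (S.kernelOp h) ∘L S.kernelOp h) ψ with hφ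
  set F := intOp (S.adjKernel K) (intOp K ψ.fn) with hF
  have hFm : AEStronglyMeasurable F volume :=
    ((S.schurKernel_adjKernel h).memLp_intOp (h.memLp_intOp ψ.memLp)).1
  have h1 : ‖φ‖ₑ ^ 2 ≤ ∫⁻ x, ‖φ.fn x‖ₑ * ‖F x‖ₑ := by
    have e : ⟪φ, φ⟫_ℂ = ∫ x, ⟪φ.fn x, F x⟫_ℂ := S.inner_adjoint_kernelOp h φ ψ
    have e2 : ‖φ‖ₑ ^ 2 = ‖⟪φ, φ⟫_ℂ‖ₑ := by
      rw [← ofReal_norm, ← ofReal_norm, ← ENNReal.ofReal_pow (norm_nonneg _),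
        inner_self_eq_norm_sq_to_K]
      simp
    rw [e2, e]
    refine (enorm_integral_le_lintegral_enorm _).trans (lintegral_mono fun x => ?_)
    rw [← ofReal_norm, ← ofReal_norm, ← ofReal_norm, ← ENNReal.ofReal_mul (norm_nonneg _)]
    exact ENNReal.ofReal_le_ofReal (norm_inner_le_norm _ _)
  -- One factor `‖φ‖²` cancels in the end.
  have h2 : ‖φ‖ₑ ^ 2 * ‖φ‖ₑ ^ 2
      ≤ ‖φ‖ₑ ^ 2 * (ENNReal.ofReal (1 - V)⁻¹ * ∫⁻ x, ‖F x‖ₑ ^ 2) := by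
    calc ‖φ‖ₑ ^ 2 * ‖φ‖ₑ ^ 2 ≤ (∫⁻ x, ‖φ.fn x‖ₑ * ‖F x‖ₑ) ^ 2 := by
          rw [← pow_two (‖φ‖ₑ ^ 2)]
          exact pow_le_pow_left' h1 2
      _ ≤ (∫⁻ x, ‖φ.fn x‖ₑ ^ 2) * ∫⁻ x, ‖F x‖ₑ ^ 2 :=
          lintegral_mul_sq_le φ.memLp.1.enorm hFm.enorm
      _ ≤ (ENNReal.ofReal (1 - V)⁻¹ * ‖φ‖ₑ ^ 2) * ∫⁻ x, ‖F x‖ₑ ^ 2 :=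
          mul_le_mul_left (S.lintegral_fn_le hV hS φ) _
      _ = _ := by ring
  rcases eq_or_ne (‖φ‖ₑ ^ 2) 0 with h0 | h0
  · rw [h0]; exact zero_le
  · exact (ENNReal.mul_le_mul_iff_right h0 (ENNReal.pow_ne_top enorm_ne_top)).1 h2

/-- Pointwise bound for `T^* T ψ`, by Cauchy–Schwarz in the variable `y` of its kernel. -/
lemma enorm_intOp_intOp_sq_le (h : SchurKernel K k M) (ψ : S.HilbertSpace) (x : Space) :
    (∫⁻ z, ‖S.adjKernel K x z (intOp K ψ.fn z)‖ₑ) ^ 2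
      ≤ 4 * (∫⁻ y, sqMajorant k x y ^ 2) * ∫⁻ y, ‖ψ.fn y‖ₑ ^ 2 := by
  have hx : Measurable fun z => k z x := h.kmeas.comp measurable_prodMk_right
  have hψ := ψ.memLp.1.enorm
  have h1 : ∫⁻ z, ‖S.adjKernel K x z (intOp K ψ.fn z)‖ₑ
      ≤ 2 * ∫⁻ y, sqMajorant k x y * ‖ψ.fn y‖ₑ := by
    have hm : AEMeasurable (Function.uncurry fun z y => k z x * (k z y * ‖ψ.fn y‖ₑ))
        (volume.prod volume) :=
      (hx.comp measurable_fst).aemeasurable.mul (h.aemeasurable_kmul hψ)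
    calc _ ≤ ∫⁻ z, 2 * ∫⁻ y, k z x * (k z y * ‖ψ.fn y‖ₑ) := by
          refine lintegral_mono fun z => ?_
          refine ((S.schurKernel_adjKernel h).enorm_apply_le x z _).trans ?_
          have e : ∫⁻ y, k z x * (k z y * ‖ψ.fn y‖ₑ) = k z x * ∫⁻ y, k z y * ‖ψ.fn y‖ₑ :=
            lintegral_const_mul'' _ ((h.kmeas_left z).aemeasurable.mul hψ)
          rw [e, mul_assoc]
          gcongr
          exact h.enorm_intOp_le _ _
      _ = 2 * ∫⁻ z, ∫⁻ y, k z x * (k z y * ‖ψ.fn y‖ₑ) :=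
          lintegral_const_mul' _ _ ENNReal.ofNat_ne_top
      _ = 2 * ∫⁻ y, ∫⁻ z, k z x * (k z y * ‖ψ.fn y‖ₑ) := by rw [lintegral_lintegral_swap hm]
      _ = _ := by
          congr 1
          refine lintegral_congr fun y => ?_
          simp only [← mul_assoc]
          exact lintegral_mul_const' _ _ enorm_ne_top
  have hl : Measurable (sqMajorant k x) :=
    (measurable_sqMajorant h.kmeas).comp measurable_prodMk_left
  calc _ ≤ (2 * ∫⁻ y, sqMajorant k x y * ‖ψ.fn y‖ₑ) ^ 2 := pow_le_pow_left' h1 2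
    _ = 4 * (∫⁻ y, sqMajorant k x y * ‖ψ.fn y‖ₑ) ^ 2 := by rw [mul_pow]; norm_num
    _ ≤ 4 * ((∫⁻ y, sqMajorant k x y ^ 2) * ∫⁻ y, ‖ψ.fn y‖ₑ ^ 2) :=
        mul_le_mul_right (lintegral_mul_sq_le hl.aemeasurable hψ) _
    _ = _ := by rw [mul_assoc]

/-- Bessel's inequality for the values of `T^* T` on an orthonormal family at a point. -/
lemma sum_enorm_intOp_sq_le (h : SchurKernel K k M) {V : ℝ} (hV : V < 1)
    (hS : ∀ x, ‖∇ S.t x‖ ≤ V) {ι : Type*} {v : ι → S.HilbertSpace} (hv : Orthonormal ℂ v)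
    (s : Finset ι) (x : Space) :
    ∑ i ∈ s, ‖intOp (S.adjKernel K) (intOp K (v i).fn) x‖ₑ ^ 2
      ≤ 4 * (4 * (∫⁻ y, sqMajorant k x y ^ 2) * ENNReal.ofReal (1 - V)⁻¹) := by
  have h0 : 0 < 1 - V := by linarith
  have hc0 : ENNReal.ofReal (1 - V)⁻¹ ≠ 0 := by
    rw [Ne, ENNReal.ofReal_eq_zero, not_le]; positivity
  rcases eq_or_ne (∫⁻ y, sqMajorant k x y ^ 2) ⊤ with htop | htop
  · rw [htop, ENNReal.mul_top (by norm_num), ENNReal.top_mul hc0, ENNReal.mul_top (by norm_num)]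
    exact le_top
  set c := 4 * (∫⁻ y, sqMajorant k x y ^ 2) * ENNReal.ofReal (1 - V)⁻¹ with hc
  have hct : c ≠ ⊤ := ENNReal.mul_ne_top (ENNReal.mul_ne_top ENNReal.ofNat_ne_top htop)
    ENNReal.ofReal_ne_top
  have hb : ∀ ψ : S.HilbertSpace, (∫⁻ z, ‖S.adjKernel K x z (intOp K ψ.fn z)‖ₑ) ^ 2
      ≤ c * ‖ψ‖ₑ ^ 2 := fun ψ => by
    refine (S.enorm_intOp_intOp_sq_le h ψ x).trans ?_
    rw [hc, mul_assoc _ (ENNReal.ofReal _)]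
    exact mul_le_mul_right (S.lintegral_fn_le hV hS ψ) _
  have hK := S.schurKernel_adjKernel h
  have hi : ∀ ψ : S.HilbertSpace, Integrable fun z => S.adjKernel K x z (intOp K ψ.fn z) := fun ψ => by
    refine ⟨hK.aestronglyMeasurable_right (h.aestronglyMeasurable_intOp ψ.memLp.1) x, ?_⟩
    have h1 := (hb ψ).trans_lt (ENNReal.mul_lt_top hct.lt_top (ENNReal.pow_lt_top enorm_lt_top))
    rw [HasFiniteIntegral]
    by_contra hne
    rw [not_lt, top_le_iff] at hne
    rw [hne] at h1
    simp at h1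
  -- The value at `x` is a bounded functional of the vector.
  let f0 : S.HilbertSpace →ₗ[ℂ] Spinor :=
    { toFun := fun ψ => intOp (S.adjKernel K) (intOp K ψ.fn) x
      map_add' := fun φ ψ => by
        have e1 : intOp K (φ + ψ).fn =ᵐ[volume] fun z => intOp K φ.fn z + intOp K ψ.fn z := by
          filter_upwards [h.intOp_add φ.memLp ψ.memLp] with z hz
          rw [← hz]
          exact intOp_congr K (HilbertSpace.fn_add φ ψ) z
        rw [intOp_congr _ e1]
        simp only [intOp, map_add]
        exact integral_add (hi φ) (hi ψ)
      map_smul' := fun a ψ => by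
        have e1 : intOp K (a • ψ).fn = fun z => a • intOp K ψ.fn z := by
          ext1 z
          rw [← intOp_smul]
          exact intOp_congr K (HilbertSpace.fn_smul a ψ) z
        rw [e1, intOp_smul, RingHom.id_apply] }
  have hf0 : ∀ ψ, ‖f0 ψ‖ ≤ √c.toReal * ‖ψ‖ := fun ψ => by
    have h1 : ‖f0 ψ‖ₑ ^ 2 ≤ c * ‖ψ‖ₑ ^ 2 :=
      (pow_le_pow_left' (enorm_integral_le_lintegral_enorm _) 2).trans (hb ψ)
    rw [← ENNReal.ofReal_toReal hct, ← ofReal_norm, ← ofReal_norm,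
      ← ENNReal.ofReal_pow (norm_nonneg _), ← ENNReal.ofReal_pow (norm_nonneg _),
      ← ENNReal.ofReal_mul ENNReal.toReal_nonneg, ENNReal.ofReal_le_ofReal_iff (by positivity)] at h1
    refine abs_le_of_sq_le_sq' ?_ (by positivity) |>.2
    rw [mul_pow, Real.sq_sqrt ENNReal.toReal_nonneg]
    exact h1
  let f : S.HilbertSpace →L[ℂ] Spinor := f0.mkContinuous _ hf0
  have h2 := sum_norm_sq_apply_le f hv s
  have h3 : ‖f‖ ^ 2 ≤ c.toReal := by
    have := LinearMap.mkContinuous_norm_le f0 (Real.sqrt_nonneg _) hf0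
    calc ‖f‖ ^ 2 ≤ √c.toReal ^ 2 := by gcongr
      _ = _ := Real.sq_sqrt ENNReal.toReal_nonneg
  have h4 : ∑ i ∈ s, ‖f (v i)‖ ^ 2 ≤ 4 * c.toReal := by linarith
  have h5 := ENNReal.ofReal_le_ofReal h4
  rw [ENNReal.ofReal_sum_of_nonneg fun _ _ => sq_nonneg _, ENNReal.ofReal_mul (by norm_num),
    ENNReal.ofReal_toReal hct, ENNReal.ofReal_ofNat] at h5
  refine le_trans (le_of_eq (Finset.sum_congr rfl fun i _ => ?_)) h5
  rw [ENNReal.ofReal_pow (norm_nonneg _), ofReal_norm]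
  rfl

/-- If the kernel of `T^* T` is dominated by a square integrable function then `T^* T` is a
Hilbert–Schmidt operator. -/
lemma isHilbertSchmidt_kernelOp (h : SchurKernel K k M)
    (hsq : ∫⁻ x, ∫⁻ y, sqMajorant k x y ^ 2 < ⊤) :
    IsHilbertSchmidt (ContinuousLinearMap.adjoint (S.kernelOp h) ∘L S.kernelOp h) := by
  obtain ⟨V, hV, hS⟩ := S.spacelike
  intro ι b
  set c := ENNReal.ofReal (1 - V)⁻¹ with hc
  set B := c * (4 * (4 * (∫⁻ x, ∫⁻ y, sqMajorant k x y ^ 2) * c)) with hB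
  have hct : c < ⊤ := ENNReal.ofReal_lt_top
  have hBt : B < ⊤ := ENNReal.mul_lt_top hct (ENNReal.mul_lt_top ENNReal.ofNat_lt_top
    (ENNReal.mul_lt_top (ENNReal.mul_lt_top ENNReal.ofNat_lt_top hsq) hct))
  refine summable_of_sum_le (c := B.toReal) (fun i => sq_nonneg _) fun s => ?_
  have h1 : ∑ i ∈ s, ‖(ContinuousLinearMap.adjoint (S.kernelOp h) ∘L S.kernelOp h) (b i)‖ₑ ^ 2
      ≤ B := by
    calc _ ≤ ∑ i ∈ s, c * ∫⁻ x, ‖intOp (S.adjKernel K) (intOp K (b i).fn) x‖ₑ ^ 2 :=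
          Finset.sum_le_sum fun i _ => S.enorm_adjoint_kernelOp_sq_le h hV hS (b i)
      _ = c * ∫⁻ x, ∑ i ∈ s, ‖intOp (S.adjKernel K) (intOp K (b i).fn) x‖ₑ ^ 2 := by
          rw [← Finset.mul_sum, lintegral_finsetSum' _ fun i _ =>
            (((S.schurKernel_adjKernel h).memLp_intOp
              (h.memLp_intOp (b i).memLp)).1.enorm.pow_const 2)]
      _ ≤ c * ∫⁻ x, 4 * (4 * (∫⁻ y, sqMajorant k x y ^ 2) * c) := by
          gcongr with x
          exact S.sum_enorm_intOp_sq_le h hV hS b.orthonormal s x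
      _ = B := by
          rw [lintegral_const_mul' _ _ ENNReal.ofNat_ne_top, lintegral_mul_const' _ _ hct.ne,
            lintegral_const_mul' _ _ ENNReal.ofNat_ne_top]
  have h2 : ENNReal.ofReal (∑ i ∈ s,
      ‖(ContinuousLinearMap.adjoint (S.kernelOp h) ∘L S.kernelOp h) (b i)‖ ^ 2) ≤ B := by
    rw [ENNReal.ofReal_sum_of_nonneg fun _ _ => sq_nonneg _]
    refine le_trans (le_of_eq (Finset.sum_congr rfl fun i _ => ?_)) h1
    rw [ENNReal.ofReal_pow (norm_nonneg _), ofReal_norm]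
  exact (ENNReal.ofReal_le_iff_le_toReal hBt.ne).1 h2

end CauchySurface


/-! ### Integrals of the majorant -/

lemma lintegral_rpow_norm_mul_exp_lt_top {s c : ℝ} (hs : -3 < s) (hc : 0 < c) (D : ℝ) :
    ∫⁻ z : Space, ENNReal.ofReal (D * (‖z‖ ^ s * Real.exp (-c * ‖z‖))) < ⊤ :=
  ((integrable_rpow_norm_mul_exp hs hc).const_mul D).lintegral_lt_top

/-- The majorant of the kernel with values in `[0, ∞]`. -/
def emajorant (C c R : ℝ) (x y : Space) : ENNReal := ENNReal.ofReal (majorant C c R x y)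

lemma measurable_emajorant (C c R : ℝ) : Measurable (Function.uncurry (emajorant C c R)) :=
  (measurable_majorant C c R).ennreal_ofReal

lemma majorant_le {C : ℝ} (hC : 0 ≤ C) (c R : ℝ) (x y : Space) :
    majorant C c R x y ≤ 2 * C * (‖y - x‖ ^ (-2 : ℝ) * Real.exp (-c * ‖y - x‖)) := by
  have h1 := ballInd_le_one R x
  have h2 := ballInd_le_one R y
  have h3 : 0 ≤ C * (‖y - x‖ ^ (-2 : ℝ) * Real.exp (-c * ‖y - x‖)) := by positivity
  rw [majorant]
  nlinarith

lemma majorant_rpow_le {C : ℝ} (hC : 0 ≤ C) (c R : ℝ) (x y : Space) :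
    majorant C c R x y ^ (4 / 3 : ℝ) ≤ 2 * C ^ (4 / 3 : ℝ) *
      (‖y - x‖ ^ (-(8 / 3) : ℝ) * Real.exp (-(4 / 3 * c) * ‖y - x‖)) *
        (ballInd R x + ballInd R y) := by
  have h1 := ballInd_le_one R x
  have h2 := ballInd_le_one R y
  have h0 : 0 ≤ ballInd R x + ballInd R y := add_nonneg (ballInd_nonneg R x) (ballInd_nonneg R y)
  rw [majorant, Real.mul_rpow (by positivity) h0, Real.mul_rpow hC (by positivity),
    Real.mul_rpow (by positivity) (by positivity), ← Real.rpow_mul (norm_nonneg _), ← Real.exp_mul]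
  have e1 : (-2 : ℝ) * (4 / 3) = -(8 / 3) := by norm_num
  have e2 : -c * ‖y - x‖ * (4 / 3) = -(4 / 3 * c) * ‖y - x‖ := by ring
  rw [e1, e2]
  have h3 : (ballInd R x + ballInd R y) ^ (4 / 3 : ℝ) ≤ 2 * (ballInd R x + ballInd R y) := by
    rw [show (4 / 3 : ℝ) = 1 / 3 + 1 by norm_num, Real.rpow_add_one' h0 (by norm_num)]
    refine mul_le_mul_of_nonneg_right ?_ h0
    calc (ballInd R x + ballInd R y) ^ (1 / 3 : ℝ) ≤ 2 ^ (1 / 3 : ℝ) :=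
          Real.rpow_le_rpow h0 (by linarith) (by norm_num)
      _ ≤ 2 ^ (1 : ℝ) := Real.rpow_le_rpow_of_exponent_le (by norm_num) (by norm_num)
      _ = 2 := Real.rpow_one 2
  have h4 : 0 ≤ C ^ (4 / 3 : ℝ) *
      (‖y - x‖ ^ (-(8 / 3) : ℝ) * Real.exp (-(4 / 3 * c) * ‖y - x‖)) := by positivity
  nlinarith [mul_le_mul_of_nonneg_left h3 h4]

lemma emajorant_rpow {C : ℝ} (hC : 0 ≤ C) (c R : ℝ) (x y : Space) :
    emajorant C c R x y ^ (4 / 3 : ℝ) = ENNReal.ofReal (majorant C c R x y ^ (4 / 3 : ℝ)) :=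
  ENNReal.ofReal_rpow_of_nonneg (majorant_nonneg hC c R x y) (by norm_num)

lemma lintegral_emajorant_le {C : ℝ} (hC : 0 ≤ C) (c R : ℝ) :
    (∀ x, ∫⁻ y, emajorant C c R x y ≤
      ∫⁻ z : Space, ENNReal.ofReal (2 * C * (‖z‖ ^ (-2 : ℝ) * Real.exp (-c * ‖z‖)))) ∧
    ∀ y, ∫⁻ x, emajorant C c R x y ≤
      ∫⁻ z : Space, ENNReal.ofReal (2 * C * (‖z‖ ^ (-2 : ℝ) * Real.exp (-c * ‖z‖))) := by
  have h : ∀ x y, emajorant C c R x y ≤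
      ENNReal.ofReal (2 * C * (‖y - x‖ ^ (-2 : ℝ) * Real.exp (-c * ‖y - x‖))) := fun x y =>
    ENNReal.ofReal_le_ofReal (majorant_le hC c R x y)
  constructor
  · intro x
    refine (lintegral_mono fun y => h x y).trans_eq ?_
    exact lintegral_sub_right_eq_self (fun z : Space =>
      ENNReal.ofReal (2 * C * (‖z‖ ^ (-2 : ℝ) * Real.exp (-c * ‖z‖)))) x
  · intro y
    refine (lintegral_mono fun x => h x y).trans_eq ?_
    exact lintegral_sub_left_eq_self (fun z : Space =>
      ENNReal.ofReal (2 * C * (‖z‖ ^ (-2 : ℝ) * Real.exp (-c * ‖z‖)))) y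

lemma lintegral_sqMajorant_emajorant_lt_top {C c : ℝ} (hC : 0 ≤ C) (hc : 0 < c) (R : ℝ) :
    ∫⁻ x, ∫⁻ y, sqMajorant (emajorant C c R) x y ^ 2 < ⊤ := by
  -- The power `|z|^{-8/3}` is still integrable in three dimensions, which fails for the square
  -- `|z|^{-4}` of the kernel.
  let Q : Space → ENNReal := fun z => ENNReal.ofReal (2 * C ^ (4 / 3 : ℝ) *
    (‖z‖ ^ (-(8 / 3) : ℝ) * Real.exp (-(4 / 3 * c) * ‖z‖)))
  let b : Space → ENNReal := fun x => ENNReal.ofReal (ballInd R x)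
  have hQ : ∫⁻ z, Q z < ⊤ :=
    lintegral_rpow_norm_mul_exp_lt_top (by norm_num) (by positivity) _
  have hQm : Measurable Q := by
    refine Measurable.ennreal_ofReal (measurable_const.mul ((measurable_norm.pow_const _).mul ?_))
    exact Real.measurable_exp.comp (measurable_const.mul measurable_norm)
  have hbm : Measurable b := (measurable_ballInd R).ennreal_ofReal
  have hb1 : ∀ x, b x ≤ 1 := fun x => ENNReal.ofReal_le_one.2 (ballInd_le_one R x)
  have hbi : ∫⁻ x, b x < ⊤ := by
    have e : b = (Metric.closedBall (0 : Space) R).indicator fun _ => 1 := by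
      funext x
      by_cases hx : x ∈ Metric.closedBall (0 : Space) R
      · simp only [b, ballInd, indicator_of_mem hx, ENNReal.ofReal_one]
      · simp only [b, ballInd, indicator_of_notMem hx, ENNReal.ofReal_zero]
    rw [e, lintegral_indicator_const Metric.isClosed_closedBall.measurableSet, one_mul]
    exact (isCompact_closedBall _ _).measure_lt_top
  have h : ∀ x y, emajorant C c R x y ^ (4 / 3 : ℝ) ≤ Q (y - x) * (b x + b y) := fun x y => by
    rw [emajorant_rpow hC]
    simp only [Q, b]
    rw [← ENNReal.ofReal_add (ballInd_nonneg R x) (ballInd_nonneg R y),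
      ← ENNReal.ofReal_mul (by positivity)]
    exact ENNReal.ofReal_le_ofReal (majorant_rpow_le hC c R x y)
  have hr : ∀ x, ∫⁻ y, Q (y - x) = ∫⁻ z, Q z := lintegral_sub_right_eq_self Q
  have hl : ∀ y, ∫⁻ x, Q (y - x) = ∫⁻ z, Q z := lintegral_sub_left_eq_self Q
  have h2 : ∀ x y, emajorant C c R x y ^ (4 / 3 : ℝ) ≤ Q (y - x) * 2 := fun x y =>
    (h x y).trans (mul_le_mul_right ((add_le_add (hb1 x) (hb1 y)).trans_eq one_add_one_eq_two) _)
  refine lintegral_sqMajorant_lt_top (N := (∫⁻ z, Q z) * 2) (measurable_emajorant C c R)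
    (ENNReal.mul_lt_top hQ ENNReal.ofNat_lt_top) (fun x => ?_) (fun y => ?_) ?_
  · refine (lintegral_mono fun y => h2 x y).trans_eq ?_
    rw [lintegral_mul_const' _ _ ENNReal.ofNat_ne_top, hr]
  · refine (lintegral_mono fun x => h2 x y).trans_eq ?_
    rw [lintegral_mul_const' _ _ ENNReal.ofNat_ne_top, hl]
  · have hm1 : Measurable fun q : Space × Space => Q (q.2 - q.1) * b q.1 :=
      (hQm.comp (measurable_snd.sub measurable_fst)).mul (hbm.comp measurable_fst)
    have hm2 : Measurable (Function.uncurry fun x y : Space => Q (y - x) * b y) :=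
      (hQm.comp (measurable_snd.sub measurable_fst)).mul (hbm.comp measurable_snd)
    have e1 : ∫⁻ x, ∫⁻ y, Q (y - x) * b x = (∫⁻ z, Q z) * ∫⁻ x, b x := by
      rw [← lintegral_const_mul _ hbm]
      refine lintegral_congr fun x => ?_
      rw [lintegral_mul_const' _ _ ENNReal.ofReal_ne_top, hr]
    have e2 : ∫⁻ x, ∫⁻ y, Q (y - x) * b y = (∫⁻ z, Q z) * ∫⁻ x, b x := by
      rw [lintegral_lintegral_swap hm2.aemeasurable, ← lintegral_const_mul _ hbm]
      refine lintegral_congr fun y => ?_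
      rw [lintegral_mul_const' _ _ ENNReal.ofReal_ne_top, hl]
    have hfin : (∫⁻ z, Q z) * ∫⁻ x, b x < ⊤ := ENNReal.mul_lt_top hQ hbi
    calc _ ≤ ∫⁻ x, ∫⁻ y, (Q (y - x) * b x + Q (y - x) * b y) :=
          lintegral_mono fun x => lintegral_mono fun y => (h x y).trans_eq (mul_add _ _ _)
      _ = ∫⁻ x, ((∫⁻ y, Q (y - x) * b x) + ∫⁻ y, Q (y - x) * b y) :=
          lintegral_congr fun x => lintegral_add_left (hm1.comp measurable_prodMk_left) _
      _ = (∫⁻ x, ∫⁻ y, Q (y - x) * b x) + ∫⁻ x, ∫⁻ y, Q (y - x) * b y :=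
          lintegral_add_left hm1.lintegral_prod_right' _
      _ < ⊤ := by
          rw [e1, e2]
          exact ENNReal.add_lt_top.2 ⟨hfin, hfin⟩

/-- A bound for the majorant in the Schur test, independent of the surface. -/
def schurConst (C c : ℝ) : ENNReal :=
  ∫⁻ z : Space, ENNReal.ofReal (2 * C * (‖z‖ ^ (-2 : ℝ) * Real.exp (-c * ‖z‖)))

lemma schurKernel_of_le_majorant {K : Space → Space → Spinor →L[ℂ] Spinor} {C c R : ℝ}
    (hC : 0 ≤ C) (hc : 0 < c) (hK : StronglyMeasurable (Function.uncurry K))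
    (h : ∀ x y, ‖K x y‖ ≤ majorant C c R x y) :
    SchurKernel K (emajorant C c R) (schurConst C c) where
  meas := hK
  kmeas := measurable_emajorant C c R
  bound x y := by
    rw [← ofReal_norm]
    exact ENNReal.ofReal_le_ofReal (h x y)
  right := (lintegral_emajorant_le hC c R).1
  left := (lintegral_emajorant_le hC c R).2
  lt_top := lintegral_rpow_norm_mul_exp_lt_top (by norm_num) hc _

/-! ### Symmetry of the kernel -/

lemma besselB_ofReal (a : ℝ) : ∃ b : ℝ, besselB (a : ℂ) = b := by
  refine ⟨∫ s in Ioi (1 : ℝ), Real.exp (-a * s) * √(s ^ 2 - 1), ?_⟩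
  rw [besselB, ← integral_complex_ofReal]
  refine integral_congr_ae (Eventually.of_forall fun s => ?_)
  simp

lemma besselB'_ofReal (a : ℝ) : ∃ b : ℝ, besselB' (a : ℂ) = b := by
  refine ⟨∫ s in Ioi (1 : ℝ), Real.exp (-a * s) * (-s) * √(s ^ 2 - 1), ?_⟩
  rw [besselB', ← integral_complex_ofReal]
  refine integral_congr_ae (Eventually.of_forall fun s => ?_)
  simp

lemma slash_neg (z : Spacetime) : slash (-z) = -slash z := by
  simp only [slash, Pi.neg_apply, mul_neg, Complex.ofReal_neg, neg_smul, Finset.sum_neg_distrib]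

lemma gam_zero_mul_conjTranspose (μ : Fin 4) : gam 0 * (gam μ).conjTranspose = gam μ * gam 0 := by
  have h := gam_zero_mul_gam_conjTranspose μ
  rw [Matrix.conjTranspose_mul, gam_zero_conjTranspose] at h
  calc gam 0 * (gam μ).conjTranspose
      = gam 0 * ((gam μ).conjTranspose * gam 0) * gam 0 := by
        rw [mul_assoc, mul_assoc, gam_zero_sq, mul_one]
    _ = _ := by rw [h, ← mul_assoc, gam_zero_sq, one_mul]

lemma gam_zero_mul_slash_conjTranspose (z : Spacetime) :
    gam 0 * (slash z).conjTranspose = slash z * gam 0 := by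
  simp only [slash, Matrix.conjTranspose_sum, Matrix.conjTranspose_smul, Finset.mul_sum,
    Finset.sum_mul, Matrix.mul_smul, Matrix.smul_mul, gam_zero_mul_conjTranspose, RCLike.star_def,
    Complex.conj_ofReal]

lemma cslash_shift_zero (z u : Spacetime) : cslash (shift z 0 u) = slash z := by
  rw [cslash, slash, shift_zero]
  simp only [Complex.ofReal_mul]

/-- At real space-like points the kernel is `iaz̸ + d` with real `a, d` even in `z`. -/
lemma pminus_spacelike {m : ℝ} (hm : 0 < m) {z : Spacetime} (hz : mink z z < 0) (u : Spacetime) :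
    ∃ a d : ℝ, pminus m (shift z 0 u) = (Complex.I * a) • slash z + (d : ℂ) • 1 ∧
      pminus m (shift (-z) 0 u) = -((Complex.I * a) • slash z) + (d : ℂ) • 1 := by
  have hsq : ∀ z : Spacetime, -cminkSq (shift z 0 u) = ((-mink z z : ℝ) : ℂ) := fun z => by
    rw [neg_cminkSq_shift]
    simp
  have hneg : mink (-z) (-z) = mink z z := by simp [mink]
  have hdom : ∀ z : Spacetime, mink z z < 0 → shift z 0 u ∈ kernelDomain := fun z hz => by
    change -cminkSq _ ∈ Complex.slitPlane
    rw [hsq]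
    exact Complex.ofReal_mem_slitPlane.2 (by linarith)
  have hr : ∀ z : Spacetime, mink z z < 0 →
      rfun (shift z 0 u) = (((-mink z z) ^ (1 / 2 : ℝ) : ℝ) : ℂ) := fun z hz => by
    rw [rfun, hsq, Complex.ofReal_cpow (by linarith)]
    norm_num
  set ρ := (-mink z z) ^ (1 / 2 : ℝ)
  obtain ⟨b, hb⟩ := besselB_ofReal (m * ρ)
  obtain ⟨b', hb'⟩ := besselB'_ofReal (m * ρ)
  have e1 := pminus_eq hm (hdom z hz)
  have e2 := pminus_eq hm (hdom (-z) (by rwa [hneg]))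
  rw [hr (-z) (by rwa [hneg]), hneg] at e2
  rw [hr z hz] at e1
  rw [← Complex.ofReal_mul, hb, hb', cslash_shift_zero] at e1 e2
  rw [slash_neg] at e2
  refine ⟨-(m ^ 3 / (4 * Real.pi ^ 2)) * (b' / ρ), -(m ^ 3 / (4 * Real.pi ^ 2)) * b, ?_, ?_⟩
  · rw [e1, smul_add, smul_smul, smul_smul]
    push_cast
    congr 2
    ring
  · rw [e2, smul_add, smul_smul, smul_smul, smul_neg]
    push_cast
    congr 3
    ring

/-- The symmetry `γ⁰ p^-(-z)^* = p^-(z) γ⁰` at real space-like points. -/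
lemma gam_zero_mul_pminus_conjTranspose {m : ℝ} (hm : 0 < m) {z : Spacetime} (hz : mink z z < 0)
    (u : Spacetime) : gam 0 * (pminus m (shift (-z) 0 u)).conjTranspose
      = pminus m (shift z 0 u) * gam 0 := by
  obtain ⟨a, d, h1, h2⟩ := pminus_spacelike hm hz u
  rw [h1, h2]
  simp only [Matrix.conjTranspose_add, Matrix.conjTranspose_neg, Matrix.conjTranspose_smul,
    Matrix.conjTranspose_one, mul_add, add_mul, Matrix.mul_smul, Matrix.smul_mul, mul_one,
    one_mul, gam_zero_mul_slash_conjTranspose, RCLike.star_def, map_mul, Complex.conj_I,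
    Complex.conj_ofReal, neg_mul, neg_smul, neg_neg]

namespace CauchySurface

variable (S : CauchySurface)

lemma mink_param_sub_neg {x y : Space} (h : x ≠ y) :
    mink (S.param y - S.param x) (S.param y - S.param x) < 0 := by
  obtain ⟨V, hV, hS⟩ := S.spacelike
  have hV0 : 0 ≤ V := (norm_nonneg _).trans (hS 0)
  have h0 : 0 < ‖y - x‖ := norm_pos_iff.2 (sub_ne_zero.2 h.symm)
  rw [mink_self, S.spat_param_sub, S.param_sub_zero]
  have h1 := S.abs_t_sub_le hS x y
  have h2 : |S.t y - S.t x| < ‖y - x‖ := by nlinarith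
  have h3 := sq_lt_sq' (by linarith [abs_nonneg (S.t y - S.t x)]) h2
  rw [sq_abs] at h3
  linarith

lemma diffKernel_symm {m : ℝ} (hm : 0 < m) {lam : Spacetime → Spacetime → ℝ}
    (hlam : ∀ x ∈ S.carrier, ∀ y ∈ S.carrier, lam x y = -lam y x) (x y : Space) (v w : Spinor) :
    ⟪S.weight x v, S.diffKernel m lam x y w⟫_ℂ = ⟪S.diffKernel m lam y x v, S.weight y w⟫_ℂ := by
  rcases eq_or_ne x y with rfl | hxy
  · simp [diffKernel]
  rw [S.diffKernel_of_ne m lam refPast hxy, S.diffKernel_of_ne m lam refPast hxy.symm,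
    smul_apply, smul_apply, inner_smul_left, inner_smul_right, kernelMap, kernelMap, act_mul_Gam,
    act_mul_Gam]
  have e1 : (starRingEnd ℂ) (Complex.exp (-Complex.I * (lam (S.param y) (S.param x) : ℝ)) - 1)
      = Complex.exp (-Complex.I * (lam (S.param x) (S.param y) : ℝ)) - 1 := by
    rw [hlam _ ⟨x, rfl⟩ _ ⟨y, rfl⟩, map_sub, map_one, ← Complex.exp_conj]
    simp
  rw [e1]
  congr 1
  have e2 : S.param x - S.param y = -(S.param y - S.param x) := (neg_sub _ _).symm
  rw [inner_act_left, inner_act_left, gam_zero_conjTranspose, ← act_mul, ← act_mul, e2,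
    gam_zero_mul_pminus_conjTranspose hm (S.mink_param_sub_neg hxy)]

lemma schurKernel_diffKernel {m : ℝ} (hm : 0 < m) {A : Spacetime → Spacetime}
    {lam : Spacetime → Spacetime → ℝ} (hlam : IsLocalGauge A lam) {C c R : ℝ} (hC : 0 ≤ C)
    (hc : 0 < c) (h : ∀ (ε : ℝ) (x y : Space), 0 ≤ ε → x ≠ y →
      ‖(Complex.exp (-Complex.I * (lam (S.param x) (S.param y) : ℝ)) - 1) •
        S.kernelMap m ε refPast x y‖ ≤ majorant C c R x y) :
    SchurKernel (S.diffKernel m lam) (emajorant C c R) (schurConst C c) := by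
  refine schurKernel_of_le_majorant hC hc (S.measurable_diffKernel hm hlam) fun x y => ?_
  rcases eq_or_ne x y with rfl | hxy
  · rw [diffKernel, if_pos rfl, norm_zero]
    exact majorant_nonneg hC c R x x
  · rw [S.diffKernel_of_ne m lam refPast hxy]
    exact h 0 x y le_rfl hxy

end CauchySurface


/-! ### The regularized matrix elements with gauge factor -/

namespace CauchySurface

variable (S : CauchySurface)

/-- With regularization the kernel has no singularity on the diagonal. -/
lemma continuous_kernelMap {m : ℝ} (hm : 0 < m) {ε : ℝ} (hε : 0 < ε) {u : Spacetime}
    (hu : u ∈ Past) : Continuous fun q : Space × Space => S.kernelMap m ε u q.1 q.2 := by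
  have h := S.continuousOn_kernelMap hm u (s := {q | q.1 = ε}) fun q hq => by
    rw [show q.1 = ε from hq]
    exact tube_subset_kernelDomain (shift_mem_tube _ hε hu)
  exact h.comp_continuous (f := fun q : Space × Space => (ε, q))
    (continuous_const.prodMk continuous_id) fun q => rfl

lemma continuous_regIntegrand {m : ℝ} (hm : 0 < m) {ε : ℝ} (hε : 0 < ε) {u : Spacetime}
    (hu : u ∈ Past) {g : Space × Space → ℂ} (hg : Continuous g) (ψ : TestSpinor) :
    Continuous fun q : Space × Space => g q • S.kernelMap m ε u q.1 q.2 (ψ.1 q.2) :=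
  hg.smul ((S.continuous_kernelMap hm hε hu).clm_apply (ψ.2.1.continuous.comp continuous_snd))

lemma integrable_regIntegrand {m : ℝ} (hm : 0 < m) {ε : ℝ} (hε : 0 < ε) {u : Spacetime}
    (hu : u ∈ Past) {g : Space × Space → ℂ} (hg : Continuous g) (φ ψ : TestSpinor) :
    Integrable (fun q : Space × Space =>
      ⟪S.weight q.1 (φ.1 q.1), g q • S.kernelMap m ε u q.1 q.2 (ψ.1 q.2)⟫_ℂ)
      (volume.prod volume) := by
  refine Continuous.integrable_of_hasCompactSupport
    (((S.continuous_weight_apply φ).comp continuous_fst).inner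
      (S.continuous_regIntegrand hm hε hu hg ψ)) ?_
  refine HasCompactSupport.intro
    ((show IsCompact (tsupport φ.1) from φ.2.2).prod (show IsCompact (tsupport ψ.1) from ψ.2.2))
    fun q hq => ?_
  by_cases h : q.1 ∈ tsupport φ.1
  · have h2 : ψ.1 q.2 = 0 := image_eq_zero_of_notMem_tsupport fun h' => hq ⟨h, h'⟩
    simp only [h2, map_zero, smul_zero, inner_zero_right]
  · simp only [image_eq_zero_of_notMem_tsupport h, map_zero, inner_zero_left]

/-- The regularized matrix element as an integral over the product of the surface with itself. -/
lemma regElement_eq {m : ℝ} (hm : 0 < m) {ε : ℝ} (hε : 0 < ε) {u : Spacetime} (hu : u ∈ Past)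
    {lam : Spacetime → Spacetime → ℝ} (hg : Continuous fun q : Space × Space =>
      Complex.exp (-Complex.I * (lam (S.param q.1) (S.param q.2) : ℝ))) (φ ψ : TestSpinor) :
    S.regElement m lam ε u φ ψ = ∫ q : Space × Space, ⟪S.weight q.1 (φ.1 q.1),
      Complex.exp (-Complex.I * (lam (S.param q.1) (S.param q.2) : ℝ)) •
        S.kernelMap m ε u q.1 q.2 (ψ.1 q.2)⟫_ℂ ∂(volume.prod volume) := by
  rw [integral_prod _ (S.integrable_regIntegrand hm hε hu hg φ ψ), regElement]
  refine integral_congr_ae (Eventually.of_forall fun x => ?_)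
  have hc : Continuous fun y => Complex.exp (-Complex.I * (lam (S.param x) (S.param y) : ℝ)) •
      S.kernelMap m ε u x y (ψ.1 y) :=
    (S.continuous_regIntegrand hm hε hu hg ψ).comp (continuous_const.prodMk continuous_id)
  have hi := hc.integrable_of_hasCompactSupport (μ := (volume : Measure Space))
    (ψ.2.2.mono fun y hy hy' => hy (by simp only [hy', map_zero, smul_zero]))
  exact (S.inner_weight_symm x _ _).symm.trans (integral_inner hi (S.weight x (φ.1 x))).symm

lemma tendsto_kernelMap {m : ℝ} (hm : 0 < m) {u : Spacetime} (hu : u ∈ Past) {x y : Space}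
    (h : x ≠ y) : Tendsto (fun ε => S.kernelMap m ε u x y) (𝓝[>] 0)
      (𝓝 (S.kernelMap m 0 u x y)) := by
  have h1 := S.continuousOn_kernelMap hm u (s := {q | 0 ≤ q.1 ∧ q.2.1 ≠ q.2.2}) fun q hq =>
    S.shift_mem_kernelDomain _ _ hq.1 hu hq.2
  have h2 : ContinuousOn (fun ε => S.kernelMap m ε u x y) (Ici 0) :=
    h1.comp (f := fun ε : ℝ => (ε, x, y))
      (continuous_id.prodMk continuous_const).continuousOn fun ε hε => ⟨hε, h⟩
  exact (h2 0 (mem_Ici.2 le_rfl)).mono_left (nhdsWithin_mono _ Ioi_subset_Ici_self)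

/-- The majorant defines a bounded bilinear form. Only the majorant matters, so the Schur test is
applied with the zero kernel. -/
lemma integrable_majorant_mul {C c : ℝ} (hC : 0 ≤ C) (hc : 0 < c) (R : ℝ) {f g : Space → Spinor}
    (hf : MemLp f 2 volume) (hg : MemLp g 2 volume) :
    Integrable (fun q : Space × Space => ‖f q.1‖ * (majorant C c R q.1 q.2 * ‖g q.2‖))
      (volume.prod volume) := by
  have h : SchurKernel (fun _ _ => (0 : Spinor →L[ℂ] Spinor)) (emajorant C c R)
      (schurConst C c) := schurKernel_of_le_majorant hC hc stronglyMeasurable_const fun x y => by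
    rw [norm_zero]
    exact majorant_nonneg hC c R x y
  refine ⟨(hf.1.norm.comp_quasiMeasurePreserving Measure.quasiMeasurePreserving_fst).mul
    ((measurable_majorant C c R).aestronglyMeasurable.mul
      (hg.1.norm.comp_quasiMeasurePreserving Measure.quasiMeasurePreserving_snd)), ?_⟩
  refine lt_of_le_of_lt (lintegral_mono fun q => ?_) (h.lintegral_bilin_lt_top hf.1.enorm
    hg.1.enorm ((memLp_two_iff_lintegral hf.1).1 hf) ((memLp_two_iff_lintegral hg.1).1 hg))
  rw [enorm_mul, enorm_mul, enorm_norm, enorm_norm,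
    Real.enorm_eq_ofReal (majorant_nonneg hC c R _ _)]
  exact le_rfl

lemma ae_fst_ne_snd : ∀ᵐ q : Space × Space ∂(volume.prod volume), q.1 ≠ q.2 := by
  have hcl : IsClosed {q : Space × Space | q.1 = q.2} := isClosed_eq continuous_fst continuous_snd
  have h : (volume.prod volume) {q : Space × Space | q.1 = q.2} = 0 := by
    rw [Measure.measure_prod_null hcl.measurableSet]
    refine Eventually.of_forall fun x => ?_
    have : Prod.mk x ⁻¹' {q : Space × Space | q.1 = q.2} = {x} := by
      ext y
      exact eq_comm
    change volume (Prod.mk x ⁻¹' {q : Space × Space | q.1 = q.2}) = 0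
    rw [this]
    exact measure_singleton x
  exact measure_eq_zero_iff_ae_notMem.1 h

/-- The contribution of `e^{-iλ} - 1` to the regularized matrix elements converges by dominated
convergence, since this factor makes the kernel integrable at the diagonal. -/
lemma tendsto_regElement_sub {m : ℝ} (hm : 0 < m) {u : Spacetime} (hu : u ∈ Past)
    {A : Spacetime → Spacetime} {lam : Spacetime → Spacetime → ℝ} (hlam : IsLocalGauge A lam)
    {k : Space → Space → ENNReal} {M : ENNReal} (h : SchurKernel (S.diffKernel m lam) k M)
    (φ ψ : TestSpinor) :
    Tendsto (fun ε => S.regElement m lam ε u φ ψ - S.regElement m (fun _ _ => 0) ε u φ ψ)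
      (𝓝[>] 0) (𝓝 ⟪S.ofTest φ, S.kernelOp h (S.ofTest ψ)⟫_ℂ) := by
  obtain ⟨V, hV, hS⟩ := S.spacelike
  obtain ⟨C, c, R, hC, hc, hmaj⟩ := exists_majorant hm ((norm_nonneg _).trans (hS 0)) hV hu hlam
  have hg0 : Continuous fun q : Space × Space => Complex.exp (-Complex.I *
      (((fun _ _ => 0 : Spacetime → Spacetime → ℝ) (S.param q.1) (S.param q.2) : ℝ) : ℂ)) :=
    continuous_const
  have hg := S.continuous_gauge_factor hlam
  let e : Space × Space → ℂ := fun q =>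
    Complex.exp (-Complex.I * (lam (S.param q.1) (S.param q.2) : ℝ)) - 1
  have he : Continuous e := hg.sub continuous_const
  let F : ℝ → Space × Space → ℂ := fun ε q =>
    ⟪S.weight q.1 (φ.1 q.1), (e q • S.kernelMap m ε u q.1 q.2) (ψ.1 q.2)⟫_ℂ
  have hlim : Tendsto (fun ε => ∫ q, F ε q ∂(volume.prod volume)) (𝓝[>] 0) (𝓝 (∫ q : Space × Space,
      ⟪S.weight q.1 (φ.1 q.1), S.diffKernel m lam q.1 q.2 (ψ.1 q.2)⟫_ℂ ∂(volume.prod volume))) := by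
    refine tendsto_integral_filter_of_dominated_convergence _ ?_ ?_
      (integrable_majorant_mul hC hc R (S.memLp_weight
        (φ.2.1.continuous.memLp_of_hasCompactSupport φ.2.2))
        (ψ.2.1.continuous.memLp_of_hasCompactSupport ψ.2.2)) ?_
    · filter_upwards [self_mem_nhdsWithin] with ε hε
      exact (S.integrable_regIntegrand hm hε hu he φ ψ).aestronglyMeasurable
    · filter_upwards [self_mem_nhdsWithin] with ε hε
      filter_upwards [ae_fst_ne_snd] with q hq
      refine (norm_inner_le_norm _ _).trans (mul_le_mul_of_nonneg_left ?_ (norm_nonneg _))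
      exact (ContinuousLinearMap.le_opNorm _ _).trans
        (mul_le_mul_of_nonneg_right (hmaj S hS ε _ _ (le_of_lt hε) hq) (norm_nonneg _))
    · filter_upwards [ae_fst_ne_snd] with q hq
      rw [S.diffKernel_of_ne m lam u hq]
      have h1 : Tendsto (fun ε => e q • S.kernelMap m ε u q.1 q.2) (𝓝[>] 0)
          (𝓝 (e q • S.kernelMap m 0 u q.1 q.2)) := (S.tendsto_kernelMap hm hu hq).const_smul (e q)
      exact tendsto_const_nhds.inner
        (((ContinuousLinearMap.apply ℂ Spinor (ψ.1 q.2)).continuous.tendsto _).comp h1)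
  have heq : ⟪S.ofTest φ, S.kernelOp h (S.ofTest ψ)⟫_ℂ = ∫ q : Space × Space,
      ⟪S.weight q.1 (φ.1 q.1), S.diffKernel m lam q.1 q.2 (ψ.1 q.2)⟫_ℂ ∂(volume.prod volume) := by
    rw [S.inner_kernelOp]
    refine integral_congr_ae ?_
    filter_upwards [Measure.quasiMeasurePreserving_fst.ae_eq_comp (S.ofTest_fn φ),
      Measure.quasiMeasurePreserving_snd.ae_eq_comp (S.ofTest_fn ψ)] with q h1 h2
    simp only [Function.comp_apply] at h1 h2
    rw [h1, h2]
  rw [heq]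
  refine hlim.congr' ?_
  filter_upwards [self_mem_nhdsWithin] with ε hε
  rw [S.regElement_eq hm hε hu hg, S.regElement_eq hm hε hu hg0,
    ← integral_sub (S.integrable_regIntegrand hm hε hu hg φ ψ)
      (S.integrable_regIntegrand hm hε hu hg0 φ ψ)]
  refine integral_congr_ae (Eventually.of_forall fun q => ?_)
  simp only [F, e]
  rw [smul_apply, sub_smul, inner_sub_right, Complex.ofReal_zero, mul_zero, Complex.exp_zero]

lemma isRegLimit_add {m : ℝ} (hm : 0 < m) {u : Spacetime} (hu : u ∈ Past)
    {A : Spacetime → Spacetime} {lam : Spacetime → Spacetime → ℝ} (hlam : IsLocalGauge A lam)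
    {k : Space → Space → ENNReal} {M : ENNReal} (h : SchurKernel (S.diffKernel m lam) k M) :
    S.IsRegLimit m lam u (S.Pminus m + S.kernelOp h) := by
  intro φ ψ
  rw [add_apply, inner_add_right]
  refine ((S.isRegLimit_Pminus hm hu φ ψ).add
    (S.tendsto_regElement_sub hm hu hlam h φ ψ)).congr fun ε => ?_
  ring

/-! ### Uniqueness -/

lemma denseRange_ofTest : DenseRange S.ofTest := by
  let e : Lp Spinor 2 (volume : Measure Space) →ₗ[ℂ] S.HilbertSpace := LinearMap.id
  have he : Continuous e := by
    refine AddMonoidHomClass.continuous_of_bound e (√2) fun f => ?_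
    refine abs_le_of_sq_le_sq' ?_ (by positivity) |>.2
    rw [mul_pow, Real.sq_sqrt zero_le_two]
    exact S.norm_sq_le (e f)
  have hs : Function.Surjective e := fun f => ⟨f, rfl⟩
  exact hs.denseRange.comp denseRange_testToLp he

lemma isRegLimit_unique {m : ℝ} {lam : Spacetime → Spacetime → ℝ} {u : Spacetime}
    {P Q : S.HilbertSpace →L[ℂ] S.HilbertSpace} (hP : S.IsRegLimit m lam u P)
    (hQ : S.IsRegLimit m lam u Q) : Q = P := by
  refine ContinuousLinearMap.coeFn_injective
    (S.denseRange_ofTest.equalizer Q.continuous P.continuous (funext fun ψ => ?_))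
  exact S.denseRange_ofTest.eq_of_inner_right ℂ fun φ =>
    tendsto_nhds_unique (hQ φ ψ) (hP φ ψ)

end CauchySurface

end

end DiracSea

theorem lemma2p3 (m : ℝ) (hm : 0 < m) (V : ℝ) (hV0 : 0 < V) (hV1 : V < 1)
    (A : Spacetime → Spacetime) (hA : ContDiff ℝ ∞ A) (hAc : HasCompactSupport A)
    (lam : Spacetime → Spacetime → ℝ) (hlam : IsLocalGauge A lam) :
    ∃ C : ℝ, ∀ S : CauchySurface, (∀ x, ‖∇ S.t x‖ ≤ V) →
      ∃ P : S.HilbertSpace →L[ℂ] S.HilbertSpace,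
        (∀ u ∈ Past, S.IsRegLimit m lam u P) ∧
        (∀ u ∈ Past, ∀ Q : S.HilbertSpace →L[ℂ] S.HilbertSpace,
          S.IsRegLimit m lam u Q → Q = P) ∧
        (∀ ψ : S.HilbertSpace, ∀ᵐ x : Space,
          Integrable (S.diffIntegrand m lam ψ x) ∧
          ((P - S.Pminus m) ψ).fn x = ∫ y : Space, S.diffIntegrand m lam ψ x y) ∧
        ‖P‖ ≤ C ∧
        IsCompactOperator (P - S.Pminus m) ∧
        IsHilbertSchmidt
          (ContinuousLinearMap.adjoint (P - S.Pminus m) ∘L (P - S.Pminus m)) ∧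
        ((∀ x ∈ S.carrier, ∀ y ∈ S.carrier, lam x y = -lam y x) → IsSelfAdjoint P) := by
  obtain ⟨C, c, R, hC, hc, hmaj⟩ := exists_majorant hm hV0.le hV1 refPast_mem hlam
  -- `‖P_Σ^-‖ ≤ 1`, and the second summand is the bound of the Schur test for `T`.
  refine ⟨1 + √(2 * (schurConst C c).toReal ^ 2 * (1 - V)⁻¹), fun S hS => ?_⟩
  have h := S.schurKernel_diffKernel hm hlam hC hc (hmaj S hS)
  have hlim : ∀ u ∈ Past, S.IsRegLimit m lam u (S.Pminus m + S.kernelOp h) :=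
    fun u hu => S.isRegLimit_add hm hu hlam h
  have hHS := S.isHilbertSchmidt_kernelOp h (lintegral_sqMajorant_emajorant_lt_top hC hc R)
  refine ⟨S.Pminus m + S.kernelOp h, hlim, fun u hu Q hQ => S.isRegLimit_unique (hlim u hu) hQ, ?_⟩
  rw [add_sub_cancel_left]
  refine ⟨fun ψ => ?_, ?_, isCompactOperator_of_isHilbertSchmidt _ hHS, hHS, fun hsymm => ?_⟩
  · filter_upwards [h.ae_integrable ψ.memLp, S.kernelOp_fn h ψ] with x h1 h2
    have e : S.diffIntegrand m lam ψ x =ᵐ[volume] fun y => S.diffKernel m lam x y (ψ.fn y) := by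
      filter_upwards [measure_eq_zero_iff_ae_notMem.1 (measure_singleton x)] with y hy
      exact S.diffIntegrand_eq m lam ψ fun hxy => hy hxy.symm
    exact ⟨h1.congr e.symm, h2.trans (integral_congr_ae e).symm⟩
  · exact (norm_add_le _ _).trans (add_le_add (Submodule.starProjection_norm_le _)
      (S.norm_kernelOp_le h hV1 hS))
  · exact (isSelfAdjoint_starProjection (S.negSpace m)).add
      (S.isSelfAdjoint_kernelOp h fun x y v w => S.diffKernel_symm hm hsymm x y v w)
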